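/- **Setting.** Let $(\mathcal M,\otimes,\mathbf 1,c)$ be a braided monoidal category whose underlying category is abelian, complete, cocomplete and satisfies AB5. Assume that $X\otimes-$ and $-\otimes X$ are additive, exact and commute with direct sums, for every object $X$. Bialgebras in $\mathcal M$ are braided bialgebras with respect to $c$ (the comultiplication and the counit are morphisms of unital algebras). A *graded bialgebra* in $\mathcal M$ is a bialgebra $(B,m,u,\Delta,\varepsilon)$ with a decomposition $B=\bigoplus_{n\ge 0}B_n$ such that $m$ maps $\bigoplus_{a+b=n}B_a\otimes B_b$ to $B_n$ and $\Delta$ maps $B_n$ to $\bigoplus_{a+b=n}B_a\otimes B_b$, for every $n$. Then $B_0$ is a bialgebra and $B_1$ is a Hopf bimodule over $B_0$, with the structure given by the components of $m,u,\Delta,\varepsilon$. Put $B[n]=\bigoplus_{i\ge n}B_i$ and $B(n)=\bigoplus_{i<n}B_i$, as subobjects of $B$. For a subobject $I$ of $B$ let $I^2$ be the image of $I\otimes I\to B\otimes B\xrightarrow{m}B$. For subobjects $X,Y$ of $B$ let $X\wedge_B Y$ be the kernel of $B\xrightarrow{\Delta}B\otimes B\to B/X\otimes B/Y$. **The bialgebra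 of type one.** Let $H$ be a bialgebra in $\mathcal M$ and $M$ a Hopf bimodule over $H$, with actions $\mu^l,\mu^r$ and coactions $\rho^l,\rho^r$. * $T=T_H(M)=\bigoplus_n M^{\otimes_H n}$ is the relative tensor algebra, with inclusions $i_0:H\to T$ and $i_1:M\to T$. It is a bialgebra through the morphisms of algebras $\Delta_T,\varepsilon_T$ determined by $\Delta_Ti_0=(i_0\otimes i_0)\Delta_H$, $\Delta_Ti_1=(i_0\otimes i_1)\rho^l+(i_1\otimes i_0)\rho^r$, $\varepsilon_Ti_0=\varepsilon_H$, $\varepsilon_Ti_1=0$. * $T^c=T^c_H(M)=\bigoplus_n M^{\square_H n}$ is the relative cotensor coalgebra, with projections $p_0:T^c\to H$, $p_1:T^c\to M$ and inclusions $j_0:H\to T^c$, $j_1:M\to T^c$. It is a bialgebra through the morphisms of coalgebras $m_{T^c},u_{T^c}$ determined by $p_0m_{T^c}=m_H(p_0\otimes p_0)$, $p_1m_{T^c}=\mu^l(p_0\otimes p_1)+\mu^r(p_1\otimes p_0)$, $p_0u_{T^c}=u_H$, $p_1u_{T^c}=0$. * Let $F:T\to T^c$ be the unique morphism of algebras with $Fi_0=j_0$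 and $Fi_1=j_1$. The *bialgebra of type one* $H[M]$ associated to $H$ and $M$ is the image of $F$, with the unique structure of graded bialgebra for which both $\varphi_F:T\twoheadrightarrow H[M]$ and $\psi_F:H[M]\hookrightarrow T^c$ (where $F=\psi_F\varphi_F$) are morphisms of graded bialgebras. **Theorem.** Let $B$ be a graded bialgebra in $\mathcal M$. Then $B$ is the bialgebra of type one $B_0[B_1]$ associated to $B_0$ and $B_1$ if and only if $$B[2]=B[1]^2\qquad\text{and}\qquad B(2)=B_0\wedge_B B_0$$ as subobjects of $B$. Here "$B$ is $B_0[B_1]$" may be read in either of two ways, and the equivalence holds for both: (i) there is an isomorphism of graded bialgebras $e:B\cong B_0[B_1]$; (ii) there is such an isomorphism $e$ which is moreover compatible with the canonical morphisms, i.e. $e|_{B_0}=\varphi_Fi_0$ and $e|_{B_1}=\varphi_Fi_1$. -/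

import Mathlib

open CategoryTheory MonoidalCategory Limits Opposite MonObj ComonObj

universe v u

set_option linter.unusedSectionVars false
set_option linter.unusedSimpArgs false

namespace TypeOne

noncomputable section

section TensorPowers

variable {D : Type u} [Category.{v} D] [MonoidalCategory D]

/-- A right module over the monoid object `A`. -/
structure RightModule (A : Mon D) where
  X : D
  act : X ⊗ A.X ⟶ X
  act_one : X ◁ η[A.X] ≫ act = (ρ_ X).hom
  act_mul : X ◁ μ[A.X] ≫ act = (α_ X A.X A.X).inv ≫ act ▷ A.X ≫ act

variable [HasCoequalizers D]

section desc
variable {X Y Z W : D} {f g : X ⟶ Y}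

def whiskerLeftDesc [∀ X : D, PreservesColimitsOfShape WalkingParallelPair (tensorLeft X)]
    (k : Z ⊗ Y ⟶ W) (hk : Z ◁ f ≫ k = Z ◁ g ≫ k) : Z ⊗ coequalizer f g ⟶ W :=
  Cofork.IsColimit.desc
    (isColimitOfHasCoequalizerOfPreservesColimit (tensorLeft Z) f g) k hk

@[simp]
lemma whiskerLeft_π_desc [∀ X : D, PreservesColimitsOfShape WalkingParallelPair (tensorLeft X)]
    (k : Z ⊗ Y ⟶ W) (hk : Z ◁ f ≫ k = Z ◁ g ≫ k) :
    Z ◁ coequalizer.π f g ≫ whiskerLeftDesc k hk = k :=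
  Cofork.IsColimit.π_desc'
    (isColimitOfHasCoequalizerOfPreservesColimit (tensorLeft Z) f g) k hk

def whiskerRightDesc [∀ X : D, PreservesColimitsOfShape WalkingParallelPair (tensorRight X)]
    (k : Y ⊗ Z ⟶ W) (hk : f ▷ Z ≫ k = g ▷ Z ≫ k) : coequalizer f g ⊗ Z ⟶ W :=
  Cofork.IsColimit.desc
    (isColimitOfHasCoequalizerOfPreservesColimit (tensorRight Z) f g) k hk

@[simp]
lemma π_whiskerRight_desc [∀ X : D, PreservesColimitsOfShape WalkingParallelPair (tensorRight X)]
    (k : Y ⊗ Z ⟶ W) (hk : f ▷ Z ≫ k = g ▷ Z ≫ k) :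
    coequalizer.π f g ▷ Z ≫ whiskerRightDesc k hk = k :=
  Cofork.IsColimit.π_desc'
    (isColimitOfHasCoequalizerOfPreservesColimit (tensorRight Z) f g) k hk

instance [∀ X : D, PreservesColimitsOfShape WalkingParallelPair (tensorLeft X)] :
    Epi (Z ◁ coequalizer.π f g) :=
  inferInstanceAs (Epi ((tensorLeft Z).map (coequalizer.π f g)))

instance [∀ X : D, PreservesColimitsOfShape WalkingParallelPair (tensorRight X)] :
    Epi (coequalizer.π f g ▷ Z) :=
  inferInstanceAs (Epi ((tensorRight Z).map (coequalizer.π f g)))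
end desc

variable [∀ X : D, PreservesColimitsOfShape WalkingParallelPair (tensorLeft X)]
  [∀ X : D, PreservesColimitsOfShape WalkingParallelPair (tensorRight X)]

variable {A : Mon D}

/-- The relative tensor product `P ⊗_A M`. -/
def relTensor (P : RightModule A) (M : Bimod A A) : D :=
  coequalizer (P.act ▷ M.X) ((α_ P.X A.X M.X).hom ≫ P.X ◁ M.actLeft)

def relTensorπ (P : RightModule A) (M : Bimod A A) :
    P.X ⊗ M.X ⟶ relTensor P M :=
  coequalizer.π (P.act ▷ M.X) ((α_ P.X A.X M.X).hom ≫ P.X ◁ M.actLeft)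

lemma relTensor_condition (P : RightModule A) (M : Bimod A A) :
    P.act ▷ M.X ≫ relTensorπ P M = (α_ P.X A.X M.X).hom ≫ P.X ◁ M.actLeft ≫ relTensorπ P M :=
  (coequalizer.condition (P.act ▷ M.X) ((α_ P.X A.X M.X).hom ≫ P.X ◁ M.actLeft)).trans
    (Category.assoc _ _ _)

/-- The right action of `A` on `P ⊗_A M` induced by the one on `M`. -/
def relTensorAct (P : RightModule A) (M : Bimod A A) :
    relTensor P M ⊗ A.X ⟶ relTensor P M :=
  whiskerRightDesc ((α_ P.X M.X A.X).hom ≫ P.X ◁ M.actRight ≫ relTensorπ P M) <| by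
    have h := M.middle_assoc
    rw [associator_naturality_left_assoc, ← whisker_exchange_assoc, relTensor_condition,
      comp_whiskerRight, Category.assoc, associator_naturality_middle_assoc,
      ← MonoidalCategory.whiskerLeft_comp_assoc, h]
    simp

lemma relTensorπ_act (P : RightModule A) (M : Bimod A A) :
    relTensorπ P M ▷ A.X ≫ relTensorAct P M =
      (α_ P.X M.X A.X).hom ≫ P.X ◁ M.actRight ≫ relTensorπ P M :=
  π_whiskerRight_desc _ _

instance (P : RightModule A) (M : Bimod A A) (Z : D) :
    Epi (relTensorπ P M ▷ Z) :=
  inferInstanceAs (Epi (coequalizer.π (P.act ▷ M.X) ((α_ P.X A.X M.X).hom ≫ P.X ◁ M.actLeft) ▷ Z))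

instance (P : RightModule A) (M : Bimod A A) (Z : D) :
    Epi (Z ◁ relTensorπ P M) :=
  inferInstanceAs (Epi (Z ◁ coequalizer.π (P.act ▷ M.X) ((α_ P.X A.X M.X).hom ≫ P.X ◁ M.actLeft)))

instance (P : RightModule A) (M : Bimod A A) :
    Epi (relTensorπ P M) :=
  inferInstanceAs (Epi (coequalizer.π (P.act ▷ M.X) ((α_ P.X A.X M.X).hom ≫ P.X ◁ M.actLeft)))

abbrev RightModule.tensor (P : RightModule A) (M : Bimod A A) :
    RightModule A where
  X := relTensor P M
  act := relTensorAct P M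
  act_one := by
    rw [← cancel_epi (relTensorπ P M ▷ 𝟙_ D), ← whisker_exchange_assoc, relTensorπ_act,
      associator_naturality_right_assoc, ← MonoidalCategory.whiskerLeft_comp_assoc, M.actRight_one]
    simp
  act_mul := by
    rw [← cancel_epi (relTensorπ P M ▷ (A.X ⊗ A.X)), ← whisker_exchange_assoc, relTensorπ_act,
      associator_naturality_right_assoc, ← MonoidalCategory.whiskerLeft_comp_assoc, M.right_assoc,
      associator_inv_naturality_left_assoc, ← comp_whiskerRight_assoc, relTensorπ_act]
    simp [relTensorπ_act]

/-- `A` as a right module over itself. -/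
abbrev RightModule.regular (A : Mon D) : RightModule A where
  X := A.X
  act := μ
  act_one := mul_one A.X
  act_mul := by simp

/-- For `m : P ⊗ Q ⟶ R` right `A`-linear in `Q`, the morphism `P ⊗ (Q ⊗_A M) ⟶ R ⊗_A M` induced by
`m ⊗ M`. -/
def relTensorLift {P Q R : RightModule A} (M : Bimod A A) (m : P.X ⊗ Q.X ⟶ R.X)
    (hm : P.X ◁ Q.act ≫ m = (α_ _ _ _).inv ≫ m ▷ A.X ≫ R.act) :
    P.X ⊗ relTensor Q M ⟶ relTensor R M :=
  whiskerLeftDesc ((α_ _ _ _).inv ≫ m ▷ M.X ≫ relTensorπ R M) (by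
    rw [associator_inv_naturality_middle_assoc, ← comp_whiskerRight_assoc, hm,
      comp_whiskerRight_assoc, comp_whiskerRight_assoc, relTensor_condition,
      MonoidalCategory.whiskerLeft_comp_assoc, associator_naturality_left_assoc,
      ← whisker_exchange_assoc]
    simp)

lemma relTensorπ_lift {P Q R : RightModule A} (M : Bimod A A) (m : P.X ⊗ Q.X ⟶ R.X)
    (hm : P.X ◁ Q.act ≫ m = (α_ _ _ _).inv ≫ m ▷ A.X ≫ R.act) :
    P.X ◁ relTensorπ Q M ≫ relTensorLift M m hm = (α_ _ _ _).inv ≫ m ▷ M.X ≫ relTensorπ R M :=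
  whiskerLeft_π_desc _ _

lemma relTensorLift_linear {P Q R : RightModule A} (M : Bimod A A) (m : P.X ⊗ Q.X ⟶ R.X)
    (hm : P.X ◁ Q.act ≫ m = (α_ _ _ _).inv ≫ m ▷ A.X ≫ R.act) :
    P.X ◁ (Q.tensor M).act ≫ relTensorLift M m hm =
      (α_ _ _ _).inv ≫ relTensorLift M m hm ▷ A.X ≫ (R.tensor M).act := by
  change P.X ◁ relTensorAct Q M ≫ _ = (α_ P.X (relTensor Q M) A.X).inv ≫ _ ≫ relTensorAct R M
  have : Epi (P.X ◁ relTensorπ Q M ▷ A.X) :=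
    inferInstanceAs (Epi ((tensorRight A.X ⋙ tensorLeft P.X).map
      (coequalizer.π (Q.act ▷ M.X) ((α_ Q.X A.X M.X).hom ≫ Q.X ◁ M.actLeft))))
  rw [← cancel_epi (P.X ◁ relTensorπ Q M ▷ A.X), ← MonoidalCategory.whiskerLeft_comp_assoc,
    relTensorπ_act, associator_inv_naturality_middle_assoc, ← comp_whiskerRight_assoc,
    relTensorπ_lift]
  simp only [MonoidalCategory.whiskerLeft_comp, Category.assoc, relTensorπ_lift, comp_whiskerRight, relTensorπ_act]
  rw [associator_naturality_left_assoc, ← whisker_exchange_assoc]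
  simp

/-- The tensor powers of `M` over `A`: `P 0 = A` and `P (n + 1) = P n ⊗_A M`. -/
def tensorPower (M : Bimod A A) : ℕ → RightModule A
  | 0 => RightModule.regular A
  | n + 1 => (tensorPower M n).tensor M

/-- The canonical right `A`-linear morphisms `P a ⊗ P b ⟶ P (a + b)` of the tensor algebra: for
`b = 0` the action of `A` on `P a`, and then by induction on `b`. -/
def tensorPowerMulAux (M : Bimod A A) (a : ℕ) : ∀ b : ℕ,
    { m : (tensorPower M a).X ⊗ (tensorPower M b).X ⟶ (tensorPower M (a + b)).X //
      (tensorPower M a).X ◁ (tensorPower M b).act ≫ m =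
        (α_ _ _ _).inv ≫ m ▷ A.X ≫ (tensorPower M (a + b)).act }
  | 0 => ⟨(tensorPower M a).act, (tensorPower M a).act_mul⟩
  | b + 1 => ⟨relTensorLift M (tensorPowerMulAux M a b).1 (tensorPowerMulAux M a b).2,
      relTensorLift_linear M _ _⟩

end TensorPowers

section Graded

variable {C : Type u} [Category.{v} C]

/-- A grading of `X`: objects `comp n` and morphisms `inj n` exhibiting `X` as the direct sum
of the `comp n`, for `n : ℕ`. -/
structure Grading (X : C) where
  comp : ℕ → C
  inj : ∀ n, comp n ⟶ X
  isColimit : IsColimit (Cofan.mk X inj)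

namespace Grading

variable {X Y : C} (G : Grading X) (K : Grading Y)

lemma hom_ext {Z : C} {f g : X ⟶ Z} (h : ∀ n, G.inj n ≫ f = G.inj n ≫ g) : f = g :=
  Cofan.IsColimit.hom_ext G.isColimit _ _ h

section
variable [Preadditive C]
/-- The projection of `X` onto the component of degree `n`. -/
def proj (n : ℕ) : X ⟶ G.comp n :=
  Cofan.IsColimit.desc G.isColimit fun m => if h : m = n then eqToHom (by rw [h]) else 0

lemma inj_proj (m n : ℕ) :
    G.inj m ≫ G.proj n = if h : m = n then eqToHom (by rw [h]) else 0 :=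
  Cofan.IsColimit.fac G.isColimit _ m

lemma inj_proj_self (n : ℕ) : G.inj n ≫ G.proj n = 𝟙 _ := by simp [inj_proj]
lemma inj_proj_ne {m n : ℕ} (h : m ≠ n) : G.inj m ≫ G.proj n = 0 := by simp [inj_proj, h]
instance (n : ℕ) : IsSplitEpi (G.proj n) := ⟨⟨⟨G.inj n, G.inj_proj_self n⟩⟩⟩
instance (n : ℕ) : IsSplitMono (G.inj n) := ⟨⟨⟨G.proj n, G.inj_proj_self n⟩⟩⟩
end

section tensor
variable [MonoidalCategory C] [∀ X : C, PreservesColimitsOfShape (Discrete ℕ) (tensorLeft X)]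
  [∀ X : C, PreservesColimitsOfShape (Discrete ℕ) (tensorRight X)]

lemma whiskerRight_ext {Z W : C} {f g : X ⊗ Z ⟶ W}
    (h : ∀ n, G.inj n ▷ Z ≫ f = G.inj n ▷ Z ≫ g) : f = g :=
  Cofan.IsColimit.hom_ext
    (isColimitCofanMkObjOfIsColimit (tensorRight Z) _ G.inj G.isColimit) _ _ h

lemma whiskerLeft_ext {Z W : C} {f g : Z ⊗ X ⟶ W}
    (h : ∀ n, Z ◁ G.inj n ≫ f = Z ◁ G.inj n ≫ g) : f = g :=
  Cofan.IsColimit.hom_ext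
    (isColimitCofanMkObjOfIsColimit (tensorLeft Z) _ G.inj G.isColimit) _ _ h

lemma tensor_ext {W : C} {f g : X ⊗ Y ⟶ W}
    (h : ∀ a b, (G.inj a ⊗ₘ K.inj b) ≫ f = (G.inj a ⊗ₘ K.inj b) ≫ g) : f = g :=
  G.whiskerRight_ext fun a => K.whiskerLeft_ext fun b => by
    simpa [tensorHom_def'] using h a b

/-- A morphism out of `X ⊗ Y` given by its components `comp a ⊗ comp b ⟶ W`. -/
def tensorDesc {W : C} (f : ∀ a b, G.comp a ⊗ K.comp b ⟶ W) : X ⊗ Y ⟶ W :=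
  Cofan.IsColimit.desc (isColimitCofanMkObjOfIsColimit (tensorRight Y) _ G.inj G.isColimit)
    fun a => Cofan.IsColimit.desc
      (isColimitCofanMkObjOfIsColimit (tensorLeft (G.comp a)) _ K.inj K.isColimit) fun b => f a b

lemma inj_tensorDesc {W : C} (f : ∀ a b, G.comp a ⊗ K.comp b ⟶ W) (a b : ℕ) :
    (G.inj a ⊗ₘ K.inj b) ≫ G.tensorDesc K f = f a b := by
  have h1 : G.inj a ▷ Y ≫ G.tensorDesc K f = _ := Cofan.IsColimit.fac
    (isColimitCofanMkObjOfIsColimit (tensorRight Y) _ G.inj G.isColimit) _ a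
  rw [tensorHom_def', Category.assoc, h1]
  exact Cofan.IsColimit.fac
      (isColimitCofanMkObjOfIsColimit (tensorLeft (G.comp a)) _ K.inj K.isColimit) _ b
end tensor

end Grading
end Graded

section GradedStructure

namespace Grading

variable {C : Type u} [Category.{v} C] [MonoidalCategory C] [HasFiniteCoproducts C]
  {X : C} (G : Grading X)

/-- The degree `n` part of `X ⊗ X`: the direct sum of `comp a ⊗ comp b` for `a + b = n`. -/
def tensorComp (n : ℕ) : C :=
  ∐ fun p : Finset.HasAntidiagonal.antidiagonal n => G.comp p.1.1 ⊗ G.comp p.1.2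

def tensorInj (n : ℕ) : G.tensorComp n ⟶ X ⊗ X :=
  Sigma.desc fun p : Finset.HasAntidiagonal.antidiagonal n => G.inj p.1.1 ⊗ₘ G.inj p.1.2

def tensorSummand {n a b : ℕ} (h : a + b = n) : G.comp a ⊗ G.comp b ⟶ G.tensorComp n :=
  Sigma.ι (fun p : Finset.HasAntidiagonal.antidiagonal n => G.comp p.1.1 ⊗ G.comp p.1.2)
    ⟨(a, b), Finset.HasAntidiagonal.mem_antidiagonal.2 h⟩

lemma tensorSummand_inj {n a b : ℕ} (h : a + b = n) :
    G.tensorSummand h ≫ G.tensorInj n = (G.inj a ⊗ₘ G.inj b) :=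
  Sigma.ι_desc _ _

lemma tensorComp_ext {n : ℕ} {Z : C} {f g : G.tensorComp n ⟶ Z}
    (hfg : ∀ (a b : ℕ) (h : a + b = n), G.tensorSummand h ≫ f = G.tensorSummand h ≫ g) : f = g :=
  Sigma.hom_ext _ _ fun p => hfg p.1.1 p.1.2 (Finset.HasAntidiagonal.mem_antidiagonal.1 p.2)

/-- The multiplication maps the degree `n` part of `X ⊗ X` to the degree `n` part of `X`. -/
def IsGradedMul [MonObj X] : Prop :=
  ∀ n, ∃ m : G.tensorComp n ⟶ G.comp n, G.tensorInj n ≫ μ[X] = m ≫ G.inj n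

/-- The comultiplication maps the degree `n` part of `X` to the degree `n` part of `X ⊗ X`. -/
def IsGradedComul [ComonObj X] : Prop :=
  ∀ n, ∃ d : G.comp n ⟶ G.tensorComp n, G.inj n ≫ Δ[X] = d ≫ G.tensorInj n

variable [Preadditive C]

/-- The component `comp a ⊗ comp b ⟶ comp n` of the multiplication. -/
def mulComp [MonObj X] (a b n : ℕ) : G.comp a ⊗ G.comp b ⟶ G.comp n :=
  (G.inj a ⊗ₘ G.inj b) ≫ μ[X] ≫ G.proj n

/-- The component `comp n ⟶ comp a ⊗ comp b` of the comultiplication. -/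
def comulComp [ComonObj X] (n a b : ℕ) : G.comp n ⟶ G.comp a ⊗ G.comp b :=
  G.inj n ≫ Δ[X] ≫ (G.proj a ⊗ₘ G.proj b)

variable {G}

section mul
variable [MonObj X]

lemma IsGradedMul.mulComp_inj (h : G.IsGradedMul) {a b n : ℕ} (hn : a + b = n) :
    G.mulComp a b n ≫ G.inj n = (G.inj a ⊗ₘ G.inj b) ≫ μ[X] := by
  obtain ⟨m, hm⟩ := h n
  have e : (G.inj a ⊗ₘ G.inj b) ≫ μ[X] = G.tensorSummand hn ≫ m ≫ G.inj n := by
    rw [← G.tensorSummand_inj hn, Category.assoc, hm]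
  rw [mulComp, Category.assoc, Category.assoc, reassoc_of% e, reassoc_of% G.inj_proj_self n, e]

lemma IsGradedMul.mulComp_eq_zero (h : G.IsGradedMul) {a b n : ℕ} (hn : a + b ≠ n) :
    G.mulComp a b n = 0 := by
  rw [mulComp, ← Category.assoc, ← h.mulComp_inj rfl, Category.assoc, G.inj_proj_ne hn, comp_zero]

end mul

section comul
variable [ComonObj X] [MonoidalPreadditive C]

lemma IsGradedComul.inj_comul (h : G.IsGradedComul) (n : ℕ) :
    G.inj n ≫ Δ[X] = ∑ p ∈ Finset.HasAntidiagonal.antidiagonal n,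
      G.comulComp n p.1 p.2 ≫ (G.inj p.1 ⊗ₘ G.inj p.2) := by
  obtain ⟨d, hd⟩ := h n
  have e : G.tensorInj n = G.tensorInj n ≫ ∑ p ∈ Finset.HasAntidiagonal.antidiagonal n,
      (G.proj p.1 ⊗ₘ G.proj p.2) ≫ (G.inj p.1 ⊗ₘ G.inj p.2) := by
    refine G.tensorComp_ext fun a b hab => ?_
    rw [Preadditive.comp_sum, Preadditive.comp_sum, Finset.sum_eq_single (a, b)]
    · rw [reassoc_of% G.tensorSummand_inj hab, tensorSummand_inj, tensorHom_comp_tensorHom_assoc,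
        G.inj_proj_self, G.inj_proj_self]
      simp
    · intro q hq hqp
      have hq' := Finset.HasAntidiagonal.mem_antidiagonal.1 hq
      rw [reassoc_of% G.tensorSummand_inj hab, tensorHom_comp_tensorHom_assoc,
        G.inj_proj_ne (m := a) (n := q.1) fun h1 => hqp (Prod.ext h1.symm (by dsimp; omega))]
      simp
    · intro hn
      exact absurd (Finset.HasAntidiagonal.mem_antidiagonal.2 hab) hn
  rw [hd, e, ← reassoc_of% hd, Preadditive.comp_sum, Preadditive.comp_sum]
  simp [comulComp]

lemma IsGradedComul.comulComp_eq_zero (h : G.IsGradedComul) {a b n : ℕ} (hn : a + b ≠ n) :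
    G.comulComp n a b = 0 := by
  obtain ⟨d, hd⟩ := h n
  rw [comulComp, reassoc_of% hd]
  have : G.tensorInj n ≫ (G.proj a ⊗ₘ G.proj b) = 0 := by
    refine G.tensorComp_ext fun c d hcd => ?_
    rw [reassoc_of% G.tensorSummand_inj hcd, tensorHom_comp_tensorHom, comp_zero]
    by_cases h1 : c = a
    · rw [G.inj_proj_ne (m := d) (n := b) (by omega)]; simp
    · rw [G.inj_proj_ne h1]; simp
  rw [this, comp_zero]

end comul
end Grading
end GradedStructure

section Bialgebra

variable (C : Type u) [Category.{v} C] [Abelian C] [MonoidalCategory C] [BraidedCategory C]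

/-- A graded bialgebra in the braided category `C`. -/
structure GradedBialgebra where
  X : C
  [bimon : BimonObj X]
  grading : Grading X
  mul_graded : grading.IsGradedMul
  comul_graded : grading.IsGradedComul

attribute [instance] GradedBialgebra.bimon

variable {C}

/-- A Hopf bimodule over the bialgebra `H`: an `H`-bimodule and `H`-bicomodule whose two coactions
are morphisms of `H`-bimodules, for the diagonal actions. -/
structure HopfBimodule (H : C) [BimonObj H] where
  X : C
  actLeft : H ⊗ X ⟶ X
  actRight : X ⊗ H ⟶ X
  coactLeft : X ⟶ H ⊗ X
  coactRight : X ⟶ X ⊗ H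
  one_actLeft : η[H] ▷ X ≫ actLeft = (λ_ X).hom
  mul_actLeft : μ[H] ▷ X ≫ actLeft = (α_ H H X).hom ≫ H ◁ actLeft ≫ actLeft
  actRight_one : X ◁ η[H] ≫ actRight = (ρ_ X).hom
  actRight_mul : X ◁ μ[H] ≫ actRight = (α_ X H H).inv ≫ actRight ▷ H ≫ actRight
  act_assoc : actLeft ▷ H ≫ actRight = (α_ H X H).hom ≫ H ◁ actRight ≫ actLeft
  coactLeft_counit : coactLeft ≫ ε[H] ▷ X = (λ_ X).inv
  coactLeft_comul : coactLeft ≫ Δ[H] ▷ X = coactLeft ≫ H ◁ coactLeft ≫ (α_ H H X).inv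
  coactRight_counit : coactRight ≫ X ◁ ε[H] = (ρ_ X).inv
  coactRight_comul : coactRight ≫ X ◁ Δ[H] = coactRight ≫ coactRight ▷ H ≫ (α_ X H H).hom
  coact_coassoc : coactRight ≫ coactLeft ▷ H = coactLeft ≫ H ◁ coactRight ≫ (α_ H X H).inv
  actLeft_coactLeft : actLeft ≫ coactLeft =
    (Δ[H] ⊗ₘ coactLeft) ≫ tensorμ H H H X ≫ (μ[H] ⊗ₘ actLeft)
  actRight_coactLeft : actRight ≫ coactLeft =
    (coactLeft ⊗ₘ Δ[H]) ≫ tensorμ H X H H ≫ (μ[H] ⊗ₘ actRight)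
  actLeft_coactRight : actLeft ≫ coactRight =
    (Δ[H] ⊗ₘ coactRight) ≫ tensorμ H H X H ≫ (actLeft ⊗ₘ μ[H])
  actRight_coactRight : actRight ≫ coactRight =
    (coactRight ⊗ₘ Δ[H]) ≫ tensorμ X H H H ≫ (actRight ⊗ₘ μ[H])

namespace Grading

variable [MonoidalPreadditive C]
  [∀ X : C, PreservesColimitsOfShape (Discrete ℕ) (tensorLeft X)]
  [∀ X : C, PreservesColimitsOfShape (Discrete ℕ) (tensorRight X)]
  {X : C} {G : Grading X}

section mul
variable [MonObj X]

lemma IsGradedMul.inj_mul_proj (h : G.IsGradedMul) {a b n : ℕ} (hn : a + b ≠ n) :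
    (G.inj a ⊗ₘ G.inj b) ≫ μ[X] ≫ G.proj n = 0 := h.mulComp_eq_zero hn

lemma proj_proj_mulComp (a b a' b' n : ℕ) :
    (G.inj a ⊗ₘ G.inj b) ≫ (G.proj a' ⊗ₘ G.proj b') ≫ G.mulComp a' b' n =
      if a = a' ∧ b = b' then G.mulComp a b n else 0 := by
  rw [tensorHom_comp_tensorHom_assoc]
  by_cases h : a = a'
  · subst h
    by_cases h : b = b'
    · subst h
      simp [G.inj_proj_self]
    · simp [G.inj_proj_ne h, h]
  · simp [G.inj_proj_ne h, h]

lemma IsGradedMul.mul_proj_zero (h : G.IsGradedMul) :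
    μ[X] ≫ G.proj 0 = (G.proj 0 ⊗ₘ G.proj 0) ≫ G.mulComp 0 0 0 := by
  refine G.tensor_ext G fun a b => ?_
  rw [proj_proj_mulComp]
  split_ifs with hab
  · rfl
  · exact h.mulComp_eq_zero (by omega)

lemma IsGradedMul.mul_proj_one (h : G.IsGradedMul) :
    μ[X] ≫ G.proj 1 = (G.proj 0 ⊗ₘ G.proj 1) ≫ G.mulComp 0 1 1 +
      (G.proj 1 ⊗ₘ G.proj 0) ≫ G.mulComp 1 0 1 := by
  refine G.tensor_ext G fun a b => ?_
  rw [Preadditive.comp_add, proj_proj_mulComp, proj_proj_mulComp]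
  change G.mulComp a b 1 = _
  by_cases h1 : a = 0 ∧ b = 1
  · simp [h1]
  · by_cases h2 : a = 1 ∧ b = 0
    · simp [h2]
    · rw [if_neg h1, if_neg h2, add_zero]
      exact h.mulComp_eq_zero (by omega)

lemma IsGradedMul.one_proj_inj (h : G.IsGradedMul) : η[X] ≫ G.proj 0 ≫ G.inj 0 = η[X] := by
  have e : ∀ a n, (G.inj a ⊗ₘ G.inj n) ≫ μ[X] ≫ G.proj n =
      (G.inj a ⊗ₘ G.inj n) ≫ ((G.proj 0 ≫ G.inj 0) ▷ X) ≫ μ[X] ≫ G.proj n := by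
    intro a n
    by_cases ha : a = 0
    · subst ha
      rw [← tensorHom_id, tensorHom_comp_tensorHom_assoc, reassoc_of% G.inj_proj_self 0,
        Category.comp_id]
    · rw [h.inj_mul_proj (by omega), ← tensorHom_id, tensorHom_comp_tensorHom_assoc,
        reassoc_of% G.inj_proj_ne ha]
      simp
  have e2 : ∀ n, (X ◁ G.inj n) ≫ μ[X] ≫ G.proj n =
      (X ◁ G.inj n) ≫ ((G.proj 0 ≫ G.inj 0) ▷ X) ≫ μ[X] ≫ G.proj n := fun n =>
    G.whiskerRight_ext fun a => by simpa [MonoidalCategory.tensorHom_def] using e a n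
  have key : (η[X] ≫ G.proj 0 ≫ G.inj 0) ▷ X ≫ μ[X] = (λ_ X).hom := by
    refine G.whiskerLeft_ext fun n => ?_
    have h1 : ((𝟙_ C) ◁ G.inj n) ≫ (η[X] ≫ G.proj 0 ≫ G.inj 0) ▷ X ≫ μ[X] ≫ G.proj n =
        (λ_ (G.comp n)).hom := by
      have := congrArg (fun f => η[X] ▷ G.comp n ≫ f) (e2 n)
      rw [comp_whiskerRight, Category.assoc, whisker_exchange_assoc, ← e2 n,
        ← whisker_exchange_assoc, reassoc_of% MonObj.one_mul X]
      simp [G.inj_proj_self]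
    have h2 : ((𝟙_ C) ◁ G.inj n) ≫ (η[X] ≫ G.proj 0 ≫ G.inj 0) ▷ X ≫ μ[X] =
        (η[X] ≫ G.proj 0) ▷ G.comp n ≫ G.mulComp 0 n n ≫ G.inj n := by
      rw [h.mulComp_inj (zero_add n), MonoidalCategory.tensorHom_def, Category.assoc,
        ← comp_whiskerRight_assoc, ← whisker_exchange_assoc]
      simp
    rw [h2, mulComp]
    rw [MonoidalCategory.tensorHom_def]
    simp only [Category.assoc]
    rw [← comp_whiskerRight_assoc, ← whisker_exchange_assoc]
    simp only [Category.assoc]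
    rw [reassoc_of% h1, leftUnitor_naturality]
  have h3 := congrArg (fun f => (ρ_ (𝟙_ C)).inv ≫ 𝟙_ C ◁ η[X] ≫ f) key
  have h4 := MonObj.mul_one X
  rw [whisker_exchange_assoc, h4] at h3
  simpa [unitors_equal] using h3

end mul

section comul
variable [ComonObj X]

lemma IsGradedComul.proj_comulComp (h : G.IsGradedComul) (a b n : ℕ) (hn : a + b = n) :
    G.proj n ≫ G.comulComp n a b = Δ[X] ≫ (G.proj a ⊗ₘ G.proj b) := by
  refine G.hom_ext fun m => ?_
  by_cases hm : m = n
  · subst hm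
    rw [reassoc_of% G.inj_proj_self m]; rfl
  · rw [← Category.assoc, G.inj_proj_ne hm, zero_comp]
    exact (h.comulComp_eq_zero (n := m) (by omega)).symm

lemma IsGradedComul.inj_comul_tensorHom (h : G.IsGradedComul) (n : ℕ) {Y Z : C} (f : X ⟶ Y)
    (g : X ⟶ Z) : G.inj n ≫ Δ[X] ≫ (f ⊗ₘ g) = ∑ p ∈ Finset.HasAntidiagonal.antidiagonal n,
      G.comulComp n p.1 p.2 ≫ ((G.inj p.1 ≫ f) ⊗ₘ (G.inj p.2 ≫ g)) := by
  rw [reassoc_of% h.inj_comul n, Preadditive.sum_comp]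
  simp

lemma IsGradedComul.proj_inj_counit (h : G.IsGradedComul) : G.proj 0 ≫ G.inj 0 ≫ ε[X] = ε[X] := by
  have key : Δ[X] ≫ X ◁ (G.proj 0 ≫ G.inj 0 ≫ ε[X]) = (ρ_ X).inv := by
    refine G.hom_ext fun n => ?_
    have h1 : G.inj n ≫ Δ[X] ≫ (G.proj n ⊗ₘ (G.proj 0 ≫ G.inj 0 ≫ ε[X])) =
        (ρ_ (G.comp n)).inv := by
      have h2 : G.inj n ≫ Δ[X] ≫ (G.proj n ⊗ₘ (G.proj 0 ≫ G.inj 0 ≫ ε[X])) =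
          G.inj n ≫ Δ[X] ≫ (G.proj n ⊗ₘ ε[X]) := by
        rw [h.inj_comul_tensorHom, h.inj_comul_tensorHom]
        refine Finset.sum_congr rfl fun p hp => ?_
        have hp := Finset.HasAntidiagonal.mem_antidiagonal.1 hp
        by_cases h0 : p.2 = 0
        · rw [h0, reassoc_of% G.inj_proj_self 0]
        · rw [G.inj_proj_ne (m := p.1) (n := n) (by omega)]
          simp
      rw [h2, tensorHom_def', reassoc_of% ComonObj.comul_counit X, ← rightUnitor_inv_naturality,
        reassoc_of% G.inj_proj_self n]
    have h3 : G.inj n ≫ Δ[X] ≫ X ◁ (G.proj 0 ≫ G.inj 0 ≫ ε[X]) =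
        G.inj n ≫ Δ[X] ≫ (G.proj n ⊗ₘ (G.proj 0 ≫ G.inj 0 ≫ ε[X])) ≫ G.inj n ▷ 𝟙_ C := by
      rw [← tensorHom_id, tensorHom_comp_tensorHom, ← id_tensorHom, h.inj_comul_tensorHom,
        h.inj_comul_tensorHom]
      refine Finset.sum_congr rfl fun p hp => ?_
      have hp := Finset.HasAntidiagonal.mem_antidiagonal.1 hp
      by_cases h0 : p.2 = 0
      · have h4 : p.1 = n := by omega
        rw [h4, reassoc_of% G.inj_proj_self n, Category.comp_id, Category.comp_id]
      · have h4 := G.inj_proj_ne h0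
        simp only [Category.assoc, reassoc_of% h4, zero_comp, MonoidalCategory.tensorHom_def, MonoidalPreadditive.whiskerLeft_zero, comp_zero]
    rw [h3, reassoc_of% h1, rightUnitor_inv_naturality]
  have h3 := congrArg (fun f => f ≫ ε[X] ▷ 𝟙_ C ≫ (λ_ (𝟙_ C)).hom) key
  have h4 := ComonObj.counit_comul X
  simp only [Category.assoc] at h3
  rw [whisker_exchange_assoc, reassoc_of% h4, unitors_equal] at h3
  simpa [unitors_inv_equal] using h3

end comul
end Grading

instance {X Y X' Y' : C} (f : X ⟶ Y) (g : X' ⟶ Y') [IsSplitEpi f] [IsSplitEpi g] :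
    IsSplitEpi (f ⊗ₘ g) :=
  ⟨⟨⟨section_ f ⊗ₘ section_ g, by rw [tensorHom_comp_tensorHom]; simp⟩⟩⟩

instance {X Y Z : C} (f : X ⟶ Y) [IsSplitEpi f] : IsSplitEpi (Z ◁ f) :=
  ⟨⟨⟨Z ◁ section_ f, by rw [← MonoidalCategory.whiskerLeft_comp]; simp⟩⟩⟩

instance {X Y Z : C} (f : X ⟶ Y) [IsSplitEpi f] : IsSplitEpi (f ▷ Z) :=
  ⟨⟨⟨section_ f ▷ Z, by rw [← comp_whiskerRight]; simp⟩⟩⟩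

/-- Transport of a bialgebra structure along a split epimorphism compatible with the operations. -/
abbrev bimonOfSplitEpi {X Y : C} [BimonObj X] (p : X ⟶ Y) [IsSplitEpi p]
    (m : Y ⊗ Y ⟶ Y) (d : Y ⟶ Y ⊗ Y) (e : Y ⟶ 𝟙_ C)
    (hm : μ[X] ≫ p = (p ⊗ₘ p) ≫ m) (hd : p ≫ d = Δ[X] ≫ (p ⊗ₘ p)) (he : p ≫ e = ε[X]) :
    BimonObj Y where
  one := η[X] ≫ p
  mul := m
  counit := e
  comul := d
  one_mul := by
    rw [← cancel_epi ((𝟙_ C) ◁ p), comp_whiskerRight, Category.assoc, whisker_exchange_assoc,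
      ← MonoidalCategory.tensorHom_def'_assoc, ← hm, MonObj.one_mul_assoc, leftUnitor_naturality]
  mul_one := by
    rw [← cancel_epi (p ▷ (𝟙_ C)), MonoidalCategory.whiskerLeft_comp, Category.assoc,
      ← whisker_exchange_assoc,
      ← MonoidalCategory.tensorHom_def_assoc, ← hm, MonObj.mul_one_assoc, rightUnitor_naturality]
  mul_assoc := by
    rw [← cancel_epi ((p ⊗ₘ p) ⊗ₘ p), ← tensorHom_id, tensorHom_comp_tensorHom_assoc, ← hm,
      associator_naturality_assoc, ← id_tensorHom, tensorHom_comp_tensorHom_assoc, ← hm]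
    have h1 : (μ[X] ≫ p ⊗ₘ p ≫ 𝟙 Y) = μ[X] ▷ X ≫ (p ⊗ₘ p) := by simp [← tensorHom_id]
    have h2 : (p ≫ 𝟙 Y ⊗ₘ μ[X] ≫ p) = X ◁ μ[X] ≫ (p ⊗ₘ p) := by simp [← id_tensorHom]
    rw [h1, h2, Category.assoc, Category.assoc, ← hm, MonObj.mul_assoc_assoc]
  counit_comul := by
    rw [← cancel_epi p, reassoc_of% hd, ← tensorHom_id, tensorHom_comp_tensorHom, he,
      Category.comp_id, MonoidalCategory.tensorHom_def, ComonObj.counit_comul_assoc,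
      leftUnitor_inv_naturality]
  comul_counit := by
    rw [← cancel_epi p, reassoc_of% hd, ← id_tensorHom, tensorHom_comp_tensorHom, he,
      Category.comp_id, MonoidalCategory.tensorHom_def', ComonObj.comul_counit_assoc,
      rightUnitor_inv_naturality]
  comul_assoc := by
    rw [← cancel_epi p, reassoc_of% hd, reassoc_of% hd, ← id_tensorHom, ← tensorHom_id,
      tensorHom_comp_tensorHom, tensorHom_comp_tensorHom_assoc, hd]
    have h1 : (Δ[X] ≫ (p ⊗ₘ p) ⊗ₘ p ≫ 𝟙 Y) = Δ[X] ▷ X ≫ ((p ⊗ₘ p) ⊗ₘ p) := by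
      rw [← tensorHom_id, tensorHom_comp_tensorHom, Category.comp_id, Category.id_comp]
    have h2 : (p ≫ 𝟙 Y ⊗ₘ Δ[X] ≫ (p ⊗ₘ p)) = X ◁ Δ[X] ≫ (p ⊗ₘ (p ⊗ₘ p)) := by
      rw [← id_tensorHom, tensorHom_comp_tensorHom, Category.comp_id, Category.id_comp]
    rw [h1, h2, Category.assoc, associator_naturality, ComonObj.comul_assoc_assoc]
  mul_comul := by
    rw [← cancel_epi (p ⊗ₘ p), ← reassoc_of% hm, hd, BimonObj.mul_comul_assoc,
      tensorHom_comp_tensorHom_assoc, hd, tensorHom_comp_tensorHom, hm,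
      ← tensorHom_comp_tensorHom_assoc, ← tensorHom_comp_tensorHom, tensorμ_natural_assoc]
  one_comul := by
    change (η[X] ≫ p) ≫ d = (λ_ (𝟙_ C)).inv ≫ (η[X] ≫ p ⊗ₘ η[X] ≫ p)
    rw [Category.assoc, hd, BimonObj.one_comul_assoc, MonObj.tensorObj.one_def,
      Category.assoc, tensorHom_comp_tensorHom]
  mul_counit := by
    change m ≫ e = (e ⊗ₘ e) ≫ (λ_ (𝟙_ C)).hom
    rw [← cancel_epi (p ⊗ₘ p), ← reassoc_of% hm, he, BimonObj.mul_counit,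
      tensorHom_comp_tensorHom_assoc, he]
    rfl
  one_counit := by
    rw [Category.assoc, he, BimonObj.one_counit]

namespace GradedBialgebra

variable [MonoidalPreadditive C]
  [∀ X : C, PreservesColimitsOfShape (Discrete ℕ) (tensorLeft X)]
  [∀ X : C, PreservesColimitsOfShape (Discrete ℕ) (tensorRight X)]

/-- The component `B₀`. -/
abbrev degZero (B : GradedBialgebra C) : C := B.grading.comp 0

/-- `B₀` is a bialgebra, with the degree zero components of the operations of `B`. -/
instance (B : GradedBialgebra C) : BimonObj B.degZero :=
  bimonOfSplitEpi (B.grading.proj 0) (B.grading.mulComp 0 0 0) (B.grading.comulComp 0 0 0)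
    (B.grading.inj 0 ≫ ε[B.X]) B.mul_graded.mul_proj_zero
    (B.comul_graded.proj_comulComp 0 0 0 rfl) B.comul_graded.proj_inj_counit

lemma mulComp_assoc (B : GradedBialgebra C) {a b c i j n : ℕ} (h1 : a + b = i) (h2 : b + c = j)
    (h3 : i + c = n) (h4 : a + j = n) :
    B.grading.mulComp a b i ▷ B.grading.comp c ≫ B.grading.mulComp i c n =
      (α_ _ _ _).hom ≫ B.grading.comp a ◁ B.grading.mulComp b c j ≫ B.grading.mulComp a j n := by
  have h := B.mul_graded
  rw [← cancel_mono (B.grading.inj n)]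
  simp only [Category.assoc]
  rw [h.mulComp_inj h3, h.mulComp_inj h4, ← tensorHom_id, ← id_tensorHom,
    tensorHom_comp_tensorHom_assoc, tensorHom_comp_tensorHom_assoc, h.mulComp_inj h1,
    h.mulComp_inj h2]
  have e1 : ((B.grading.inj a ⊗ₘ B.grading.inj b) ≫ μ[B.X] ⊗ₘ 𝟙 _ ≫ B.grading.inj c) =
      ((B.grading.inj a ⊗ₘ B.grading.inj b) ⊗ₘ B.grading.inj c) ≫ μ[B.X] ▷ B.X := by
    rw [← tensorHom_id, tensorHom_comp_tensorHom, Category.comp_id, Category.id_comp]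
  have e2 : (𝟙 _ ≫ B.grading.inj a ⊗ₘ (B.grading.inj b ⊗ₘ B.grading.inj c) ≫ μ[B.X]) =
      (B.grading.inj a ⊗ₘ (B.grading.inj b ⊗ₘ B.grading.inj c)) ≫ B.X ◁ μ[B.X] := by
    rw [← id_tensorHom, tensorHom_comp_tensorHom, Category.comp_id, Category.id_comp]
  rw [e1, e2, Category.assoc, MonObj.mul_assoc, Category.assoc, associator_naturality_assoc]

lemma comulComp_coassoc (B : GradedBialgebra C) {a b c i j n : ℕ} (h1 : a + b = i)
    (h2 : b + c = j) (h3 : i + c = n) (h4 : a + j = n) :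
    B.grading.comulComp n a j ≫ B.grading.comp a ◁ B.grading.comulComp j b c =
      B.grading.comulComp n i c ≫ B.grading.comulComp i a b ▷ B.grading.comp c ≫
        (α_ _ _ _).hom := by
  have h := B.comul_graded
  rw [← cancel_epi (B.grading.proj n), reassoc_of% (h.proj_comulComp _ _ n h3),
    reassoc_of% (h.proj_comulComp _ _ n h4), ← tensorHom_id, ← id_tensorHom,
    tensorHom_comp_tensorHom, tensorHom_comp_tensorHom_assoc, h.proj_comulComp _ _ _ h1,
    h.proj_comulComp _ _ _ h2]
  have e1 : (Δ[B.X] ≫ (B.grading.proj a ⊗ₘ B.grading.proj b) ⊗ₘ B.grading.proj c ≫ 𝟙 _) =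
      Δ[B.X] ▷ B.X ≫ ((B.grading.proj a ⊗ₘ B.grading.proj b) ⊗ₘ B.grading.proj c) := by
    rw [← tensorHom_id, tensorHom_comp_tensorHom, Category.comp_id, Category.id_comp]
  have e2 : (B.grading.proj a ≫ 𝟙 _ ⊗ₘ Δ[B.X] ≫ (B.grading.proj b ⊗ₘ B.grading.proj c)) =
      B.X ◁ Δ[B.X] ≫ (B.grading.proj a ⊗ₘ (B.grading.proj b ⊗ₘ B.grading.proj c)) := by
    rw [← id_tensorHom, tensorHom_comp_tensorHom, Category.comp_id, Category.id_comp]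
  rw [e1, e2, Category.assoc, associator_naturality, ComonObj.comul_assoc_assoc]

lemma comulComp_coassoc_inv (B : GradedBialgebra C) {a b c i j n : ℕ} (h1 : a + b = i)
    (h2 : b + c = j) (h3 : i + c = n) (h4 : a + j = n) :
    B.grading.comulComp n i c ≫ B.grading.comulComp i a b ▷ B.grading.comp c =
      B.grading.comulComp n a j ≫ B.grading.comp a ◁ B.grading.comulComp j b c ≫
        (α_ _ _ _).inv := by
  rw [reassoc_of% B.comulComp_coassoc h1 h2 h3 h4]
  simp

lemma one_mulComp (B : GradedBialgebra C) (n : ℕ) :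
    (η[B.X] ≫ B.grading.proj 0) ▷ B.grading.comp n ≫ B.grading.mulComp 0 n n =
      (λ_ _).hom := by
  have h := B.mul_graded
  rw [← cancel_mono (B.grading.inj n), Category.assoc, h.mulComp_inj (zero_add n), ← tensorHom_id,
    tensorHom_comp_tensorHom_assoc, Category.assoc, h.one_proj_inj, Category.id_comp,
    tensorHom_def', Category.assoc, MonObj.one_mul, leftUnitor_naturality]

lemma mulComp_one (B : GradedBialgebra C) (n : ℕ) :
    B.grading.comp n ◁ (η[B.X] ≫ B.grading.proj 0) ≫ B.grading.mulComp n 0 n =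
      (ρ_ _).hom := by
  have h := B.mul_graded
  rw [← cancel_mono (B.grading.inj n), Category.assoc, h.mulComp_inj (add_zero n), ← id_tensorHom,
    tensorHom_comp_tensorHom_assoc, Category.assoc, h.one_proj_inj, Category.id_comp,
    MonoidalCategory.tensorHom_def, Category.assoc, MonObj.mul_one, rightUnitor_naturality]

lemma comulComp_counit_left (B : GradedBialgebra C) (n : ℕ) :
    B.grading.comulComp n 0 n ≫ (B.grading.inj 0 ≫ ε[B.X]) ▷ B.grading.comp n =
      (λ_ _).inv := by
  have h := B.comul_graded
  rw [← cancel_epi (B.grading.proj n), reassoc_of% (h.proj_comulComp 0 n n (zero_add n)),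
    ← tensorHom_id,
    tensorHom_comp_tensorHom, h.proj_inj_counit, Category.comp_id,
    MonoidalCategory.tensorHom_def, ComonObj.counit_comul_assoc, leftUnitor_inv_naturality]

lemma comulComp_counit_right (B : GradedBialgebra C) (n : ℕ) :
    B.grading.comulComp n n 0 ≫ B.grading.comp n ◁ (B.grading.inj 0 ≫ ε[B.X]) =
      (ρ_ _).inv := by
  have h := B.comul_graded
  rw [← cancel_epi (B.grading.proj n), reassoc_of% (h.proj_comulComp n 0 n (add_zero n)),
    ← id_tensorHom,
    tensorHom_comp_tensorHom, h.proj_inj_counit, Category.comp_id,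
    tensorHom_def', ComonObj.comul_counit_assoc, rightUnitor_inv_naturality]

lemma mulComp_comulComp (B : GradedBialgebra C) {n k l : ℕ} (i j : ℕ) (h : k + l = n) :
    B.grading.mulComp i j n ≫ B.grading.comulComp n k l =
      (B.grading.inj i ≫ Δ[B.X] ⊗ₘ B.grading.inj j ≫ Δ[B.X]) ≫ tensorμ B.X B.X B.X B.X ≫
        (μ[B.X] ≫ B.grading.proj k ⊗ₘ μ[B.X] ≫ B.grading.proj l) := by
  rw [Grading.mulComp, Category.assoc, Category.assoc, B.comul_graded.proj_comulComp k l n h,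
    BimonObj.mul_comul_assoc, tensorHom_comp_tensorHom_assoc]
  simp

lemma comul_tensorμ (B : GradedBialgebra C) (i j a b c d : ℕ) {Y Z : C}
    (f : B.grading.comp a ⊗ B.grading.comp b ⟶ Y) (g : B.grading.comp c ⊗ B.grading.comp d ⟶ Z) :
    (B.grading.inj i ≫ Δ[B.X] ⊗ₘ B.grading.inj j ≫ Δ[B.X]) ≫ tensorμ B.X B.X B.X B.X ≫
        ((B.grading.proj a ⊗ₘ B.grading.proj b) ≫ f ⊗ₘ (B.grading.proj c ⊗ₘ B.grading.proj d) ≫ g) =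
      (B.grading.comulComp i a c ⊗ₘ B.grading.comulComp j b d) ≫ tensorμ _ _ _ _ ≫ (f ⊗ₘ g) := by
  have e : (B.grading.comulComp i a c ⊗ₘ B.grading.comulComp j b d) =
      (B.grading.inj i ≫ Δ[B.X] ⊗ₘ B.grading.inj j ≫ Δ[B.X]) ≫
        ((B.grading.proj a ⊗ₘ B.grading.proj c) ⊗ₘ (B.grading.proj b ⊗ₘ B.grading.proj d)) := by
    rw [tensorHom_comp_tensorHom, Category.assoc, Category.assoc]
    rfl
  rw [e, Category.assoc, tensorμ_natural_assoc, tensorHom_comp_tensorHom]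

/-- `B₁` is a Hopf bimodule over `B₀`, with the components of the multiplication and of the
comultiplication of `B`. -/
def degOne (B : GradedBialgebra C) : HopfBimodule B.degZero where
  X := B.grading.comp 1
  actLeft := B.grading.mulComp 0 1 1
  actRight := B.grading.mulComp 1 0 1
  coactLeft := B.grading.comulComp 1 0 1
  coactRight := B.grading.comulComp 1 1 0
  one_actLeft := B.one_mulComp 1
  mul_actLeft := B.mulComp_assoc rfl rfl rfl rfl
  actRight_one := B.mulComp_one 1
  actRight_mul := by
    rw [Iso.eq_inv_comp]
    exact (B.mulComp_assoc rfl rfl rfl rfl).symm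
  act_assoc := B.mulComp_assoc rfl rfl rfl rfl
  coactLeft_counit := B.comulComp_counit_left 1
  coactLeft_comul := B.comulComp_coassoc_inv rfl rfl rfl rfl
  coactRight_counit := B.comulComp_counit_right 1
  coactRight_comul := B.comulComp_coassoc rfl rfl rfl rfl
  coact_coassoc := B.comulComp_coassoc_inv rfl rfl rfl rfl
  actLeft_coactLeft := by
    have h0 : B.grading.comulComp 0 0 1 = 0 := B.comul_graded.comulComp_eq_zero (by omega)
    rw [B.mulComp_comulComp 0 1 (k := 0) (l := 1) rfl, B.mul_graded.mul_proj_zero, B.mul_graded.mul_proj_one,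
      MonoidalPreadditive.tensor_add, Preadditive.comp_add,
      Preadditive.comp_add, comul_tensorμ, comul_tensorμ, h0]
    simp only [MonoidalCategory.tensorHom_def, MonoidalPreadditive.zero_whiskerRight,
      MonoidalPreadditive.whiskerLeft_zero, zero_comp, comp_zero, add_zero, zero_add]
    rfl
  actRight_coactLeft := by
    have h0 : B.grading.comulComp 0 0 1 = 0 := B.comul_graded.comulComp_eq_zero (by omega)
    rw [B.mulComp_comulComp 1 0 (k := 0) (l := 1) rfl, B.mul_graded.mul_proj_zero, B.mul_graded.mul_proj_one,
      MonoidalPreadditive.tensor_add, Preadditive.comp_add,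
      Preadditive.comp_add, comul_tensorμ, comul_tensorμ, h0]
    simp only [MonoidalCategory.tensorHom_def, MonoidalPreadditive.zero_whiskerRight,
      MonoidalPreadditive.whiskerLeft_zero, zero_comp, comp_zero, add_zero, zero_add]
    rfl
  actLeft_coactRight := by
    have h0 : B.grading.comulComp 0 1 0 = 0 := B.comul_graded.comulComp_eq_zero (by omega)
    rw [B.mulComp_comulComp 0 1 (k := 1) (l := 0) rfl, B.mul_graded.mul_proj_zero, B.mul_graded.mul_proj_one,
      MonoidalPreadditive.add_tensor, Preadditive.comp_add,
      Preadditive.comp_add, comul_tensorμ, comul_tensorμ, h0]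
    simp only [MonoidalCategory.tensorHom_def, MonoidalPreadditive.zero_whiskerRight,
      MonoidalPreadditive.whiskerLeft_zero, zero_comp, comp_zero, add_zero, zero_add]
    rfl
  actRight_coactRight := by
    have h0 : B.grading.comulComp 0 1 0 = 0 := B.comul_graded.comulComp_eq_zero (by omega)
    rw [B.mulComp_comulComp 1 0 (k := 1) (l := 0) rfl, B.mul_graded.mul_proj_zero, B.mul_graded.mul_proj_one,
      MonoidalPreadditive.add_tensor, Preadditive.comp_add,
      Preadditive.comp_add, comul_tensorμ, comul_tensorμ, h0]
    simp only [MonoidalCategory.tensorHom_def, MonoidalPreadditive.zero_whiskerRight,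
      MonoidalPreadditive.whiskerLeft_zero, zero_comp, comp_zero, add_zero, zero_add]
    rfl

end GradedBialgebra
end Bialgebra

section Exact

/-- The tensor product is exact in each variable and commutes with direct sums. -/
class ExactTensor (C : Type u) [Category.{v} C] [MonoidalCategory C] : Prop where
  left_limits : ∀ X : C, PreservesFiniteLimits (tensorLeft X)
  right_limits : ∀ X : C, PreservesFiniteLimits (tensorRight X)
  left_colimits : ∀ X : C, PreservesFiniteColimits (tensorLeft X)
  right_colimits : ∀ X : C, PreservesFiniteColimits (tensorRight X)
  left_coproducts : ∀ (X : C) (J : Type v), PreservesColimitsOfShape (Discrete J) (tensorLeft X)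
  right_coproducts : ∀ (X : C) (J : Type v), PreservesColimitsOfShape (Discrete J) (tensorRight X)

attribute [instance] ExactTensor.left_limits ExactTensor.right_limits
  ExactTensor.left_colimits ExactTensor.right_colimits

variable {C : Type u} [Category.{v} C] [MonoidalCategory C] [ExactTensor C]

instance (X : C) : PreservesColimitsOfShape (Discrete ℕ) (tensorLeft X) :=
  have := ExactTensor.left_coproducts X (ULift.{v} ℕ)
  preservesColimitsOfShape_of_equiv (Discrete.equivalence Equiv.ulift) _

instance (X : C) : PreservesColimitsOfShape (Discrete ℕ) (tensorRight X) :=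
  have := ExactTensor.right_coproducts X (ULift.{v} ℕ)
  preservesColimitsOfShape_of_equiv (Discrete.equivalence Equiv.ulift) _

instance (X : Cᵒᵖ) : PreservesColimitsOfShape WalkingParallelPair (tensorLeft X) :=
  have : PreservesFiniteColimits (tensorLeft X.unop).op := preservesFiniteColimits_op _
  preservesColimitsOfShape_of_natIso
    (NatIso.ofComponents (F := (tensorLeft X.unop).op) (fun _ => Iso.refl _)
      (fun _ => (Category.comp_id _).trans (Category.id_comp _).symm))

instance (X : Cᵒᵖ) : PreservesColimitsOfShape WalkingParallelPair (tensorRight X) :=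
  have : PreservesFiniteColimits (tensorRight X.unop).op := preservesFiniteColimits_op _
  preservesColimitsOfShape_of_natIso
    (NatIso.ofComponents (F := (tensorRight X.unop).op) (fun _ => Iso.refl _)
      (fun _ => (Category.comp_id _).trans (Category.id_comp _).symm))

end Exact

section PowerOne

variable {D : Type u} [Category.{v} D] [MonoidalCategory D] [HasCoequalizers D]
  [∀ X : D, PreservesColimitsOfShape WalkingParallelPair (tensorLeft X)]
  [∀ X : D, PreservesColimitsOfShape WalkingParallelPair (tensorRight X)]
  {A : Mon D}

/-- The canonical isomorphism `M ≅ A ⊗_A M`, from left to right. -/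
def toTensorPowerOne (M : Bimod A A) : M.X ⟶ relTensor (RightModule.regular A) M :=
  (λ_ M.X).inv ≫ η[A.X] ▷ M.X ≫ relTensorπ (RightModule.regular A) M

/-- The canonical isomorphism `A ⊗_A M ≅ M`, from left to right. -/
def ofTensorPowerOne (M : Bimod A A) : relTensor (RightModule.regular A) M ⟶ M.X :=
  coequalizer.desc M.actLeft (M.left_assoc.trans (Category.assoc _ _ _).symm)

end PowerOne

section TypeOneBialgebras

variable {C : Type u} [Category.{v} C] [Abelian C] [MonoidalCategory C] [BraidedCategory C]
  [MonoidalPreadditive C] [HasColimits C] [ExactTensor C]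

namespace Grading

/-- The tautological grading of a direct sum. -/
abbrev sigma (f : ℕ → C) : Grading (∐ f) where
  comp := f
  inj := Sigma.ι f
  isColimit := coproductIsCoproduct f

end Grading

namespace HopfBimodule

variable {H : C} [BimonObj H] (M : HopfBimodule H)

/-- The underlying bimodule. -/
abbrev bimod : Bimod (Mon.mk H) (Mon.mk H) where
  X := M.X
  actLeft := M.actLeft
  actRight := M.actRight
  one_actLeft := M.one_actLeft
  left_assoc := M.mul_actLeft
  actRight_one := M.actRight_one
  right_assoc := M.actRight_mul
  middle_assoc := M.act_assoc

/-- The coalgebra `H` as a monoid object of the opposite category. -/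
abbrev opMon (H : C) [ComonObj H] : Mon Cᵒᵖ := Comon.ComonToMonOpOpObj ⟨H⟩

/-- The underlying bicomodule, as a bimodule in the opposite category. -/
abbrev opBimod : Bimod (opMon H) (opMon H) where
  X := op M.X
  actLeft := M.coactLeft.op
  actRight := M.coactRight.op
  one_actLeft := congrArg Quiver.Hom.op M.coactLeft_counit
  left_assoc := congrArg Quiver.Hom.op (M.coactLeft_comul.trans (Category.assoc _ _ _).symm)
  actRight_one := congrArg Quiver.Hom.op M.coactRight_counit
  right_assoc := congrArg Quiver.Hom.op (M.coactRight_comul.trans (Category.assoc _ _ _).symm)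
  middle_assoc := congrArg Quiver.Hom.op (M.coact_coassoc.trans (Category.assoc _ _ _).symm)

/-- The tensor power of `M` over `H`, with `H` for `n = 0`. -/
def power (n : ℕ) : C := (tensorPower M.bimod n).X

/-- The canonical morphism from `M^{⊗_H a} ⊗ M^{⊗_H b}` to `M^{⊗_H (a + b)}`. -/
def powerMul (a b : ℕ) : M.power a ⊗ M.power b ⟶ M.power (a + b) :=
  (tensorPowerMulAux M.bimod a b).1

/-- The cotensor power of `M` over `H`, with `H` for `n = 0`. It is a tensor power in the opposite
category, where the coequalizer that defines the relative tensor product is the equalizer in `C`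
that defines the cotensor product. -/
def copower (n : ℕ) : C := (tensorPower M.opBimod n).X.unop

/-- The canonical morphism from `M^{□_H (a + b)}` to `M^{□_H a} ⊗ M^{□_H b}`. -/
def copowerComul (a b : ℕ) : M.copower (a + b) ⟶ M.copower a ⊗ M.copower b :=
  (tensorPowerMulAux M.opBimod a b).1.unop

/-- The object `T_H(M)`. -/
def tensorObj : C := ∐ M.power

/-- The object `T^c_H(M)`. -/
def cotensorObj : C := ∐ M.copower

/-- The grading of `T_H(M)` by tensor powers. -/
abbrev tensorGrading : Grading M.tensorObj := Grading.sigma M.power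

/-- The grading of `T^c_H(M)` by cotensor powers. -/
abbrev cotensorGrading : Grading M.cotensorObj := Grading.sigma M.copower

/-- The multiplication of the relative tensor algebra `T_H(M)`. -/
def tensorMul : M.tensorObj ⊗ M.tensorObj ⟶ M.tensorObj :=
  M.tensorGrading.tensorDesc M.tensorGrading fun a b =>
    M.powerMul a b ≫ M.tensorGrading.inj (a + b)

/-- The inclusion `H ⟶ T_H(M)`. -/
def inclZero : H ⟶ M.tensorObj := M.tensorGrading.inj 0

/-- The inclusion `M ⟶ T_H(M)`, through `M ≅ H ⊗_H M`. -/
def inclOne : M.X ⟶ M.tensorObj := toTensorPowerOne M.bimod ≫ M.tensorGrading.inj 1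

/-- The inclusion `H ⟶ T^c_H(M)`. -/
def coinclZero : H ⟶ M.cotensorObj := M.cotensorGrading.inj 0

/-- The inclusion `M ⟶ T^c_H(M)`, through `M ≅ H □_H M`. -/
def coinclOne : M.X ⟶ M.cotensorObj := (ofTensorPowerOne M.opBimod).unop ≫ M.cotensorGrading.inj 1

/-- The projection `T^c_H(M) ⟶ H`. -/
def coprojZero : M.cotensorObj ⟶ H := M.cotensorGrading.proj 0

/-- The projection `T^c_H(M) ⟶ M`, through `H □_H M ≅ M`. -/
def coprojOne : M.cotensorObj ⟶ M.X := M.cotensorGrading.proj 1 ≫ (toTensorPowerOne M.opBimod).unop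

/-- The comultiplication of the relative cotensor coalgebra `T^c_H(M)`. -/
def cotensorComul : M.cotensorObj ⟶ M.cotensorObj ⊗ M.cotensorObj :=
  Sigma.desc fun n => ∑ p : Finset.HasAntidiagonal.antidiagonal n,
    eqToHom (congrArg M.copower (Finset.HasAntidiagonal.mem_antidiagonal.1 p.2).symm) ≫
      M.copowerComul p.1.1 p.1.2 ≫ (M.cotensorGrading.inj p.1.1 ⊗ₘ M.cotensorGrading.inj p.1.2)

end HopfBimodule

/-- The bialgebra structure of the relative tensor algebra: its algebra structure is the usual one,
and the comultiplication and the counit, which are morphisms of algebras, are prescribed on `H` and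
on `M`. -/
structure TensorBialgebra {H : C} [BimonObj H] (M : HopfBimodule H) where
  bimon : BimonObj M.tensorObj
  one_eq : η[M.tensorObj] = η[H] ≫ M.inclZero
  mul_eq : μ[M.tensorObj] = M.tensorMul
  inclZero_comul : M.inclZero ≫ Δ[M.tensorObj] = Δ[H] ≫ (M.inclZero ⊗ₘ M.inclZero)
  inclOne_comul : M.inclOne ≫ Δ[M.tensorObj] =
    M.coactLeft ≫ (M.inclZero ⊗ₘ M.inclOne) + M.coactRight ≫ (M.inclOne ⊗ₘ M.inclZero)
  inclZero_counit : M.inclZero ≫ ε[M.tensorObj] = ε[H]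
  inclOne_counit : M.inclOne ≫ ε[M.tensorObj] = 0

/-- The bialgebra structure of the relative cotensor coalgebra: its coalgebra structure is the usual
one, and the multiplication and the unit, which are morphisms of coalgebras, are prescribed after
projection to `H` and to `M`. -/
structure CotensorBialgebra {H : C} [BimonObj H] (M : HopfBimodule H) where
  bimon : BimonObj M.cotensorObj
  counit_eq : ε[M.cotensorObj] = M.coprojZero ≫ ε[H]
  comul_eq : Δ[M.cotensorObj] = M.cotensorComul
  mul_coprojZero : μ[M.cotensorObj] ≫ M.coprojZero = (M.coprojZero ⊗ₘ M.coprojZero) ≫ μ[H]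
  mul_coprojOne : μ[M.cotensorObj] ≫ M.coprojOne =
    (M.coprojZero ⊗ₘ M.coprojOne) ≫ M.actLeft + (M.coprojOne ⊗ₘ M.coprojZero) ≫ M.actRight
  one_coprojZero : η[M.cotensorObj] ≫ M.coprojZero = η[H]
  one_coprojOne : η[M.cotensorObj] ≫ M.coprojOne = 0

/-- A morphism that maps components to components of the same degree. -/
def Grading.IsGradedHom {X Y : C} (G : Grading X) (K : Grading Y) (f : X ⟶ Y) : Prop :=
  ∀ n, ∃ g : G.comp n ⟶ K.comp n, G.inj n ≫ f = g ≫ K.inj n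

/-- An isomorphism of graded bialgebras. -/
structure GradedBialgebra.Iso (A B : GradedBialgebra C) where
  iso : A.X ≅ B.X
  isBimonHom : IsBimonHom iso.hom
  isGradedHom : A.grading.IsGradedHom B.grading iso.hom

/-- The bialgebra of type one `H[M]`: the image of the morphism of algebras `F` from `T_H(M)` to
`T^c_H(M)` that extends the inclusions of `H` and of `M`, with the structure of graded bialgebra for
which the two factors `φ` and `ψ` of `F` are morphisms of graded bialgebras. -/
structure TypeOneBialgebra {H : C} [BimonObj H] (M : HopfBimodule H) extends
    GradedBialgebra C where
  T : TensorBialgebra M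
  Tc : CotensorBialgebra M
  F : M.tensorObj ⟶ M.cotensorObj
  F_isMonHom : letI := T.bimon; letI := Tc.bimon; IsMonHom F
  inclZero_F : M.inclZero ≫ F = M.coinclZero
  inclOne_F : M.inclOne ≫ F = M.coinclOne
  φ : M.tensorObj ⟶ X
  ψ : X ⟶ M.cotensorObj
  fac : φ ≫ ψ = F
  φ_epi : Epi φ
  ψ_mono : Mono ψ
  φ_isBimonHom : letI := T.bimon; IsBimonHom φ
  ψ_isBimonHom : letI := Tc.bimon; IsBimonHom ψ
  φ_isGradedHom : M.tensorGrading.IsGradedHom grading φ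
  ψ_isGradedHom : grading.IsGradedHom M.cotensorGrading ψ

namespace Grading

variable {X : C} (G : Grading X) (p : ℕ → Prop)

/-- The direct sum of the components whose degree satisfies `p`, as a subobject of `X`. -/
def partι : (∐ fun i : {i // p i} => G.comp i.1) ⟶ X := Sigma.desc fun i => G.inj i.1

open Classical in
instance : IsSplitMono (G.partι p) :=
  ⟨⟨⟨Cofan.IsColimit.desc G.isColimit fun n =>
      if h : p n then Sigma.ι (fun i : {i // p i} => G.comp i.1) ⟨n, h⟩ else 0, by
    refine Sigma.hom_ext _ _ fun i => ?_
    rw [partι, Sigma.ι_desc_assoc]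
    exact (Cofan.IsColimit.fac G.isColimit _ i.1).trans (by simp [i.2])⟩⟩⟩

/-- The subobject `X(n)`: the direct sum of the components of degree less than `n`. -/
def head (n : ℕ) : Subobject X := Subobject.mk (G.partι (· < n))

/-- The subobject `X[n]`: the direct sum of the components of degree at least `n`. -/
def tail (n : ℕ) : Subobject X := Subobject.mk (G.partι (n ≤ ·))

end Grading

/-- The image of `S ⊗ S` under the multiplication. -/
def subobjectSq {X : C} [MonObj X] (S : Subobject X) : Subobject X :=
  imageSubobject ((S.arrow ⊗ₘ S.arrow) ≫ μ[X])

/-- The wedge product of two subobjects of a coalgebra. -/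
def wedge {X : C} [ComonObj X] (S T : Subobject X) : Subobject X :=
  kernelSubobject (Δ[X] ≫ (cokernel.π S.arrow ⊗ₘ cokernel.π T.arrow))

namespace GradedBialgebra

/-- `B` is the bialgebra of type one `B₀[B₁]`, up to isomorphism of graded bialgebras. -/
def IsTypeOne (B : GradedBialgebra C) : Prop :=
  ∃ A : TypeOneBialgebra B.degOne, Nonempty (B.Iso A.toGradedBialgebra)

/-- `B` is the bialgebra of type one `B₀[B₁]`, through an isomorphism of graded bialgebras that is
compatible with the canonical morphisms from `B₀` and from `B₁`. -/
def IsCanonicallyTypeOne (B : GradedBialgebra C) : Prop :=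
  ∃ (A : TypeOneBialgebra B.degOne) (e : B.Iso A.toGradedBialgebra),
    B.grading.inj 0 ≫ e.iso.hom = B.degOne.inclZero ≫ A.φ ∧
      B.grading.inj 1 ≫ e.iso.hom = B.degOne.inclOne ≫ A.φ

end GradedBialgebra

end TypeOneBialgebras

end

end TypeOne

/-!
A graded bialgebra `B` is the bialgebra of type one of `B₀` and `B₁` exactly when it is generated in
degree one (`B[2] = B[1]²`) and cogenerated in degree one (`B(2) = B₀ ∧ B₀`).

The inclusions of `B₀` and `B₁` extend to a morphism of algebras `fromTensor : T ⟶ B`, and the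
projections to `B₀` and `B₁` lift to a morphism of coalgebras `toCotensor : B ⟶ T^c`. Both are
graded. An algebra morphism on `T` is determined by its restrictions to `H` and `M`
(`tensorAlg_hom_ext`), and a coalgebra morphism to `T^c` by its projections to `H` and `M`
(`cotensorCoalg_hom_ext`), so both are morphisms of bialgebras, and their composite is the canonical
morphism `F`. Hence `B` is the image of `F` as soon as `fromTensor` is epic and `toCotensor` is
monic. In degrees zero and one their components are split by the identities of `B₀` and `B₁`. In
degree `n ≥ 2` the first condition says that `B_n` is spanned by products of elements of smaller
positive degree (`Grading.eq_zero_of_mulComp`), the second that an element of `B_n` vanishes when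
its comultiplication has no components in smaller positive degrees
(`Grading.eq_zero_of_comulComp`), so induction on the degree applies (`epi_fromTpow`,
`mono_toCpow`).

Conversely, let `f : T ⟶ B` be a graded epimorphism of algebras. Since `M^{⊗ n} ⊗ M ⟶ M^{⊗ (n + 1)}`
is epic, so is the multiplication `B_n ⊗ B_1 ⟶ B_{n + 1}` (`epi_mulComp`), which gives
`B[2] ≤ B[1]²`; dually, a graded monomorphism of coalgebras to `T^c` makes the components
`B_{n + 1} ⟶ B_n ⊗ B_1` of the comultiplication monic (`mono_comulComp`), which gives
`B₀ ∧ B₀ ≤ B(2)`. The other two inclusions hold in every graded bialgebra.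

The bialgebras `T` and `T^c` are constructed from the same theory of multiplicative families on
tensor powers, applied to the category and to its opposite. For `T^c` two facts are needed which
have no counterpart for `T`, since a coproduct is not a product. The projections of a direct sum
are jointly monic: this is where AB5 enters (`Grading.eq_zero_of_comp_proj`). A family of morphisms
to the cotensor powers assembles to a morphism to their direct sum only under a finiteness
condition, which is guaranteed by degree (`IsHomogeneousFamily.lift_eq_zero`).
-/

namespace TypeOne

noncomputable section

section TensorHom

variable {D : Type u} [Category.{v} D] [MonoidalCategory D] {X Y Z W V : D}

/-! ### Composition with whiskered morphisms -/

lemma tensorHom_whiskerLeft (f : X ⟶ Y) (g : Z ⟶ W) (h : W ⟶ V) :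
    (f ⊗ₘ g) ≫ Y ◁ h = (f ⊗ₘ g ≫ h) := by
  rw [← id_tensorHom, tensorHom_comp_tensorHom, Category.comp_id]

lemma tensorHom_whiskerRight (f : X ⟶ Y) (g : Z ⟶ W) (h : Y ⟶ V) :
    (f ⊗ₘ g) ≫ h ▷ W = (f ≫ h ⊗ₘ g) := by
  rw [← tensorHom_id, tensorHom_comp_tensorHom, Category.comp_id]

lemma whiskerLeft_tensorHom (f : X ⟶ Y) (g : Z ⟶ W) (h : W ⟶ V) :
    X ◁ g ≫ (f ⊗ₘ h) = (f ⊗ₘ g ≫ h) := by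
  rw [← id_tensorHom, tensorHom_comp_tensorHom, Category.id_comp]

lemma whiskerRight_tensorHom (f : X ⟶ Y) (g : Z ⟶ W) (h : Y ⟶ V) :
    f ▷ Z ≫ (h ⊗ₘ g) = (f ≫ h ⊗ₘ g) := by
  rw [← tensorHom_id, tensorHom_comp_tensorHom, Category.id_comp]

lemma tensorHom_tensorμ_mul [BraidedCategory D] {R S : D} [MonObj R] [MonObj S] (a : X ⟶ R)
    (b : Y ⟶ R) (c : Z ⟶ S) (d : W ⟶ S) : ((a ⊗ₘ c) ⊗ₘ (b ⊗ₘ d)) ≫ μ[R ⊗ S] =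
      tensorμ X Z Y W ≫ ((a ⊗ₘ b) ≫ μ[R] ⊗ₘ (c ⊗ₘ d) ≫ μ[S]) := by
  change _ ≫ tensorμ R S R S ≫ (μ[R] ⊗ₘ μ[S]) = _
  rw [tensorμ_natural_assoc, tensorHom_comp_tensorHom]

end TensorHom

section Powers

variable {D : Type u} [Category.{v} D] [MonoidalCategory D] [HasCoequalizers D]
  [∀ X : D, PreservesColimitsOfShape WalkingParallelPair (tensorLeft X)]
  [∀ X : D, PreservesColimitsOfShape WalkingParallelPair (tensorRight X)]
  {A : Mon D} (M : Bimod A A)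

/-! ### Relative tensor powers -/

/-- The object underlying the `n`-th tensor power of `M` over `A`. -/
def tpow (n : ℕ) : D := (tensorPower M n).X

/-- The right action of `A` on a tensor power. -/
def tpowAct (n : ℕ) : tpow M n ⊗ A.X ⟶ tpow M n := (tensorPower M n).act

/-- The quotient morphism from `P n ⊗ M` to `P (n + 1) = P n ⊗_A M`. -/
def tpowπ (n : ℕ) : tpow M n ⊗ M.X ⟶ tpow M (n + 1) := relTensorπ (tensorPower M n) M

/-- The multiplication `P a ⊗ P b ⟶ P (a + b)` of the tensor powers. -/
def tpowMul (a b : ℕ) : tpow M a ⊗ tpow M b ⟶ tpow M (a + b) := (tensorPowerMulAux M a b).1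

/-- The identification of tensor powers with equal exponents. -/
abbrev tpowCast {a b : ℕ} (h : a = b) : tpow M a ⟶ tpow M b := eqToHom (congrArg (tpow M) h)

instance (n : ℕ) : Epi (tpowπ M n) :=
  inferInstanceAs (Epi (relTensorπ (tensorPower M n) M))

instance (n : ℕ) (Z : D) : Epi (tpowπ M n ▷ Z) :=
  inferInstanceAs (Epi (relTensorπ (tensorPower M n) M ▷ Z))

instance (n : ℕ) (Z : D) : Epi (Z ◁ tpowπ M n) :=
  inferInstanceAs (Epi (Z ◁ relTensorπ (tensorPower M n) M))

/-- The identification of `A` with the tensor power of exponent zero. -/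
def tpowZero : A.X ≅ tpow M 0 := Iso.refl _

lemma tpowZero_act : (tpowZero M).hom ▷ A.X ≫ tpowAct M 0 = μ[A.X] ≫ (tpowZero M).hom := by
  change 𝟙 A.X ▷ A.X ≫ μ[A.X] = μ[A.X] ≫ 𝟙 A.X
  simp

/-- The unit of `A`, as a morphism to the tensor power of exponent zero. -/
def tpowUnit : 𝟙_ D ⟶ tpow M 0 := η[A.X] ≫ (tpowZero M).hom

lemma tpowAct_one (n : ℕ) : tpow M n ◁ η[A.X] ≫ tpowAct M n = (ρ_ _).hom :=
  (tensorPower M n).act_one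

lemma tpowπ_act (n : ℕ) : tpowπ M n ▷ A.X ≫ tpowAct M (n + 1) =
    (α_ _ _ _).hom ≫ tpow M n ◁ M.actRight ≫ tpowπ M n :=
  relTensorπ_act (tensorPower M n) M

lemma tpowπ_condition (n : ℕ) : tpowAct M n ▷ M.X ≫ tpowπ M n =
    (α_ _ _ _).hom ≫ tpow M n ◁ M.actLeft ≫ tpowπ M n :=
  relTensor_condition (tensorPower M n) M

lemma tpowZero_mul (a : ℕ) : tpow M a ◁ (tpowZero M).hom ≫ tpowMul M a 0 = tpowAct M a := by
  change (tensorPower M a).X ◁ 𝟙 A.X ≫ (tensorPower M a).act = (tensorPower M a).act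
  simp

lemma tpow_whiskerLeft_ext {a : ℕ} {Z : D} {f g : tpow M a ⊗ tpow M 0 ⟶ Z}
    (h : tpow M a ◁ (tpowZero M).hom ≫ f = tpow M a ◁ (tpowZero M).hom ≫ g) : f = g :=
  (cancel_epi _).1 h

lemma tpowMul_succ (a b : ℕ) :
    tpow M a ◁ tpowπ M b ≫ tpowMul M a (b + 1) =
      (α_ _ _ _).inv ≫ tpowMul M a b ▷ M.X ≫ tpowπ M (a + b) :=
  relTensorπ_lift M _ (tensorPowerMulAux M a b).2

lemma tpowMul_act (a b : ℕ) :
    tpow M a ◁ tpowAct M b ≫ tpowMul M a b =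
      (α_ _ _ _).inv ≫ tpowMul M a b ▷ A.X ≫ tpowAct M (a + b) :=
  (tensorPowerMulAux M a b).2

lemma tpowπ_cast {a b : ℕ} (h : a = b) :
    tpowπ M a ≫ tpowCast M (congrArg (· + 1) h) = tpowCast M h ▷ M.X ≫ tpowπ M b := by
  subst h
  simp

lemma tpowMul_assoc (a b c : ℕ) :
    tpowMul M a b ▷ tpow M c ≫ tpowMul M (a + b) c ≫ tpowCast M (add_assoc a b c) =
      (α_ _ _ _).hom ≫ tpow M a ◁ tpowMul M b c ≫ tpowMul M a (b + c) := by
  induction c with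
  | zero =>
    rw [← cancel_epi ((tpow M a ⊗ tpow M b) ◁ (tpowZero M).hom), whisker_exchange_assoc,
      associator_naturality_right_assoc, ← MonoidalCategory.whiskerLeft_comp_assoc, tpowZero_mul,
      reassoc_of% tpowZero_mul]
    erw [tpowMul_act]
    simp only [tpowCast, eqToHom_refl, Category.comp_id, Iso.hom_inv_id_assoc]
  | succ c ih =>
    rw [← cancel_epi ((tpow M a ⊗ tpow M b) ◁ tpowπ M c)]
    have e1 : tpowπ M (a + b + c) ≫ tpowCast M (add_assoc a b (c + 1)) = _ :=
      tpowπ_cast M (add_assoc a b c)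
    have e4 : tpow M a ◁ tpowπ M (b + c) ≫ tpowMul M a (b + (c + 1)) = _ :=
      tpowMul_succ M a (b + c)
    rw [whisker_exchange_assoc, reassoc_of% tpowMul_succ, e1,
      associator_naturality_right_assoc, ← MonoidalCategory.whiskerLeft_comp_assoc, tpowMul_succ]
    simp only [MonoidalCategory.whiskerLeft_comp, Category.assoc]
    rw [e4, associator_inv_naturality_left_assoc, ← comp_whiskerRight_assoc,
      ← comp_whiskerRight_assoc, Category.assoc, ih]
    simp

lemma one_tpowMul (b : ℕ) :
    tpowUnit M ▷ tpow M b ≫ tpowMul M 0 b ≫ tpowCast M (zero_add b) = (λ_ _).hom := by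
  induction b with
  | zero =>
    rw [← cancel_epi (_ ◁ (tpowZero M).hom), whisker_exchange_assoc, reassoc_of% tpowZero_mul,
      tpowUnit, comp_whiskerRight_assoc, reassoc_of% tpowZero_act, MonObj.one_mul_assoc,
      leftUnitor_naturality]
    simp [tpowCast]
  | succ b ih =>
    rw [← cancel_epi (_ ◁ tpowπ M b)]
    have e1 : tpowπ M (0 + b) ≫ tpowCast M (zero_add (b + 1)) = _ :=
      tpowπ_cast M (zero_add b)
    rw [whisker_exchange_assoc, reassoc_of% tpowMul_succ, e1, associator_inv_naturality_left_assoc,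
      ← comp_whiskerRight_assoc, ← comp_whiskerRight_assoc, Category.assoc, ih]
    simp

lemma tpowMul_one (a : ℕ) :
    tpow M a ◁ tpowUnit M ≫ tpowMul M a 0 = (ρ_ _).hom := by
  rw [tpowUnit, MonoidalCategory.whiskerLeft_comp_assoc, tpowZero_mul]
  exact tpowAct_one M a

/-- The canonical morphism from `M` to the first tensor power. -/
def toTpowOne : M.X ⟶ tpow M 1 := toTensorPowerOne M

/-- The canonical morphism from the first tensor power to `M`. -/
def ofTpowOne : tpow M 1 ⟶ M.X := ofTensorPowerOne M

lemma toTpowOne_def : toTpowOne M = (λ_ M.X).inv ≫ tpowUnit M ▷ M.X ≫ tpowπ M 0 := by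
  rw [tpowUnit]
  -- The isomorphism `tpowZero` is an identity morphism.
  erw [Category.comp_id]
  rfl

lemma tpowπ_ofTpowOne : (tpowZero M).hom ▷ M.X ≫ tpowπ M 0 ≫ ofTpowOne M = M.actLeft := by
  have : (𝟙 A.X) ▷ M.X ≫ relTensorπ (RightModule.regular A) M ≫ ofTensorPowerOne M =
      M.actLeft := by
    rw [id_whiskerRight, Category.id_comp]
    exact coequalizer.π_desc _ _
  exact this

lemma actLeft_toTpowOne : M.actLeft ≫ toTpowOne M = (tpowZero M).hom ▷ M.X ≫ tpowπ M 0 := by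
  rw [toTpowOne_def, leftUnitor_inv_naturality_assoc, whisker_exchange_assoc,
    ← cancel_epi (λ_ _).hom, Iso.hom_inv_id_assoc]
  have h := tpowπ_condition M 0
  rw [← Iso.inv_comp_eq] at h
  have e : tpowUnit M ▷ A.X ≫ tpowAct M 0 = (λ_ A.X).hom ≫ (tpowZero M).hom := by
    rw [tpowUnit, comp_whiskerRight, Category.assoc, tpowZero_act, MonObj.one_mul_assoc]
  rw [← h, associator_inv_naturality_left_assoc, ← comp_whiskerRight_assoc, e]
  simp

@[simp]
lemma toTpowOne_ofTpowOne : toTpowOne M ≫ ofTpowOne M = 𝟙 _ := by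
  rw [toTpowOne_def, Category.assoc, Category.assoc, tpowUnit, comp_whiskerRight_assoc,
    tpowπ_ofTpowOne, M.one_actLeft, Iso.inv_hom_id]

@[simp]
lemma ofTpowOne_toTpowOne : ofTpowOne M ≫ toTpowOne M = 𝟙 _ := by
  rw [← cancel_epi ((tpowZero M).hom ▷ M.X ≫ tpowπ M 0), Category.assoc,
    reassoc_of% tpowπ_ofTpowOne, actLeft_toTpowOne, Category.comp_id]

instance : IsSplitEpi (toTpowOne M) := ⟨⟨⟨ofTpowOne M, ofTpowOne_toTpowOne M⟩⟩⟩

lemma tpowMul_toTpowOne (a : ℕ) : tpow M a ◁ toTpowOne M ≫ tpowMul M a 1 = tpowπ M a := by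
  rw [toTpowOne_def, MonoidalCategory.whiskerLeft_comp, MonoidalCategory.whiskerLeft_comp,
    Category.assoc, Category.assoc, tpowMul_succ,
    associator_inv_naturality_middle_assoc, ← comp_whiskerRight_assoc, tpowMul_one]
  simp

instance (a : ℕ) : Epi (tpowMul M a 1) := by
  have : Epi (tpow M a ◁ toTpowOne M ≫ tpowMul M a 1) := by
    rw [tpowMul_toTpowOne]; infer_instance
  exact epi_of_epi (tpow M a ◁ toTpowOne M) _

lemma tpowZero_mul_zero :
    ((tpowZero M).hom ⊗ₘ (tpowZero M).hom) ≫ tpowMul M 0 0 = μ[A.X] ≫ (tpowZero M).hom := by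
  rw [MonoidalCategory.tensorHom_def, Category.assoc, tpowZero_mul, tpowZero_act]

lemma tpowMul_toTpowOne_zero :
    ((tpowZero M).hom ⊗ₘ toTpowOne M) ≫ tpowMul M 0 1 = M.actLeft ≫ toTpowOne M := by
  rw [MonoidalCategory.tensorHom_def, Category.assoc]
  erw [tpowMul_toTpowOne M 0]
  rw [actLeft_toTpowOne]

lemma toTpowOne_mul_zero :
    (toTpowOne M ⊗ₘ (tpowZero M).hom) ≫ tpowMul M 1 0 = M.actRight ≫ toTpowOne M := by
  have e := tpowπ_act M 0
  rw [MonoidalCategory.tensorHom_def, Category.assoc, tpowZero_mul, toTpowOne_def,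
    comp_whiskerRight, comp_whiskerRight, Category.assoc, Category.assoc]
  erw [e]
  rw [associator_naturality_left_assoc, ← whisker_exchange_assoc, leftUnitor_inv_naturality_assoc]
  simp

/-! ### Multiplicative families on the tensor powers -/

/-- A pair of morphisms from `A` and from `M` to a monoid object `R` that respects all the
structure: an algebra morphism `f₀` and a morphism `f₁` of bimodules along `f₀`. -/
structure IsBimodPair {R : D} [MonObj R] (f₀ : A.X ⟶ R) (f₁ : M.X ⟶ R) : Prop where
  one : η[A.X] ≫ f₀ = η[R]
  mul : μ[A.X] ≫ f₀ = (f₀ ⊗ₘ f₀) ≫ μ[R]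
  left : M.actLeft ≫ f₁ = (f₀ ⊗ₘ f₁) ≫ μ[R]
  right : M.actRight ≫ f₁ = (f₁ ⊗ₘ f₀) ≫ μ[R]

lemma tensorHom_mul_assoc {R X Y Z : D} [MonObj R] (f : X ⟶ R) (g : Y ⟶ R) (h : Z ⟶ R) :
    ((f ⊗ₘ g) ≫ μ[R] ⊗ₘ h) ≫ μ[R] = (α_ _ _ _).hom ≫ (f ⊗ₘ (g ⊗ₘ h) ≫ μ[R]) ≫ μ[R] := by
  have e1 : ((f ⊗ₘ g) ≫ μ[R] ⊗ₘ h) = ((f ⊗ₘ g) ⊗ₘ h) ≫ μ[R] ▷ R := by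
    rw [← tensorHom_id, tensorHom_comp_tensorHom, Category.comp_id]
  have e2 : (f ⊗ₘ (g ⊗ₘ h) ≫ μ[R]) = (f ⊗ₘ (g ⊗ₘ h)) ≫ R ◁ μ[R] := by
    rw [← id_tensorHom, tensorHom_comp_tensorHom, Category.comp_id]
  rw [e1, e2, Category.assoc, MonObj.mul_assoc, associator_naturality_assoc, Category.assoc]

variable {M} {R : D} [MonObj R] {f₀ : A.X ⟶ R} {f₁ : M.X ⟶ R}

/-- The product morphism `P n ⟶ R`, on elements `m₁ ⊗ ⋯ ⊗ mₙ ↦ f₁ m₁ ⋯ f₁ mₙ`, together with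
its right `A`-linearity, on which the next step of the recursion depends. -/
def IsBimodPair.liftAux (h : IsBimodPair M f₀ f₁) :
    ∀ n, { f : tpow M n ⟶ R // tpowAct M n ≫ f = (f ⊗ₘ f₀) ≫ μ[R] }
  | 0 => ⟨(tpowZero M).inv ≫ f₀, by
      rw [← cancel_epi ((tpowZero M).hom ▷ A.X), reassoc_of% tpowZero_act,
        Iso.hom_inv_id_assoc, h.mul, ← tensorHom_id, tensorHom_comp_tensorHom_assoc]
      simp⟩
  | n + 1 =>
    have h₁ : tpowAct M n ▷ M.X ≫ ((h.liftAux n).1 ⊗ₘ f₁) ≫ μ[R] =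
        (α_ (tpow M n) A.X M.X).hom ≫ tpow M n ◁ M.actLeft ≫ ((h.liftAux n).1 ⊗ₘ f₁) ≫ μ[R] := by
      rw [← tensorHom_id, ← id_tensorHom, tensorHom_comp_tensorHom_assoc, (h.liftAux n).2,
        tensorHom_comp_tensorHom_assoc, h.left, Category.id_comp, Category.id_comp,
        tensorHom_mul_assoc]
    have h₂ : ∃ g : tpow M (n + 1) ⟶ R, tpowπ M n ≫ g = ((h.liftAux n).1 ⊗ₘ f₁) ≫ μ[R] :=
      ⟨coequalizer.desc _ (h₁.trans (Category.assoc _ _ _).symm), coequalizer.π_desc _ _⟩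
    ⟨h₂.choose, by
      rw [← cancel_epi (tpowπ M n ▷ A.X), reassoc_of% tpowπ_act, h₂.choose_spec, ← tensorHom_id,
        ← id_tensorHom, tensorHom_comp_tensorHom_assoc, tensorHom_comp_tensorHom_assoc,
        h₂.choose_spec, h.right, Category.id_comp, Category.id_comp, tensorHom_mul_assoc]⟩

/-- The product morphism `P n ⟶ R`, on elements `m₁ ⊗ ⋯ ⊗ mₙ ↦ f₁ m₁ ⋯ f₁ mₙ`. -/
def IsBimodPair.lift (h : IsBimodPair M f₀ f₁) (n : ℕ) : tpow M n ⟶ R := (h.liftAux n).1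

lemma IsBimodPair.tpowZero_lift (h : IsBimodPair M f₀ f₁) :
    (tpowZero M).hom ≫ h.lift 0 = f₀ := Iso.hom_inv_id_assoc _ _

lemma IsBimodPair.tpowAct_lift (h : IsBimodPair M f₀ f₁) (n : ℕ) :
    tpowAct M n ≫ h.lift n = (h.lift n ⊗ₘ f₀) ≫ μ[R] := (h.liftAux n).2

lemma IsBimodPair.tpowπ_lift (h : IsBimodPair M f₀ f₁) (n : ℕ) :
    tpowπ M n ≫ h.lift (n + 1) = (h.lift n ⊗ₘ f₁) ≫ μ[R] :=
  Exists.choose_spec (p := fun g => tpowπ M n ≫ g = _) _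

lemma IsBimodPair.toTpowOne_lift (h : IsBimodPair M f₀ f₁) : toTpowOne M ≫ h.lift 1 = f₁ := by
  rw [toTpowOne_def, Category.assoc, Category.assoc, h.tpowπ_lift, ← tensorHom_id,
    tensorHom_comp_tensorHom_assoc, tpowUnit, Category.assoc, h.tpowZero_lift,
    h.one, MonoidalCategory.tensorHom_def']
  simp

lemma IsBimodPair.tpowMul_lift (h : IsBimodPair M f₀ f₁) (a b : ℕ) :
    tpowMul M a b ≫ h.lift (a + b) = (h.lift a ⊗ₘ h.lift b) ≫ μ[R] := by
  induction b with
  | zero =>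
    apply tpow_whiskerLeft_ext
    rw [reassoc_of% tpowZero_mul]
    erw [h.tpowAct_lift a]
    rw [← id_tensorHom, tensorHom_comp_tensorHom_assoc, h.tpowZero_lift, Category.id_comp]
  | succ b ih =>
    have e : tpowπ M (a + b) ≫ h.lift (a + (b + 1)) = _ := h.tpowπ_lift (a + b)
    rw [← cancel_epi (tpow M a ◁ tpowπ M b), reassoc_of% tpowMul_succ, e, ← tensorHom_id,
      ← id_tensorHom, tensorHom_comp_tensorHom_assoc, tensorHom_comp_tensorHom_assoc, ih,
      h.tpowπ_lift, Category.id_comp, Category.id_comp, tensorHom_mul_assoc,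
      Iso.inv_hom_id_assoc]

/-- A multiplicative family on the tensor powers is determined by its values on `A` and `M`. -/
lemma tpow_family_ext {f g : ∀ n, tpow M n ⟶ R}
    (hf : ∀ n, tpowMul M n 1 ≫ f (n + 1) = (f n ⊗ₘ f 1) ≫ μ[R])
    (hg : ∀ n, tpowMul M n 1 ≫ g (n + 1) = (g n ⊗ₘ g 1) ≫ μ[R])
    (h₀ : (tpowZero M).hom ≫ f 0 = (tpowZero M).hom ≫ g 0)
    (h₁ : toTpowOne M ≫ f 1 = toTpowOne M ≫ g 1) (n : ℕ) : f n = g n := by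
  have h1 : f 1 = g 1 := by
    simpa only [reassoc_of% ofTpowOne_toTpowOne M] using congrArg (ofTpowOne M ≫ ·) h₁
  induction n with
  | zero => exact (cancel_epi _).1 h₀
  | succ n ih => rw [← cancel_epi (tpowMul M n 1), hf, hg, ih, h1]

end Powers

namespace Grading

section Whisker

/-! ### Gradings of tensor products -/

variable {C : Type u} [Category.{v} C] [Preadditive C]
  [MonoidalCategory C] [MonoidalPreadditive C]
  [∀ X : C, PreservesColimitsOfShape (Discrete ℕ) (tensorLeft X)]
  [∀ X : C, PreservesColimitsOfShape (Discrete ℕ) (tensorRight X)]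
  {X Y Z : C} (G : Grading X) (K : Grading Y) (L : Grading Z)

/-- The grading of `X ⊗ Z` induced by a grading of `X`. -/
abbrev whiskerRight (Z : C) : Grading (X ⊗ Z) where
  comp n := G.comp n ⊗ Z
  inj n := G.inj n ▷ Z
  isColimit := isColimitCofanMkObjOfIsColimit (tensorRight Z) _ G.inj G.isColimit

/-- The grading of `Z ⊗ X` induced by a grading of `X`. -/
abbrev whiskerLeft (Z : C) : Grading (Z ⊗ X) where
  comp n := Z ⊗ G.comp n
  inj n := Z ◁ G.inj n
  isColimit := isColimitCofanMkObjOfIsColimit (tensorLeft Z) _ G.inj G.isColimit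

lemma whiskerRight_proj (Z : C) (n : ℕ) : (G.whiskerRight Z).proj n = G.proj n ▷ Z :=
  (G.whiskerRight Z).hom_ext fun m => by
    by_cases h : m = n
    · subst h
      rw [inj_proj_self, ← comp_whiskerRight, inj_proj_self, id_whiskerRight]
    · rw [inj_proj_ne _ h, ← comp_whiskerRight, inj_proj_ne _ h,
        MonoidalPreadditive.zero_whiskerRight]

lemma whiskerLeft_proj (Z : C) (n : ℕ) : (G.whiskerLeft Z).proj n = Z ◁ G.proj n :=
  (G.whiskerLeft Z).hom_ext fun m => by
    by_cases h : m = n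
    · subst h
      rw [inj_proj_self, ← MonoidalCategory.whiskerLeft_comp, inj_proj_self,
        MonoidalCategory.whiskerLeft_id]
    · rw [inj_proj_ne _ h, ← MonoidalCategory.whiskerLeft_comp, inj_proj_ne _ h,
        MonoidalPreadditive.whiskerLeft_zero]

lemma tensor3_ext {W : C} {f g : (X ⊗ Y) ⊗ Z ⟶ W}
    (h : ∀ a b c, ((G.inj a ⊗ₘ K.inj b) ⊗ₘ L.inj c) ≫ f =
      ((G.inj a ⊗ₘ K.inj b) ⊗ₘ L.inj c) ≫ g) : f = g :=
  L.whiskerLeft_ext fun c => ((K.whiskerLeft X).whiskerRight _).hom_ext fun b =>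
    ((G.whiskerRight _).whiskerRight _).hom_ext fun a => by
      simpa only [MonoidalCategory.tensorHom_def, Category.assoc, comp_whiskerRight]
        using h a b c

end Whisker

end Grading

/-! ### Projections of a direct sum are jointly monic -/

section AB5

variable {C : Type u} [Category.{v} C] [Abelian C] [HasColimits C] [AB5 C]

instance : HasExactColimitsOfShape ℕ C :=
  HasExactColimitsOfShape.of_domain_equivalence C (AsSmall.equiv (C := ℕ)).symm

namespace Grading

variable {X Y : C} (G : Grading X) (K : Grading Y)

/-- The projection of `X` that kills the components of degree at most `n`. -/
def truncation (n : ℕ) : X ⟶ X := 𝟙 X - ∑ k ∈ Finset.range (n + 1), G.proj k ≫ G.inj k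

lemma inj_truncation (a n : ℕ) :
    G.inj a ≫ G.truncation n = if a ≤ n then 0 else G.inj a := by
  rw [truncation, Preadditive.comp_sub, Category.comp_id, Preadditive.comp_sum]
  split_ifs with h
  · rw [Finset.sum_eq_single a, reassoc_of% G.inj_proj_self a, sub_self]
    · intro b _ hb
      rw [← Category.assoc, G.inj_proj_ne hb.symm, zero_comp]
    · intro ha
      exact absurd (Finset.mem_range.2 (by omega)) ha
  · rw [Finset.sum_eq_zero, sub_zero]
    intro b hb
    rw [← Category.assoc, G.inj_proj_ne (by have := Finset.mem_range.1 hb; omega), zero_comp]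

/-- The colimit of `X ⟶ X ⟶ ⋯` along the truncations is zero. A subobject whose elements have no
components is fixed by every truncation, so by exactness it embeds into that colimit. -/
lemma mono_eq_zero {I : C} (i : I ⟶ X) [Mono i] (hi : ∀ n, i ≫ G.proj n = 0) : i = 0 := by
  let Q : ℕ ⥤ C := Functor.ofSequence G.truncation
  let t : (Functor.const ℕ).obj I ⟶ Q := NatTrans.ofSequence (fun _ => i) (fun n => by
    have e : i ≫ G.truncation n = i := by
      rw [truncation, Preadditive.comp_sub, Preadditive.comp_sum, Finset.sum_eq_zero, sub_zero,
        Category.comp_id]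
      intro k _
      rw [← Category.assoc, hi, zero_comp]
    rw [Functor.ofSequence_map_homOfLE_succ]
    exact (Category.id_comp i).trans e.symm)
  have : ∀ n, Mono (t.app n) := fun n => inferInstanceAs (Mono i)
  have : Mono t := NatTrans.mono_of_mono_app t
  have hm : Mono (colim.map t) := inferInstance
  obtain ⟨c, hc⟩ : ∃ c : ∀ n, X ⟶ colimit Q, ∀ n, c n = colimit.ι Q n := ⟨_, fun _ => rfl⟩
  have hs : ∀ n, G.truncation n ≫ c (n + 1) = c n := fun n => by
    have := colimit.w Q (homOfLE (Nat.le_add_right n 1))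
    rw [Functor.ofSequence_map_homOfLE_succ] at this
    rw [hc, hc]
    exact this
  have hs2 : ∀ a k n, a ≤ n + k → G.inj a ≫ c n = 0 := by
    intro a k
    induction k with
    | zero =>
      intro n h
      rw [← hs n, ← Category.assoc, inj_truncation, if_pos (by omega), zero_comp]
    | succ k ih =>
      intro n h
      rw [← hs n, ← Category.assoc, inj_truncation]
      split_ifs
      · exact zero_comp
      · exact ih (n + 1) (by omega)
  have hz : ∀ n, colimit.ι Q n = 0 := fun n => (hc n).symm.trans <|
    G.hom_ext fun a => (hs2 a a n (by omega)).trans comp_zero.symm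
  have hc : colim.map t = 0 := colimit.hom_ext fun n => by
    rw [comp_zero]
    exact (ι_colimMap t n).trans ((congrArg (t.app n ≫ ·) (hz n)).trans comp_zero)
  obtain ⟨k, r, hk⟩ : ∃ (k : I ⟶ colim.obj ((Functor.const ℕ).obj I)) (r : _ ⟶ I), k ≫ r = 𝟙 I :=
    ⟨colimit.ι ((Functor.const ℕ).obj I) 0,
      colimit.desc ((Functor.const ℕ).obj I) ⟨I, 𝟙 _⟩, colimit.ι_desc _ _⟩
  have h1 : k = 0 := by rw [← cancel_mono (colim.map t), hc, comp_zero, comp_zero]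
  rw [← Category.id_comp i, ← hk, h1, zero_comp, zero_comp]

lemma eq_zero_of_comp_proj {Z : C} (f : Z ⟶ X) (h : ∀ n, f ≫ G.proj n = 0) : f = 0 := by
  have hi : image.ι f = 0 := G.mono_eq_zero _ fun n => by
    rw [← cancel_epi (factorThruImage f), image.fac_assoc, h, comp_zero]
  rw [← image.fac f, hi, comp_zero]

lemma proj_hom_ext {Z : C} {f g : Z ⟶ X} (h : ∀ n, f ≫ G.proj n = g ≫ G.proj n) : f = g :=
  sub_eq_zero.1 <| G.eq_zero_of_comp_proj _ fun n => by
    rw [Preadditive.sub_comp, h, sub_self]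

variable [MonoidalCategory C] [MonoidalPreadditive C]
  [∀ X : C, PreservesColimitsOfShape (Discrete ℕ) (tensorLeft X)]
  [∀ X : C, PreservesColimitsOfShape (Discrete ℕ) (tensorRight X)]

lemma proj_whiskerRight_ext {Z W : C} {f g : W ⟶ X ⊗ Z}
    (h : ∀ n, f ≫ G.proj n ▷ Z = g ≫ G.proj n ▷ Z) : f = g :=
  (G.whiskerRight Z).proj_hom_ext fun n => by rw [whiskerRight_proj, h]

lemma proj_whiskerLeft_ext {Z W : C} {f g : W ⟶ Z ⊗ X}
    (h : ∀ n, f ≫ Z ◁ G.proj n = g ≫ Z ◁ G.proj n) : f = g :=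
  (G.whiskerLeft Z).proj_hom_ext fun n => by rw [whiskerLeft_proj, h]

lemma proj_tensor3_ext {Z : C} (L : Grading Z) {W : C} {f g : W ⟶ (X ⊗ Y) ⊗ Z}
    (h : ∀ a b c, f ≫ ((G.proj a ⊗ₘ K.proj b) ⊗ₘ L.proj c) =
      g ≫ ((G.proj a ⊗ₘ K.proj b) ⊗ₘ L.proj c)) : f = g :=
  L.proj_whiskerLeft_ext fun c => ((K.whiskerLeft X).whiskerRight _).proj_hom_ext fun b =>
    ((G.whiskerRight _).whiskerRight _).proj_hom_ext fun a => by
      simpa only [whiskerRight_proj, whiskerLeft_proj, MonoidalCategory.tensorHom_def',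
        Category.assoc, comp_whiskerRight] using h a b c

lemma proj_tensor_ext {W : C} {f g : W ⟶ X ⊗ Y}
    (h : ∀ a b, f ≫ (G.proj a ⊗ₘ K.proj b) = g ≫ (G.proj a ⊗ₘ K.proj b)) : f = g :=
  G.proj_whiskerRight_ext fun a => K.proj_whiskerLeft_ext fun b => by
    simpa only [MonoidalCategory.tensorHom_def, Category.assoc] using h a b

end Grading

end AB5

section TensorAlgebra

variable {C : Type u} [Category.{v} C] [Abelian C] [MonoidalCategory C] [BraidedCategory C]
  [MonoidalPreadditive C] [HasColimits C] [ExactTensor C]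

namespace HopfBimodule

variable {H : C} [BimonObj H] (M : HopfBimodule H)

/-! ### The relative tensor algebra -/

/-- The inclusion of the `n`-th tensor power into `T_H(M)`. -/
def tIn (n : ℕ) : tpow M.bimod n ⟶ M.tensorObj := M.tensorGrading.inj n

variable {M} in
lemma tensorObj_hom_ext {Z : C} {f g : M.tensorObj ⟶ Z} (h : ∀ n, M.tIn n ≫ f = M.tIn n ≫ g) :
    f = g :=
  M.tensorGrading.hom_ext h

variable {M} in
lemma tensorObj_whiskerRight_ext {Z W : C} {f g : M.tensorObj ⊗ W ⟶ Z}
    (h : ∀ n, M.tIn n ▷ W ≫ f = M.tIn n ▷ W ≫ g) : f = g :=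
  M.tensorGrading.whiskerRight_ext h

variable {M} in
lemma tensorObj_whiskerLeft_ext {Z W : C} {f g : W ⊗ M.tensorObj ⟶ Z}
    (h : ∀ n, W ◁ M.tIn n ≫ f = W ◁ M.tIn n ≫ g) : f = g :=
  M.tensorGrading.whiskerLeft_ext h

variable {M} in
lemma tensorObj_tensor_ext {Z : C} {f g : M.tensorObj ⊗ M.tensorObj ⟶ Z}
    (h : ∀ a b, (M.tIn a ⊗ₘ M.tIn b) ≫ f = (M.tIn a ⊗ₘ M.tIn b) ≫ g) : f = g :=
  M.tensorGrading.tensor_ext M.tensorGrading h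

lemma tIn_mul (a b : ℕ) :
    (M.tIn a ⊗ₘ M.tIn b) ≫ M.tensorMul = tpowMul M.bimod a b ≫ M.tIn (a + b) :=
  M.tensorGrading.inj_tensorDesc M.tensorGrading _ a b

lemma tpowCast_tIn {a b : ℕ} (h : a = b) : tpowCast M.bimod h ≫ M.tIn b = M.tIn a := by
  subst h
  simp

lemma inclZero_eq : M.inclZero = (tpowZero M.bimod).hom ≫ M.tIn 0 :=
  (Category.id_comp (M.tensorGrading.inj 0)).symm

lemma inclOne_eq : M.inclOne = toTpowOne M.bimod ≫ M.tIn 1 := rfl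

lemma one_inclZero : η[H] ≫ M.inclZero = tpowUnit M.bimod ≫ M.tIn 0 := by
  rw [inclZero_eq, tpowUnit, Category.assoc]

/-- The relative tensor algebra `T_H(M)`. -/
abbrev tensorMon : MonObj M.tensorObj where
  one := η[H] ≫ M.inclZero
  mul := M.tensorMul
  one_mul := tensorObj_whiskerLeft_ext fun n => by
    rw [whisker_exchange_assoc, one_inclZero, comp_whiskerRight_assoc, ← tensorHom_def_assoc,
      tIn_mul, leftUnitor_naturality,
      ← one_tpowMul M.bimod n, Category.assoc, Category.assoc, tpowCast_tIn]
  mul_one := tensorObj_whiskerRight_ext fun n => by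
    rw [← whisker_exchange_assoc, one_inclZero, MonoidalCategory.whiskerLeft_comp_assoc,
      ← tensorHom_def'_assoc, tIn_mul, rightUnitor_naturality, ← tpowMul_one M.bimod n]
    simp
  mul_assoc := M.tensorGrading.tensor3_ext M.tensorGrading M.tensorGrading fun a b c => by
    change ((M.tIn a ⊗ₘ M.tIn b) ⊗ₘ M.tIn c) ≫ M.tensorMul ▷ M.tensorObj ≫ M.tensorMul =
      ((M.tIn a ⊗ₘ M.tIn b) ⊗ₘ M.tIn c) ≫ (α_ _ _ _).hom ≫ M.tensorObj ◁ M.tensorMul ≫ M.tensorMul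
    have e1 : ((M.tIn a ⊗ₘ M.tIn b) ⊗ₘ M.tIn c) ≫ M.tensorMul ▷ M.tensorObj =
        tpowMul M.bimod a b ▷ _ ≫ (M.tIn (a + b) ⊗ₘ M.tIn c) := by
      rw [← tensorHom_id, ← tensorHom_id, tensorHom_comp_tensorHom, tensorHom_comp_tensorHom,
        tIn_mul, Category.comp_id, Category.id_comp]
    have e2 : (M.tIn a ⊗ₘ (M.tIn b ⊗ₘ M.tIn c)) ≫ M.tensorObj ◁ M.tensorMul =
        _ ◁ tpowMul M.bimod b c ≫ (M.tIn a ⊗ₘ M.tIn (b + c)) := by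
      rw [← id_tensorHom, ← id_tensorHom, tensorHom_comp_tensorHom, tensorHom_comp_tensorHom,
        tIn_mul, Category.comp_id, Category.id_comp]
    rw [associator_naturality_assoc, reassoc_of% e1, reassoc_of% e2, tIn_mul, tIn_mul,
      ← reassoc_of% tpowMul_assoc, tpowCast_tIn]

attribute [local instance] tensorMon

variable {M} {R : C} [MonObj R] {f₀ : H ⟶ R} {f₁ : M.X ⟶ R}

/-- The morphism `T_H(M) ⟶ R` that extends `f₀` and `f₁`. -/
def tensorLift (h : IsBimodPair M.bimod f₀ f₁) : M.tensorObj ⟶ R :=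
  Sigma.desc fun n => h.lift n

lemma tIn_tensorLift (h : IsBimodPair M.bimod f₀ f₁) (n : ℕ) :
    M.tIn n ≫ tensorLift h = h.lift n := Sigma.ι_desc _ _

lemma inclZero_tensorLift (h : IsBimodPair M.bimod f₀ f₁) :
    M.inclZero ≫ tensorLift h = f₀ := by
  rw [inclZero_eq, Category.assoc, tIn_tensorLift, h.tpowZero_lift]

lemma inclOne_tensorLift (h : IsBimodPair M.bimod f₀ f₁) :
    M.inclOne ≫ tensorLift h = f₁ := by
  rw [inclOne_eq, Category.assoc, tIn_tensorLift, h.toTpowOne_lift]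

instance (h : IsBimodPair M.bimod f₀ f₁) : IsMonHom (tensorLift h) where
  one_hom := by
    change (η[H] ≫ M.inclZero) ≫ _ = _
    rw [Category.assoc, inclZero_tensorLift]
    exact h.one
  mul_hom := by
    change M.tensorMul ≫ _ = _
    refine tensorObj_tensor_ext fun a b => ?_
    rw [reassoc_of% tIn_mul, tIn_tensorLift, h.tpowMul_lift, tensorHom_comp_tensorHom_assoc,
      tIn_tensorLift, tIn_tensorLift]

/-- Algebra morphisms on `T_H(M)` are determined by their restrictions to `H` and `M`. -/
lemma tensorAlg_hom_ext (f g : M.tensorObj ⟶ R) [IsMonHom f] [IsMonHom g]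
    (h₀ : M.inclZero ≫ f = M.inclZero ≫ g) (h₁ : M.inclOne ≫ f = M.inclOne ≫ g) : f = g := by
  have key : ∀ k : M.tensorObj ⟶ R, IsMonHom k → ∀ n, tpowMul M.bimod n 1 ≫ M.tIn (n + 1) ≫ k =
      (M.tIn n ≫ k ⊗ₘ M.tIn 1 ≫ k) ≫ μ[R] := fun k hk n => by
    have h : M.tensorMul ≫ k = (k ⊗ₘ k) ≫ μ[R] := hk.mul_hom
    rw [← reassoc_of% tIn_mul, h, tensorHom_comp_tensorHom_assoc]
  refine tensorObj_hom_ext fun n => tpow_family_ext (f := fun n => M.tIn n ≫ f)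
    (g := fun n => M.tIn n ≫ g) (key f inferInstance) (key g inferInstance) ?_ ?_ n
  · simpa only [inclZero_eq, Category.assoc] using h₀
  · simpa only [inclOne_eq, Category.assoc] using h₁

variable (M) in
/-- The inclusions of `H` and `M` into the tensor algebra respect all the structure. -/
lemma isBimodPair_incl : IsBimodPair M.bimod M.inclZero M.inclOne where
  one := rfl
  mul := by
    change μ[H] ≫ M.inclZero = _ ≫ M.tensorMul
    rw [inclZero_eq, ← tensorHom_comp_tensorHom_assoc, tIn_mul]
    exact ((reassoc_of% (tpowZero_mul_zero M.bimod)) (M.tIn 0)).symm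
  left := by
    change M.actLeft ≫ _ = _ ≫ M.tensorMul
    rw [inclZero_eq, inclOne_eq, ← tensorHom_comp_tensorHom_assoc, tIn_mul]
    exact ((reassoc_of% (tpowMul_toTpowOne_zero M.bimod)) (M.tIn 1)).symm
  right := by
    change M.actRight ≫ _ = _ ≫ M.tensorMul
    rw [inclZero_eq, inclOne_eq, ← tensorHom_comp_tensorHom_assoc, tIn_mul]
    exact ((reassoc_of% (toTpowOne_mul_zero M.bimod)) (M.tIn 1)).symm

/-- The diagonal values on `H` and on `M` of the comultiplication of the tensor algebra. -/
lemma isBimodPair_comul (h : IsBimodPair M.bimod f₀ f₁) :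
    IsBimodPair M.bimod (Δ[H] ≫ (f₀ ⊗ₘ f₀))
      (M.coactLeft ≫ (f₀ ⊗ₘ f₁) + M.coactRight ≫ (f₁ ⊗ₘ f₀)) where
  one := by
    have e : η[H] ≫ f₀ = η[R] := h.one
    change η[H] ≫ _ = _
    rw [BimonObj.one_comul_assoc, MonObj.tensorObj.one_def, MonObj.tensorObj.one_def,
      Category.assoc, tensorHom_comp_tensorHom, e]
  mul := by
    have e : μ[H] ≫ f₀ = _ := h.mul
    change μ[H] ≫ _ = _
    rw [BimonObj.mul_comul_assoc, tensorHom_comp_tensorHom, e, ← tensorHom_comp_tensorHom_assoc,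
      tensorHom_tensorμ_mul]
  left := by
    have e : M.actLeft ≫ f₁ = _ := h.left
    have e' : μ[H] ≫ f₀ = _ := h.mul
    have e'' : M.actRight ≫ f₁ = _ := h.right
    change M.actLeft ≫ _ = _
    rw [MonoidalPreadditive.tensor_add, Preadditive.add_comp, Preadditive.comp_add,
      reassoc_of% M.actLeft_coactLeft, reassoc_of% M.actLeft_coactRight,
      tensorHom_comp_tensorHom, tensorHom_comp_tensorHom, e, e', ← tensorHom_comp_tensorHom_assoc,
      ← tensorHom_comp_tensorHom_assoc, tensorHom_tensorμ_mul, tensorHom_tensorμ_mul]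
  right := by
    have e : M.actLeft ≫ f₁ = _ := h.left
    have e' : μ[H] ≫ f₀ = _ := h.mul
    have e'' : M.actRight ≫ f₁ = _ := h.right
    change M.actRight ≫ _ = _
    rw [MonoidalPreadditive.add_tensor, Preadditive.add_comp, Preadditive.comp_add,
      reassoc_of% M.actRight_coactLeft, reassoc_of% M.actRight_coactRight,
      tensorHom_comp_tensorHom, tensorHom_comp_tensorHom, e'', e', ← tensorHom_comp_tensorHom_assoc,
      ← tensorHom_comp_tensorHom_assoc, tensorHom_tensorμ_mul, tensorHom_tensorμ_mul]

variable (M) in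
/-- The values on `H` and on `M` of the counit of the tensor algebra. -/
lemma isBimodPair_counit : IsBimodPair M.bimod ε[H] (0 : M.X ⟶ 𝟙_ C) where
  one := BimonObj.one_counit H
  mul := BimonObj.mul_counit H
  left := by
    rw [comp_zero, MonoidalCategory.tensorHom_def, MonoidalPreadditive.whiskerLeft_zero, comp_zero,
      zero_comp]
  right := by
    rw [comp_zero, MonoidalCategory.tensorHom_def, MonoidalPreadditive.zero_whiskerRight, zero_comp,
      zero_comp]

variable (M) in
/-- The comultiplication of the tensor algebra. -/
def tensorComul : M.tensorObj ⟶ M.tensorObj ⊗ M.tensorObj :=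
  tensorLift (isBimodPair_comul M.isBimodPair_incl)

variable (M) in
/-- The counit of the tensor algebra. -/
def tensorCounit : M.tensorObj ⟶ 𝟙_ C := tensorLift M.isBimodPair_counit

instance : IsMonHom M.tensorComul := inferInstanceAs (IsMonHom (tensorLift _))

instance : IsMonHom M.tensorCounit := inferInstanceAs (IsMonHom (tensorLift _))

lemma inclZero_tensorComul : M.inclZero ≫ M.tensorComul = Δ[H] ≫ (M.inclZero ⊗ₘ M.inclZero) :=
  inclZero_tensorLift _

lemma inclOne_tensorComul : M.inclOne ≫ M.tensorComul =
    M.coactLeft ≫ (M.inclZero ⊗ₘ M.inclOne) + M.coactRight ≫ (M.inclOne ⊗ₘ M.inclZero) :=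
  inclOne_tensorLift _

lemma inclZero_tensorCounit : M.inclZero ≫ M.tensorCounit = ε[H] := inclZero_tensorLift _

lemma inclOne_tensorCounit : M.inclOne ≫ M.tensorCounit = 0 := inclOne_tensorLift _

variable (M) in
/-- The bialgebra structure of the tensor algebra. Each axiom equates two algebra morphisms on
`T_H(M)`, so it is checked on `H` and on `M`. -/
abbrev tensorBimon : BimonObj M.tensorObj where
  toMonObj := M.tensorMon
  comul := M.tensorComul
  counit := M.tensorCounit
  counit_comul := by
    rw [← cancel_mono (λ_ M.tensorObj).hom, Iso.inv_hom_id]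
    refine tensorAlg_hom_ext _ _ ?_ ?_
    · rw [Category.assoc, reassoc_of% inclZero_tensorComul, ← tensorHom_id,
        tensorHom_comp_tensorHom_assoc, inclZero_tensorCounit, Category.comp_id,
        ComonObj.counit_comul_hom_assoc]
      simp
    · rw [Category.assoc, reassoc_of% inclOne_tensorComul, Preadditive.add_comp, Category.assoc,
        Category.assoc, ← tensorHom_id,
        tensorHom_comp_tensorHom_assoc, tensorHom_comp_tensorHom_assoc, inclZero_tensorCounit,
        inclOne_tensorCounit, Category.comp_id, Category.comp_id]
      have := M.coactLeft_counit
      simp [MonoidalCategory.tensorHom_def, reassoc_of% this]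
  comul_counit := by
    rw [← cancel_mono (ρ_ M.tensorObj).hom, Iso.inv_hom_id]
    refine tensorAlg_hom_ext _ _ ?_ ?_
    · rw [Category.assoc, reassoc_of% inclZero_tensorComul, ← id_tensorHom,
        tensorHom_comp_tensorHom_assoc, inclZero_tensorCounit, Category.comp_id,
        ComonObj.comul_counit_hom_assoc]
      simp
    · rw [Category.assoc, reassoc_of% inclOne_tensorComul, Preadditive.add_comp, Category.assoc,
        Category.assoc, ← id_tensorHom,
        tensorHom_comp_tensorHom_assoc, tensorHom_comp_tensorHom_assoc, inclZero_tensorCounit,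
        inclOne_tensorCounit, Category.comp_id, Category.comp_id]
      have := M.coactRight_counit
      simp [MonoidalCategory.tensorHom_def', reassoc_of% this]
  comul_assoc := by
    have e : IsMonHom (M.tensorComul ≫ M.tensorComul ▷ M.tensorObj ≫ (α_ _ _ _).hom) :=
      inferInstance
    refine tensorAlg_hom_ext _ _ ?_ ?_
    · rw [reassoc_of% inclZero_tensorComul, reassoc_of% inclZero_tensorComul, tensorHom_whiskerLeft,
        reassoc_of% tensorHom_whiskerRight, inclZero_tensorComul, ← whiskerLeft_tensorHom,
        ← whiskerRight_tensorHom, Category.assoc, associator_naturality, ComonObj.comul_assoc_assoc]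
    · simp only [reassoc_of% inclOne_tensorComul, Preadditive.add_comp, Category.assoc,
        tensorHom_whiskerLeft, reassoc_of% tensorHom_whiskerRight, inclZero_tensorComul,
        inclOne_tensorComul, MonoidalPreadditive.tensor_add, MonoidalPreadditive.add_tensor,
        Preadditive.comp_add, ← whiskerLeft_tensorHom, ← whiskerRight_tensorHom,
        associator_naturality]
      have h1 := M.coactLeft_comul
      have h2 := M.coactRight_comul
      have h3 := M.coact_coassoc
      rw [reassoc_of% h1, reassoc_of% h2, reassoc_of% h3]
      simp only [Iso.inv_hom_id_assoc]
      abel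
  mul_comul := IsMonHom.mul_hom (f := M.tensorComul)
  one_comul := IsMonHom.one_hom (f := M.tensorComul)
  mul_counit := IsMonHom.mul_hom (f := M.tensorCounit)
  one_counit := IsMonHom.one_hom (f := M.tensorCounit)

end HopfBimodule

/-- The relative tensor algebra as a bialgebra. -/
def HopfBimodule.tensorBialgebra {H : C} [BimonObj H] (M : HopfBimodule H) :
    TensorBialgebra M where
  bimon := M.tensorBimon
  one_eq := rfl
  mul_eq := rfl
  inclZero_comul := M.inclZero_tensorComul
  inclOne_comul := M.inclOne_tensorComul
  inclZero_counit := M.inclZero_tensorCounit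
  inclOne_counit := M.inclOne_tensorCounit

end TensorAlgebra

section CotensorCoalgebra

variable {C : Type u} [Category.{v} C] [Abelian C] [MonoidalCategory C] [BraidedCategory C]
  [MonoidalPreadditive C] [HasColimits C] [ExactTensor C]

namespace HopfBimodule

variable {H : C} [BimonObj H] (M : HopfBimodule H)

/-! ### Relative cotensor powers -/

/-- The `n`-th cotensor power of `M` over `H`. -/
def cpow (n : ℕ) : C := (tpow M.opBimod n).unop

/-- The comultiplication of the cotensor powers. -/
def cpowComul (a b : ℕ) : M.cpow (a + b) ⟶ M.cpow a ⊗ M.cpow b := (tpowMul M.opBimod a b).unop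

/-- The identification of cotensor powers with equal exponents. -/
abbrev cpowCast {a b : ℕ} (h : a = b) : M.cpow a ⟶ M.cpow b := eqToHom (congrArg M.cpow h)

/-- The identification of the cotensor power of exponent zero with `H`. -/
def cpowZero : M.cpow 0 ≅ H := (tpowZero M.opBimod).unop

/-- The canonical isomorphism from the first cotensor power to `M`. -/
def cpowOne : M.cpow 1 ≅ M.X where
  hom := (toTpowOne M.opBimod).unop
  inv := (ofTpowOne M.opBimod).unop
  hom_inv_id := congrArg Quiver.Hom.unop (ofTpowOne_toTpowOne M.opBimod)
  inv_hom_id := congrArg Quiver.Hom.unop (toTpowOne_ofTpowOne M.opBimod)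

lemma cpowCast_eq {a b : ℕ} (h : a = b) :
    (tpowCast M.opBimod h).unop = M.cpowCast h.symm := by
  subst h
  rfl

lemma cpowComul_coassoc (a b c : ℕ) :
    M.cpowCast (add_assoc a b c).symm ≫ M.cpowComul (a + b) c ≫ M.cpowComul a b ▷ M.cpow c =
      M.cpowComul a (b + c) ≫ M.cpow a ◁ M.cpowComul b c ≫ (α_ _ _ _).inv := by
  rw [← cpowCast_eq]
  have h := congrArg Quiver.Hom.unop (tpowMul_assoc M.opBimod a b c)
  rw [unop_comp, unop_comp, unop_comp, unop_comp, Category.assoc, Category.assoc] at h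
  exact h

lemma cpowComul_counit_left (b : ℕ) :
    M.cpowCast (zero_add b).symm ≫ M.cpowComul 0 b ≫ (M.cpowZero.hom ≫ ε[H]) ▷ M.cpow b =
      (λ_ _).inv := by
  rw [← cpowCast_eq]
  have h := congrArg Quiver.Hom.unop (one_tpowMul M.opBimod b)
  rw [unop_comp, unop_comp, Category.assoc] at h
  exact h

lemma cpowComul_counit_right (a : ℕ) :
    M.cpowComul a 0 ≫ M.cpow a ◁ (M.cpowZero.hom ≫ ε[H]) = (ρ_ _).inv := by
  have h := congrArg Quiver.Hom.unop (tpowMul_one M.opBimod a)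
  rw [unop_comp] at h
  exact h

lemma cpowComul_zero_zero :
    M.cpowComul 0 0 ≫ (M.cpowZero.hom ⊗ₘ M.cpowZero.hom) = M.cpowZero.hom ≫ Δ[H] :=
  congrArg Quiver.Hom.unop (tpowZero_mul_zero M.opBimod)

lemma cpowComul_zero_one :
    M.cpowComul 0 1 ≫ (M.cpowZero.hom ⊗ₘ M.cpowOne.hom) = M.cpowOne.hom ≫ M.coactLeft :=
  congrArg Quiver.Hom.unop (tpowMul_toTpowOne_zero M.opBimod)

lemma cpowComul_one_zero :
    M.cpowComul 1 0 ≫ (M.cpowOne.hom ⊗ₘ M.cpowZero.hom) = M.cpowOne.hom ≫ M.coactRight :=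
  congrArg Quiver.Hom.unop (toTpowOne_mul_zero M.opBimod)

instance (a : ℕ) : Mono (M.cpowComul a 1) :=
  inferInstanceAs (Mono (tpowMul M.opBimod a 1).unop)

/-! ### Comultiplicative families on the cotensor powers -/

/-- A pair of morphisms from a comonoid object `E` to `H` and to `M` that respects all the
structure: a coalgebra morphism `g₀` and a morphism `g₁` of bicomodules along `g₀`. -/
structure IsBicomodPair {E : C} [ComonObj E] (g₀ : E ⟶ H) (g₁ : E ⟶ M.X) : Prop where
  counit : g₀ ≫ ε[H] = ε[E]
  comul : g₀ ≫ Δ[H] = Δ[E] ≫ (g₀ ⊗ₘ g₀)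
  left : g₁ ≫ M.coactLeft = Δ[E] ≫ (g₀ ⊗ₘ g₁)
  right : g₁ ≫ M.coactRight = Δ[E] ≫ (g₁ ⊗ₘ g₀)

namespace IsBicomodPair

variable {M} {E : C} [ComonObj E] {g₀ : E ⟶ H} {g₁ : E ⟶ M.X}

lemma op (h : M.IsBicomodPair g₀ g₁) :
    letI := Comon.ComonToMonOpOpObjMon ⟨E⟩
    IsBimodPair M.opBimod (R := Opposite.op E) g₀.op g₁.op :=
  letI := Comon.ComonToMonOpOpObjMon ⟨E⟩
  { one := congrArg Quiver.Hom.op h.counit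
    mul := congrArg Quiver.Hom.op h.comul
    left := congrArg Quiver.Hom.op h.left
    right := congrArg Quiver.Hom.op h.right }

/-- The components `E ⟶ M^{□ n}` of a morphism to the cotensor coalgebra. -/
def lift (h : M.IsBicomodPair g₀ g₁) (n : ℕ) : E ⟶ M.cpow n :=
  letI := Comon.ComonToMonOpOpObjMon ⟨E⟩
  (h.op.lift n).unop

lemma lift_zero (h : M.IsBicomodPair g₀ g₁) : h.lift 0 ≫ M.cpowZero.hom = g₀ :=
  letI := Comon.ComonToMonOpOpObjMon ⟨E⟩
  congrArg Quiver.Hom.unop h.op.tpowZero_lift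

lemma lift_one (h : M.IsBicomodPair g₀ g₁) : h.lift 1 ≫ M.cpowOne.hom = g₁ :=
  letI := Comon.ComonToMonOpOpObjMon ⟨E⟩
  congrArg Quiver.Hom.unop h.op.toTpowOne_lift

lemma lift_comul (h : M.IsBicomodPair g₀ g₁) (a b : ℕ) :
    h.lift (a + b) ≫ M.cpowComul a b = Δ[E] ≫ (h.lift a ⊗ₘ h.lift b) :=
  letI := Comon.ComonToMonOpOpObjMon ⟨E⟩
  congrArg Quiver.Hom.unop (h.op.tpowMul_lift a b)

end IsBicomodPair

/-- A comultiplicative family to the cotensor powers is determined by its values in `H` and `M`. -/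
lemma cpow_family_ext {E : C} [ComonObj E] {f g : ∀ n, E ⟶ M.cpow n}
    (hf : ∀ n, f (n + 1) ≫ M.cpowComul n 1 = Δ[E] ≫ (f n ⊗ₘ f 1))
    (hg : ∀ n, g (n + 1) ≫ M.cpowComul n 1 = Δ[E] ≫ (g n ⊗ₘ g 1))
    (h₀ : f 0 ≫ M.cpowZero.hom = g 0 ≫ M.cpowZero.hom)
    (h₁ : f 1 ≫ M.cpowOne.hom = g 1 ≫ M.cpowOne.hom) (n : ℕ) : f n = g n := by
  have h1 : f 1 = g 1 := (cancel_mono _).1 h₁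
  induction n with
  | zero => exact (cancel_mono _).1 h₀
  | succ n ih => rw [← cancel_mono (M.cpowComul n 1), hf, hg, ih, h1]

/-! ### The relative cotensor coalgebra -/

/-- The projection of `T^c_H(M)` onto the `n`-th cotensor power. -/
def cOut (n : ℕ) : M.cotensorObj ⟶ M.cpow n := M.cotensorGrading.proj n

/-- The inclusion of the `n`-th cotensor power into `T^c_H(M)`. -/
def cIn (n : ℕ) : M.cpow n ⟶ M.cotensorObj := M.cotensorGrading.inj n

lemma cIn_cOut_self (n : ℕ) : M.cIn n ≫ M.cOut n = 𝟙 _ := M.cotensorGrading.inj_proj_self n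

lemma cIn_cOut_ne {m n : ℕ} (h : m ≠ n) : M.cIn m ≫ M.cOut n = 0 :=
  M.cotensorGrading.inj_proj_ne h

lemma cOut_cpowCast {a b : ℕ} (h : a = b) : M.cOut a ≫ M.cpowCast h = M.cOut b := by
  subst h
  simp

lemma coprojZero_eq : M.coprojZero = M.cOut 0 ≫ M.cpowZero.hom :=
  (Category.comp_id (M.cotensorGrading.proj 0)).symm

lemma coprojOne_eq : M.coprojOne = M.cOut 1 ≫ M.cpowOne.hom := rfl

lemma coinclZero_eq : M.coinclZero = M.cpowZero.inv ≫ M.cIn 0 :=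
  (Category.id_comp (M.cotensorGrading.inj 0)).symm

lemma coinclOne_eq : M.coinclOne = M.cpowOne.inv ≫ M.cIn 1 := rfl

variable {M} in
lemma cotensorObj_hom_ext {Z : C} {f g : M.cotensorObj ⟶ Z}
    (h : ∀ n, M.cIn n ≫ f = M.cIn n ≫ g) : f = g :=
  M.cotensorGrading.hom_ext h

lemma cIn_comul (n : ℕ) : M.cIn n ≫ M.cotensorComul =
    ∑ p : Finset.HasAntidiagonal.antidiagonal n,
      M.cpowCast (Finset.HasAntidiagonal.mem_antidiagonal.1 p.2).symm ≫
      M.cpowComul p.1.1 p.1.2 ≫ (M.cIn p.1.1 ⊗ₘ M.cIn p.1.2) :=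
  Sigma.ι_desc _ _

lemma comul_cOut (a b : ℕ) : M.cotensorComul ≫ (M.cOut a ⊗ₘ M.cOut b) =
    M.cOut (a + b) ≫ M.cpowComul a b := by
  refine cotensorObj_hom_ext fun n => ?_
  rw [reassoc_of% M.cIn_comul, Preadditive.sum_comp]
  simp only [Category.assoc, tensorHom_comp_tensorHom]
  by_cases h : n = a + b
  · subst h
    rw [Finset.sum_eq_single ⟨(a, b), Finset.HasAntidiagonal.mem_antidiagonal.2 rfl⟩,
      reassoc_of% M.cIn_cOut_self]
    · simp [cIn_cOut_self]
    · intro p _ hp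
      have hp1 := Finset.HasAntidiagonal.mem_antidiagonal.1 p.2
      have : p.1.1 ≠ a := fun h1 => hp (Subtype.ext (Prod.ext h1 (by dsimp; omega)))
      simp [M.cIn_cOut_ne this]
    · intro h
      exact absurd (Finset.mem_univ _) h
  · rw [← Category.assoc, M.cIn_cOut_ne h, zero_comp]
    refine Finset.sum_eq_zero fun p _ => ?_
    have hp1 := Finset.HasAntidiagonal.mem_antidiagonal.1 p.2
    by_cases h1 : p.1.1 = a
    · simp [M.cIn_cOut_ne (m := p.1.2) (n := b) (by omega)]
    · simp [M.cIn_cOut_ne h1]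

variable [AB5 C]

/-- The relative cotensor coalgebra `T^c_H(M)`. -/
abbrev cotensorComon : ComonObj M.cotensorObj where
  counit := M.coprojZero ≫ ε[H]
  comul := M.cotensorComul
  counit_comul := M.cotensorGrading.proj_whiskerLeft_ext fun n => by
    change (M.cotensorComul ≫ (M.coprojZero ≫ ε[H]) ▷ M.cotensorObj) ≫ 𝟙_ C ◁ M.cOut n =
      (λ_ M.cotensorObj).inv ≫ 𝟙_ C ◁ M.cOut n
    rw [Category.assoc, coprojZero_eq, Category.assoc, comp_whiskerRight_assoc,
      ← whisker_exchange, ← tensorHom_def_assoc, reassoc_of% comul_cOut,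
      ← leftUnitor_inv_naturality, ← cpowComul_counit_left, reassoc_of% M.cOut_cpowCast]
  comul_counit := M.cotensorGrading.proj_whiskerRight_ext fun n => by
    change (M.cotensorComul ≫ M.cotensorObj ◁ (M.coprojZero ≫ ε[H])) ≫ M.cOut n ▷ 𝟙_ C =
      (ρ_ M.cotensorObj).inv ≫ M.cOut n ▷ 𝟙_ C
    rw [Category.assoc, coprojZero_eq, Category.assoc, MonoidalCategory.whiskerLeft_comp_assoc,
      whisker_exchange, ← tensorHom_def'_assoc, reassoc_of% comul_cOut,
      ← rightUnitor_inv_naturality]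
    exact congrArg (M.cOut n ≫ ·) (M.cpowComul_counit_right n)
  comul_assoc := by
    rw [← Category.assoc, ← Iso.comp_inv_eq, Category.assoc]
    refine M.cotensorGrading.proj_tensor3_ext M.cotensorGrading M.cotensorGrading fun a b c => ?_
    change (M.cotensorComul ≫ M.cotensorObj ◁ M.cotensorComul ≫ (α_ _ _ _).inv) ≫
        ((M.cOut a ⊗ₘ M.cOut b) ⊗ₘ M.cOut c) =
      (M.cotensorComul ≫ M.cotensorComul ▷ M.cotensorObj) ≫ ((M.cOut a ⊗ₘ M.cOut b) ⊗ₘ M.cOut c)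
    have e1 : M.cotensorComul ▷ M.cotensorObj ≫ ((M.cOut a ⊗ₘ M.cOut b) ⊗ₘ M.cOut c) =
        (M.cOut (a + b) ⊗ₘ M.cOut c) ≫ M.cpowComul a b ▷ M.cpow c := by
      rw [← tensorHom_id, ← tensorHom_id, tensorHom_comp_tensorHom, tensorHom_comp_tensorHom,
        comul_cOut, Category.comp_id, Category.id_comp]
    have e2 : M.cotensorObj ◁ M.cotensorComul ≫ (M.cOut a ⊗ₘ (M.cOut b ⊗ₘ M.cOut c)) =
        (M.cOut a ⊗ₘ M.cOut (b + c)) ≫ M.cpow a ◁ M.cpowComul b c := by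
      rw [← id_tensorHom, ← id_tensorHom, tensorHom_comp_tensorHom, tensorHom_comp_tensorHom,
        comul_cOut, Category.comp_id, Category.id_comp]
    rw [Category.assoc, Category.assoc, Category.assoc, ← associator_inv_naturality,
      reassoc_of% e2, e1, reassoc_of% comul_cOut, reassoc_of% comul_cOut, ← cpowComul_coassoc,
      reassoc_of% M.cOut_cpowCast]

attribute [local instance] cotensorComon ComonObj.instTensorUnit

end HopfBimodule

end CotensorCoalgebra

section ComonHom

/-! ### Coherence morphisms as coalgebra morphisms -/

variable {C : Type u} [Category.{v} C] [MonoidalCategory C] [BraidedCategory C]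
  {X Y Z : C} [ComonObj X] [ComonObj Y] [ComonObj Z]

attribute [local instance] ComonObj.instTensorUnit

lemma isComonHom_whiskerRight (f : X ⟶ Y) [IsComonHom f] : IsComonHom (f ▷ Z) :=
  inferInstanceAs (IsComonHom ((Comon.Hom.mk f : Comon.mk X ⟶ Comon.mk Y) ▷ Comon.mk Z).hom)

lemma isComonHom_whiskerLeft (f : X ⟶ Y) [IsComonHom f] : IsComonHom (Z ◁ f) :=
  inferInstanceAs (IsComonHom (Comon.mk Z ◁ (Comon.Hom.mk f : Comon.mk X ⟶ Comon.mk Y)).hom)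

lemma isComonHom_tensorHom {W : C} [ComonObj W] (f : X ⟶ Y) (g : Z ⟶ W) [IsComonHom f]
    [IsComonHom g] : IsComonHom (f ⊗ₘ g) := by
  have := isComonHom_whiskerRight (Z := Z) f
  have := isComonHom_whiskerLeft (Z := Y) g
  rw [MonoidalCategory.tensorHom_def]
  infer_instance

lemma isComonHom_associator_hom : IsComonHom (α_ X Y Z).hom := by
  have h := (α_ (Comon.mk X) (Comon.mk Y) (Comon.mk Z)).hom.isComonHom_hom
  have e : (α_ (Comon.mk X) (Comon.mk Y) (Comon.mk Z)).hom.hom = (α_ X Y Z).hom := by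
    rw [Comon.monoidal_associator_hom_hom]
    change 𝟙 (X ⊗ Y) ▷ Z ≫ (α_ X Y Z).hom ≫ X ◁ 𝟙 (Y ⊗ Z) = _
    simp
  rw [e] at h
  exact h

lemma isComonHom_leftUnitor_hom : IsComonHom (λ_ X).hom where
  hom_counit := by simp [MonoidalCategory.tensorHom_def]
  hom_comul := by simp [tensorμ, MonoidalCategory.tensorHom_def]

lemma isComonHom_rightUnitor_hom : IsComonHom (ρ_ X).hom where
  hom_counit := by simp [MonoidalCategory.tensorHom_def, unitors_equal]
  hom_comul := by
    simp [tensorμ, MonoidalCategory.tensorHom_def]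
    monoidal

end ComonHom

section GradedFamily

variable {C : Type u} [Category.{v} C] [Abelian C] [MonoidalCategory C] [BraidedCategory C]
  [MonoidalPreadditive C]

/-! ### Homogeneous families in coalgebras -/

/-- A family of morphisms `k i` to a coalgebra `E`, thought of as consisting of homogeneous elements
of degree `deg i`, on which the comultiplication is a finite sum of tensors of members of the family
whose degrees add up to the degree of the original. -/
def IsHomogeneousFamily {E : C} [ComonObj E] {I : Type} {K : I → C} (k : ∀ i, K i ⟶ E)
    (deg : I → ℕ) : Prop :=
  ∀ i, ∃ (J : Type) (s : Finset J) (l r : J → I) (d : ∀ j, K i ⟶ K (l j) ⊗ K (r j)),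
    (∀ j ∈ s, deg (l j) + deg (r j) = deg i) ∧ k i ≫ Δ[E] = ∑ j ∈ s, d j ≫ (k (l j) ⊗ₘ k (r j))

lemma Grading.IsGradedComul.isHomogeneousFamily {X : C} [ComonObj X] {G : Grading X}
    (h : G.IsGradedComul) : IsHomogeneousFamily G.inj id := fun n =>
  ⟨ℕ × ℕ, Finset.HasAntidiagonal.antidiagonal n, Prod.fst, Prod.snd,
    fun p => G.comulComp n p.1 p.2, fun _ hp => Finset.HasAntidiagonal.mem_antidiagonal.1 hp,
    h.inj_comul n⟩

lemma isHomogeneousFamily_unit :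
    letI := ComonObj.instTensorUnit C
    IsHomogeneousFamily (fun _ : Unit => 𝟙 (𝟙_ C)) (fun _ => 0) := fun _ =>
  ⟨Unit, {()}, id, id, fun _ => (λ_ (𝟙_ C)).inv, fun _ _ => rfl, by simp⟩

lemma IsHomogeneousFamily.tensor {E E' : C} [ComonObj E] [ComonObj E'] {I I' : Type}
    {K : I → C} {K' : I' → C} {k : ∀ i, K i ⟶ E} {k' : ∀ i, K' i ⟶ E'} {deg : I → ℕ}
    {deg' : I' → ℕ} (h : IsHomogeneousFamily k deg) (h' : IsHomogeneousFamily k' deg') :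
    IsHomogeneousFamily (fun p : I × I' => k p.1 ⊗ₘ k' p.2) (fun p => deg p.1 + deg' p.2) := by
  rintro ⟨i, i'⟩
  obtain ⟨J, s, l, r, d, hs, hd⟩ := h i
  obtain ⟨J', s', l', r', d', hs', hd'⟩ := h' i'
  refine ⟨J × J', s ×ˢ s', fun j => (l j.1, l' j.2), fun j => (r j.1, r' j.2),
    fun j => (d j.1 ⊗ₘ d' j.2) ≫ tensorμ _ _ _ _, fun j hj => ?_, ?_⟩
  · have := hs j.1 (Finset.mem_product.1 hj).1
    have := hs' j.2 (Finset.mem_product.1 hj).2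
    dsimp only
    omega
  · rw [Comon.tensorObj_comul, tensorHom_comp_tensorHom_assoc, hd, hd', sum_tensor,
      Preadditive.sum_comp, Finset.sum_product]
    refine Finset.sum_congr rfl fun j _ => ?_
    rw [tensor_sum, Preadditive.sum_comp]
    refine Finset.sum_congr rfl fun j' _ => ?_
    rw [← tensorHom_comp_tensorHom, Category.assoc, Category.assoc, tensorμ_natural]

variable [HasColimits C] [ExactTensor C] {H : C} [BimonObj H] {M : HopfBimodule H}
  {E : C} [ComonObj E] {g₀ : E ⟶ H} {g₁ : E ⟶ M.X}

/-- If `g₀` and `g₁` respect the degrees on a homogeneous family, then so do all components of the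
induced morphism to the cotensor powers. -/
lemma IsHomogeneousFamily.lift_eq_zero {I : Type} {K : I → C} {k : ∀ i, K i ⟶ E} {deg : I → ℕ}
    (hk : IsHomogeneousFamily k deg) (h : M.IsBicomodPair g₀ g₁)
    (h₀ : ∀ i, deg i ≠ 0 → k i ≫ g₀ = 0) (h₁ : ∀ i, deg i ≠ 1 → k i ≫ g₁ = 0) (n : ℕ) :
    ∀ i, deg i ≠ n → k i ≫ h.lift n = 0 := by
  have e1 : ∀ i, deg i ≠ 1 → k i ≫ h.lift 1 = 0 := fun i hi => by
    rw [← cancel_mono M.cpowOne.hom, Category.assoc, h.lift_one, h₁ i hi, zero_comp]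
  induction n with
  | zero =>
    intro i hi
    rw [← cancel_mono M.cpowZero.hom, Category.assoc, h.lift_zero, h₀ i hi, zero_comp]
  | succ n ih =>
    intro i hi
    obtain ⟨J, s, l, r, d, hs, hd⟩ := hk i
    rw [← cancel_mono (M.cpowComul n 1), Category.assoc, h.lift_comul, reassoc_of% hd, zero_comp,
      Preadditive.sum_comp]
    refine Finset.sum_eq_zero fun j hj => ?_
    have := hs j hj
    rw [Category.assoc, tensorHom_comp_tensorHom]
    by_cases hl : deg (l j) = n
    · rw [e1 (r j) (by omega)]
      simp
    · rw [ih (l j) hl]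
      simp

end GradedFamily

section CotensorBialgebra

variable {C : Type u} [Category.{v} C] [Abelian C] [MonoidalCategory C] [BraidedCategory C]
  [MonoidalPreadditive C] [HasColimits C] [ExactTensor C] [AB5 C]

namespace HopfBimodule

variable {H : C} [BimonObj H] {M : HopfBimodule H}

attribute [local instance] cotensorComon ComonObj.instTensorUnit

/-! ### Morphisms to the relative cotensor coalgebra -/

lemma cotensorObj_proj_ext {Z : C} {f g : Z ⟶ M.cotensorObj}
    (h : ∀ n, f ≫ M.cOut n = g ≫ M.cOut n) : f = g :=
  M.cotensorGrading.proj_hom_ext h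

section

variable {E : C} [ComonObj E] {g₀ : E ⟶ H} {g₁ : E ⟶ M.X}

lemma IsBicomodPair.isComonHom (h : M.IsBicomodPair g₀ g₁) (g : E ⟶ M.cotensorObj)
    (hg : ∀ n, g ≫ M.cOut n = h.lift n) : IsComonHom g where
  hom_counit := by
    change g ≫ M.coprojZero ≫ ε[H] = _
    rw [coprojZero_eq, Category.assoc, reassoc_of% hg, reassoc_of% h.lift_zero, h.counit]
  hom_comul := by
    change g ≫ M.cotensorComul = _
    refine M.cotensorGrading.proj_tensor_ext M.cotensorGrading fun a b => ?_
    change (g ≫ M.cotensorComul) ≫ (M.cOut a ⊗ₘ M.cOut b) =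
      (Δ[E] ≫ (g ⊗ₘ g)) ≫ (M.cOut a ⊗ₘ M.cOut b)
    rw [Category.assoc, Category.assoc, comul_cOut, reassoc_of% hg, h.lift_comul,
      tensorHom_comp_tensorHom, hg, hg]

lemma IsBicomodPair.comp_coprojZero (h : M.IsBicomodPair g₀ g₁) (g : E ⟶ M.cotensorObj)
    (hg : ∀ n, g ≫ M.cOut n = h.lift n) : g ≫ M.coprojZero = g₀ := by
  rw [coprojZero_eq, reassoc_of% hg, h.lift_zero]

lemma IsBicomodPair.comp_coprojOne (h : M.IsBicomodPair g₀ g₁) (g : E ⟶ M.cotensorObj)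
    (hg : ∀ n, g ≫ M.cOut n = h.lift n) : g ≫ M.coprojOne = g₁ := by
  rw [coprojOne_eq, reassoc_of% hg, h.lift_one]

/-- Coalgebra morphisms to `T^c_H(M)` are determined by their projections to `H` and `M`. -/
lemma cotensorCoalg_hom_ext (f g : E ⟶ M.cotensorObj) [IsComonHom f] [IsComonHom g]
    (h₀ : f ≫ M.coprojZero = g ≫ M.coprojZero) (h₁ : f ≫ M.coprojOne = g ≫ M.coprojOne) :
    f = g := by
  have key : ∀ k : E ⟶ M.cotensorObj, IsComonHom k → ∀ n,
      (k ≫ M.cOut (n + 1)) ≫ M.cpowComul n 1 = Δ[E] ≫ (k ≫ M.cOut n ⊗ₘ k ≫ M.cOut 1) :=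
    fun k hk n => by
      have h : k ≫ M.cotensorComul = Δ[E] ≫ (k ⊗ₘ k) := hk.hom_comul
      rw [Category.assoc, ← comul_cOut, reassoc_of% h, tensorHom_comp_tensorHom]
  refine cotensorObj_proj_ext fun n => M.cpow_family_ext (f := fun n => f ≫ M.cOut n)
    (g := fun n => g ≫ M.cOut n) (key f inferInstance) (key g inferInstance) ?_ ?_ n
  · simpa only [coprojZero_eq, Category.assoc] using h₀
  · simpa only [coprojOne_eq, Category.assoc] using h₁

end

variable (M) in
/-- The projections of the cotensor coalgebra to `H` and `M` respect all the structure. -/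
lemma isBicomodPair_proj : M.IsBicomodPair M.coprojZero M.coprojOne where
  counit := rfl
  comul := by
    change _ = M.cotensorComul ≫ _
    rw [coprojZero_eq, ← tensorHom_comp_tensorHom, reassoc_of% comul_cOut, Category.assoc]
    exact congrArg (M.cOut 0 ≫ ·) M.cpowComul_zero_zero.symm
  left := by
    change _ = M.cotensorComul ≫ _
    rw [coprojZero_eq, coprojOne_eq, ← tensorHom_comp_tensorHom, reassoc_of% comul_cOut,
      Category.assoc]
    exact congrArg (M.cOut 1 ≫ ·) M.cpowComul_zero_one.symm
  right := by
    change _ = M.cotensorComul ≫ _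
    rw [coprojZero_eq, coprojOne_eq, ← tensorHom_comp_tensorHom, reassoc_of% comul_cOut,
      Category.assoc]
    exact congrArg (M.cOut 1 ≫ ·) M.cpowComul_one_zero.symm

variable (M) in
lemma cotensor_isGradedComul : M.cotensorGrading.IsGradedComul := fun n => by
  refine ⟨∑ p : Finset.HasAntidiagonal.antidiagonal n,
    M.cpowCast (Finset.HasAntidiagonal.mem_antidiagonal.1 p.2).symm ≫
      M.cpowComul p.1.1 p.1.2 ≫
      M.cotensorGrading.tensorSummand (Finset.HasAntidiagonal.mem_antidiagonal.1 p.2), ?_⟩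
  refine (M.cIn_comul n).trans ?_
  rw [Preadditive.sum_comp]
  refine Finset.sum_congr rfl fun p _ => ?_
  have e : M.cotensorGrading.tensorSummand (Finset.HasAntidiagonal.mem_antidiagonal.1 p.2) ≫
      M.cotensorGrading.tensorInj n = (M.cIn p.1.1 ⊗ₘ M.cIn p.1.2) :=
    M.cotensorGrading.tensorSummand_inj _
  exact ((Category.assoc _ _ _).trans
    (congrArg _ ((Category.assoc _ _ _).trans (congrArg _ e)))).symm

variable (M) in
lemma cotensor_isHomogeneousFamily : IsHomogeneousFamily M.cIn id :=
  M.cotensor_isGradedComul.isHomogeneousFamily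

/-- The components in `H` and in `M` of a product of elements of the cotensor coalgebra. -/
lemma IsBicomodPair.mul {E E' : C} [ComonObj E] [ComonObj E'] {g₀ : E ⟶ H} {g₁ : E ⟶ M.X}
    {g₀' : E' ⟶ H} {g₁' : E' ⟶ M.X} (h : M.IsBicomodPair g₀ g₁) (h' : M.IsBicomodPair g₀' g₁') :
    M.IsBicomodPair ((g₀ ⊗ₘ g₀') ≫ μ[H])
      ((g₀ ⊗ₘ g₁') ≫ M.actLeft + (g₁ ⊗ₘ g₀') ≫ M.actRight) where
  counit := by
    rw [Category.assoc, BimonObj.mul_counit, Comon.tensorObj_counit, Comon.tensorObj_counit,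
      tensorHom_comp_tensorHom_assoc, h.counit, h'.counit]
  comul := by
    rw [Category.assoc, BimonObj.mul_comul, tensorHom_comp_tensorHom_assoc, h.comul, h'.comul,
      ← tensorHom_comp_tensorHom, Category.assoc, tensorμ_natural_assoc, tensorHom_comp_tensorHom,
      Comon.tensorObj_comul, Category.assoc]
  left := by
    rw [MonoidalPreadditive.tensor_add, Preadditive.add_comp, Preadditive.comp_add,
      Category.assoc, Category.assoc, M.actLeft_coactLeft, M.actRight_coactLeft,
      tensorHom_comp_tensorHom_assoc, tensorHom_comp_tensorHom_assoc, h.comul, h'.comul, h.left,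
      h'.left, ← tensorHom_comp_tensorHom, ← tensorHom_comp_tensorHom, Category.assoc,
      Category.assoc, tensorμ_natural_assoc, tensorμ_natural_assoc, tensorHom_comp_tensorHom,
      tensorHom_comp_tensorHom, Comon.tensorObj_comul, Category.assoc, Category.assoc]
  right := by
    rw [MonoidalPreadditive.add_tensor, Preadditive.add_comp, Preadditive.comp_add,
      Category.assoc, Category.assoc, M.actLeft_coactRight, M.actRight_coactRight,
      tensorHom_comp_tensorHom_assoc, tensorHom_comp_tensorHom_assoc, h.comul, h'.comul, h.right,
      h'.right, ← tensorHom_comp_tensorHom, ← tensorHom_comp_tensorHom, Category.assoc,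
      Category.assoc, tensorμ_natural_assoc, tensorμ_natural_assoc, tensorHom_comp_tensorHom,
      tensorHom_comp_tensorHom, Comon.tensorObj_comul, Category.assoc, Category.assoc]

variable (M) in
/-- The components in `H` and in `M` of the unit of the cotensor coalgebra. -/
lemma isBicomodPair_one : M.IsBicomodPair η[H] (0 : 𝟙_ C ⟶ M.X) where
  counit := BimonObj.one_counit H
  comul := by
    rw [BimonObj.one_comul, MonObj.tensorObj.one_def]
    rfl
  left := by simp [MonoidalCategory.tensorHom_def]
  right := by simp [MonoidalCategory.tensorHom_def]

/-! ### The multiplication of the relative cotensor coalgebra -/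

variable (M) in
lemma isBicomodPair_mul : M.IsBicomodPair ((M.coprojZero ⊗ₘ M.coprojZero) ≫ μ[H])
    ((M.coprojZero ⊗ₘ M.coprojOne) ≫ M.actLeft + (M.coprojOne ⊗ₘ M.coprojZero) ≫ M.actRight) :=
  M.isBicomodPair_proj.mul M.isBicomodPair_proj

variable (M) in
/-- The multiplication of the cotensor coalgebra. On `M^{□ a} ⊗ M^{□ b}`, only the component of
degree `a + b` is nonzero. -/
def cotensorMul : M.cotensorObj ⊗ M.cotensorObj ⟶ M.cotensorObj :=
  M.cotensorGrading.tensorDesc M.cotensorGrading fun a b =>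
    (M.cIn a ⊗ₘ M.cIn b) ≫ M.isBicomodPair_mul.lift (a + b) ≫ M.cIn (a + b)

variable (M) in
/-- The unit of the cotensor coalgebra. -/
def cotensorOne : 𝟙_ C ⟶ M.cotensorObj := M.isBicomodPair_one.lift 0 ≫ M.cIn 0

lemma cotensorObj_tensor_ext {Z : C} {f g : M.cotensorObj ⊗ M.cotensorObj ⟶ Z}
    (h : ∀ a b, (M.cIn a ⊗ₘ M.cIn b) ≫ f = (M.cIn a ⊗ₘ M.cIn b) ≫ g) : f = g :=
  M.cotensorGrading.tensor_ext M.cotensorGrading h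

lemma cIn_coprojZero {n : ℕ} (h : n ≠ 0) : M.cIn n ≫ M.coprojZero = 0 := by
  rw [coprojZero_eq, ← Category.assoc, M.cIn_cOut_ne h, zero_comp]

lemma cIn_coprojOne {n : ℕ} (h : n ≠ 1) : M.cIn n ≫ M.coprojOne = 0 := by
  rw [coprojOne_eq, ← Category.assoc, M.cIn_cOut_ne h, zero_comp]

lemma cotensorMul_cOut (n : ℕ) : M.cotensorMul ≫ M.cOut n = M.isBicomodPair_mul.lift n := by
  refine cotensorObj_tensor_ext fun a b => ?_
  have e : (M.cIn a ⊗ₘ M.cIn b) ≫ M.cotensorMul =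
    (M.cIn a ⊗ₘ M.cIn b) ≫ M.isBicomodPair_mul.lift (a + b) ≫ M.cIn (a + b) :=
    M.cotensorGrading.inj_tensorDesc M.cotensorGrading _ a b
  rw [reassoc_of% e]
  by_cases h : a + b = n
  · subst h
    rw [cIn_cOut_self, Category.comp_id]
  · rw [M.cIn_cOut_ne h, comp_zero, comp_zero]
    refine ((M.cotensor_isHomogeneousFamily.tensor M.cotensor_isHomogeneousFamily).lift_eq_zero
      M.isBicomodPair_mul ?_ ?_ n (a, b) h).symm
    · rintro ⟨i, j⟩ hij
      dsimp only [id] at hij ⊢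
      rw [tensorHom_comp_tensorHom_assoc]
      by_cases hi : i = 0
      · rw [cIn_coprojZero (n := j) (by omega)]
        simp
      · rw [cIn_coprojZero hi]
        simp
    · rintro ⟨i, j⟩ hij
      dsimp only [id] at hij ⊢
      rw [Preadditive.comp_add, tensorHom_comp_tensorHom_assoc, tensorHom_comp_tensorHom_assoc]
      by_cases hi : i = 0
      · rw [cIn_coprojOne (n := j) (by omega), cIn_coprojOne (n := i) (by omega)]
        simp
      · by_cases hj : j = 0
        · rw [cIn_coprojZero hi, cIn_coprojOne (n := i) (by omega)]
          simp
        · rw [cIn_coprojZero hi, cIn_coprojZero hj]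
          simp

lemma cotensorOne_cOut (n : ℕ) : M.cotensorOne ≫ M.cOut n = M.isBicomodPair_one.lift n := by
  rw [cotensorOne, Category.assoc]
  by_cases h : n = 0
  · subst h
    rw [cIn_cOut_self, Category.comp_id]
  · rw [M.cIn_cOut_ne (Ne.symm h), comp_zero]
    have hu := (isHomogeneousFamily_unit (C := C)).lift_eq_zero M.isBicomodPair_one
      (fun _ h => absurd rfl h) (fun _ _ => comp_zero) n () (Ne.symm h)
    rw [Category.id_comp] at hu
    exact hu.symm

instance isComonHom_cotensorMul : IsComonHom M.cotensorMul :=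
  M.isBicomodPair_mul.isComonHom _ cotensorMul_cOut

instance isComonHom_cotensorOne : IsComonHom M.cotensorOne :=
  M.isBicomodPair_one.isComonHom _ cotensorOne_cOut

lemma cotensorMul_coprojZero :
    M.cotensorMul ≫ M.coprojZero = (M.coprojZero ⊗ₘ M.coprojZero) ≫ μ[H] :=
  M.isBicomodPair_mul.comp_coprojZero _ cotensorMul_cOut

lemma cotensorMul_coprojOne : M.cotensorMul ≫ M.coprojOne =
    (M.coprojZero ⊗ₘ M.coprojOne) ≫ M.actLeft + (M.coprojOne ⊗ₘ M.coprojZero) ≫ M.actRight :=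
  M.isBicomodPair_mul.comp_coprojOne _ cotensorMul_cOut

lemma cotensorOne_coprojZero : M.cotensorOne ≫ M.coprojZero = η[H] :=
  M.isBicomodPair_one.comp_coprojZero _ cotensorOne_cOut

lemma cotensorOne_coprojOne : M.cotensorOne ≫ M.coprojOne = 0 :=
  M.isBicomodPair_one.comp_coprojOne _ cotensorOne_cOut

variable (M) in
/-- The bialgebra structure of the cotensor coalgebra. Each axiom equates two coalgebra morphisms to
`T^c_H(M)`, so it is checked after projection to `H` and to `M`. -/
abbrev cotensorBimon : BimonObj M.cotensorObj where
  toComonObj := M.cotensorComon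
  one := M.cotensorOne
  mul := M.cotensorMul
  one_mul := by
    have := isComonHom_whiskerRight (Z := M.cotensorObj) M.cotensorOne
    have := isComonHom_leftUnitor_hom (X := M.cotensorObj)
    refine cotensorCoalg_hom_ext _ _ ?_ ?_
    · rw [Category.assoc, cotensorMul_coprojZero, reassoc_of% whiskerRight_tensorHom,
        cotensorOne_coprojZero, MonoidalCategory.tensorHom_def', Category.assoc, MonObj.one_mul,
        leftUnitor_naturality]
    · rw [Category.assoc, cotensorMul_coprojOne, Preadditive.comp_add,
        reassoc_of% whiskerRight_tensorHom,
        reassoc_of% whiskerRight_tensorHom, cotensorOne_coprojZero, cotensorOne_coprojOne,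
        MonoidalCategory.tensorHom_def', Category.assoc, M.one_actLeft, leftUnitor_naturality]
      simp [MonoidalCategory.tensorHom_def]
  mul_one := by
    have := isComonHom_whiskerLeft (Z := M.cotensorObj) M.cotensorOne
    have := isComonHom_rightUnitor_hom (X := M.cotensorObj)
    refine cotensorCoalg_hom_ext _ _ ?_ ?_
    · rw [Category.assoc, cotensorMul_coprojZero, reassoc_of% whiskerLeft_tensorHom,
        cotensorOne_coprojZero, MonoidalCategory.tensorHom_def, Category.assoc, MonObj.mul_one,
        rightUnitor_naturality]
    · rw [Category.assoc, cotensorMul_coprojOne, Preadditive.comp_add,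
        reassoc_of% whiskerLeft_tensorHom,
        reassoc_of% whiskerLeft_tensorHom, cotensorOne_coprojZero, cotensorOne_coprojOne,
        MonoidalCategory.tensorHom_def (g := η[H]), Category.assoc, M.actRight_one,
        rightUnitor_naturality]
      simp [MonoidalCategory.tensorHom_def]
  mul_assoc := by
    have := isComonHom_whiskerLeft (Z := M.cotensorObj) M.cotensorMul
    have := isComonHom_whiskerRight (Z := M.cotensorObj) M.cotensorMul
    have := isComonHom_associator_hom (X := M.cotensorObj) (Y := M.cotensorObj)
      (Z := M.cotensorObj)
    refine cotensorCoalg_hom_ext _ _ ?_ ?_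
    · rw [Category.assoc, Category.assoc, Category.assoc, cotensorMul_coprojZero,
        reassoc_of% whiskerRight_tensorHom, reassoc_of% whiskerLeft_tensorHom,
        cotensorMul_coprojZero, tensorHom_mul_assoc]
    · have h1 := M.mul_actLeft
      have h2 := M.actRight_mul
      have h3 := M.act_assoc
      simp only [Category.assoc, cotensorMul_coprojOne, cotensorMul_coprojZero,
        Preadditive.comp_add, reassoc_of% whiskerRight_tensorHom, reassoc_of% whiskerLeft_tensorHom,
        MonoidalPreadditive.tensor_add, MonoidalPreadditive.add_tensor, Preadditive.add_comp,
        ← reassoc_of% tensorHom_whiskerLeft, ← reassoc_of% tensorHom_whiskerRight, h1, h2, h3,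
        associator_naturality_assoc, associator_inv_naturality_assoc]
      rw [Iso.hom_inv_id_assoc, add_assoc]
  mul_comul := by
    have := IsComonHom.hom_comul M.cotensorMul
    rwa [Comon.tensorObj_comul, Category.assoc] at this
  one_comul := IsComonHom.hom_comul M.cotensorOne
  mul_counit := IsComonHom.hom_counit M.cotensorMul
  one_counit := IsComonHom.hom_counit M.cotensorOne

variable (M) in
/-- The relative cotensor coalgebra as a bialgebra. -/
def cotensorBialgebra : CotensorBialgebra M where
  bimon := M.cotensorBimon
  counit_eq := rfl
  comul_eq := rfl
  mul_coprojZero := cotensorMul_coprojZero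
  mul_coprojOne := cotensorMul_coprojOne
  one_coprojZero := cotensorOne_coprojZero
  one_coprojOne := cotensorOne_coprojOne

end HopfBimodule

end CotensorBialgebra

section Parts

variable {C : Type u} [Category.{v} C] [Abelian C] [HasColimits C] [AB5 C]

namespace Grading

/-! ### Subobjects spanned by components -/

variable {X : C} (G : Grading X) (p : ℕ → Prop)

open Classical in
/-- The retraction of `X` onto the direct sum of the components whose degree satisfies `p`. -/
def partπ : X ⟶ ∐ fun i : {i // p i} => G.comp i.1 :=
  Cofan.IsColimit.desc G.isColimit fun n =>
    if h : p n then Sigma.ι (fun i : {i // p i} => G.comp i.1) ⟨n, h⟩ else 0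

lemma inj_partπ_partι {n : ℕ} (h : p n) : G.inj n ≫ G.partπ p ≫ G.partι p = G.inj n := by
  have e : G.inj n ≫ G.partπ p = Sigma.ι (fun i : {i // p i} => G.comp i.1) ⟨n, h⟩ :=
    (Cofan.IsColimit.fac G.isColimit _ n).trans (dif_pos h)
  rw [reassoc_of% e, partι, Sigma.ι_desc]

lemma inj_partπ_eq_zero {n : ℕ} (h : ¬ p n) : G.inj n ≫ G.partπ p = 0 :=
  (Cofan.IsColimit.fac G.isColimit _ n).trans (dif_neg h)

lemma partι_proj {n : ℕ} (h : ¬ p n) : G.partι p ≫ G.proj n = 0 :=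
  Sigma.hom_ext _ _ fun i => by
    have hi : i.1 ≠ n := by
      rintro rfl
      exact h i.2
    rw [partι, Sigma.ι_desc_assoc, comp_zero, G.inj_proj_ne hi]

lemma mk_partι_arrow_proj {n : ℕ} (h : ¬ p n) :
    (Subobject.mk (G.partι p)).arrow ≫ G.proj n = 0 := by
  rw [← Subobject.underlyingIso_hom_comp_eq_mk, Category.assoc, G.partι_proj p h, comp_zero]

lemma mk_partι_arrow_comp_eq_zero {Z : C} {f : X ⟶ Z} (h : ∀ n, p n → G.inj n ≫ f = 0) :
    (Subobject.mk (G.partι p)).arrow ≫ f = 0 := by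
  have e : G.partι p ≫ f = 0 := Sigma.hom_ext _ _ fun i => by
    rw [partι, Sigma.ι_desc_assoc, comp_zero, h _ i.2]
  rw [← Subobject.underlyingIso_hom_comp_eq_mk, Category.assoc, e, comp_zero]

/-- A morphism whose components vanish outside the degrees satisfying `p` has its image in the
corresponding part of `X`. -/
lemma mk_partι_factors {Z : C} (f : Z ⟶ X) (h : ∀ n, ¬ p n → f ≫ G.proj n = 0) :
    (Subobject.mk (G.partι p)).Factors f := by
  have key : (f ≫ G.partπ p) ≫ G.partι p = f := G.proj_hom_ext fun n => ?_
  · exact (Subobject.mk_factors_iff _ _).2 ⟨_, key⟩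
  by_cases hn : p n
  · rw [Category.assoc, Category.assoc]
    congr 1
    refine G.hom_ext fun m => ?_
    by_cases hm : p m
    · rw [← Category.assoc, ← Category.assoc, Category.assoc (G.inj m), G.inj_partπ_partι p hm]
    · rw [reassoc_of% G.inj_partπ_eq_zero p hm, zero_comp, G.inj_proj_ne fun e => hm (by rwa [e])]
  · rw [Category.assoc, Category.assoc, G.partι_proj p hn, comp_zero, comp_zero, h n hn]

lemma mk_partι_factors_inj {n : ℕ} (h : p n) : (Subobject.mk (G.partι p)).Factors (G.inj n) :=
  G.mk_partι_factors p _ fun m hm => G.inj_proj_ne fun e => hm (by rwa [← e])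

end Grading

end Parts

section Conditions

variable {C : Type u} [Category.{v} C] [Abelian C] [MonoidalCategory C] [MonoidalPreadditive C]
  [BraidedCategory C] [HasColimits C] [ExactTensor C] [AB5 C] {X : C} {G : Grading X}

/-! ### Exactness of the tensor product -/

instance {X Y Z : C} (f : X ⟶ Y) [Epi f] : Epi (Z ◁ f) :=
  inferInstanceAs (Epi ((tensorLeft Z).map f))

instance {X Y Z : C} (f : X ⟶ Y) [Epi f] : Epi (f ▷ Z) :=
  inferInstanceAs (Epi ((tensorRight Z).map f))

instance {X Y Z : C} (f : X ⟶ Y) [Mono f] : Mono (Z ◁ f) :=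
  inferInstanceAs (Mono ((tensorLeft Z).map f))

instance {X Y Z : C} (f : X ⟶ Y) [Mono f] : Mono (f ▷ Z) :=
  inferInstanceAs (Mono ((tensorRight Z).map f))

instance {X Y Z W : C} (f : X ⟶ Y) (g : Z ⟶ W) [Epi f] [Epi g] : Epi (f ⊗ₘ g) := by
  rw [MonoidalCategory.tensorHom_def]; infer_instance

instance {X Y Z W : C} (f : X ⟶ Y) (g : Z ⟶ W) [Mono f] [Mono g] : Mono (f ⊗ₘ g) := by
  rw [MonoidalCategory.tensorHom_def]; infer_instance

namespace Grading

section Mul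

variable [MonObj X]

/-! ### Generation in degree one -/

lemma IsGradedMul.tensorHom_mul_proj_inj (h : G.IsGradedMul) {a b n : ℕ} (hn : a + b = n)
    {Y Z : C} {f : Y ⟶ X} {g : Z ⟶ X} (hf : f ≫ G.proj a ≫ G.inj a = f)
    (hg : g ≫ G.proj b ≫ G.inj b = g) :
    (f ⊗ₘ g) ≫ μ[X] ≫ G.proj n ≫ G.inj n = (f ⊗ₘ g) ≫ μ[X] := by
  have e : (f ⊗ₘ g) = (f ≫ G.proj a ⊗ₘ g ≫ G.proj b) ≫ (G.inj a ⊗ₘ G.inj b) := by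
    rw [tensorHom_comp_tensorHom, Category.assoc, Category.assoc, hf, hg]
  rw [e, Category.assoc, Category.assoc, ← reassoc_of% h.mulComp_inj hn, ← h.mulComp_inj hn,
    reassoc_of% G.inj_proj_self n]

lemma IsGradedMul.subobjectSq_tail_le (h : G.IsGradedMul) :
    subobjectSq (G.tail 1) ≤ G.tail 2 := by
  have h0 : (G.tail 1).arrow ≫ G.proj 0 = 0 := G.mk_partι_arrow_proj _ (by omega)
  have hf : (G.tail 2).Factors (((G.tail 1).arrow ⊗ₘ (G.tail 1).arrow) ≫ μ[X]) := by
    refine G.mk_partι_factors _ _ fun n hn => ?_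
    obtain rfl | rfl : n = 0 ∨ n = 1 := by omega
    · rw [Category.assoc, h.mul_proj_zero, tensorHom_comp_tensorHom_assoc, h0]
      simp
    · rw [Category.assoc, h.mul_proj_one, Preadditive.comp_add, tensorHom_comp_tensorHom_assoc,
        tensorHom_comp_tensorHom_assoc, h0]
      simp
  exact imageSubobject_le _ _ (Subobject.factorThru_arrow _ _ hf)

lemma IsGradedMul.tail_le_subobjectSq (h : G.IsGradedMul)
    (he : ∀ n, 1 ≤ n → Epi (G.mulComp n 1 (n + 1))) : G.tail 2 ≤ subobjectSq (G.tail 1) := by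
  set S := subobjectSq (G.tail 1)
  -- Products of elements of positive degree vanish modulo `S`, and for `n ≥ 2` they span the
  -- component of degree `n`.
  have hS : ∀ a b, 1 ≤ a → 1 ≤ b → (G.inj a ⊗ₘ G.inj b) ≫ μ[X] ≫ cokernel.π S.arrow = 0 := by
    intro a b ha hb
    have ea := Subobject.factorThru_arrow _ _ (G.mk_partι_factors_inj (1 ≤ ·) ha)
    have eb := Subobject.factorThru_arrow _ _ (G.mk_partι_factors_inj (1 ≤ ·) hb)
    rw [← ea, ← eb, ← tensorHom_comp_tensorHom_assoc]
    have := imageSubobject_arrow_comp (((G.tail 1).arrow ⊗ₘ (G.tail 1).arrow) ≫ μ[X])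
    have e : ((G.tail 1).arrow ⊗ₘ (G.tail 1).arrow) ≫ μ[X] ≫ cokernel.π S.arrow = 0 := by
      rw [← Category.assoc, ← this, Category.assoc]
      exact (congrArg _ (cokernel.condition _)).trans comp_zero
    exact (congrArg _ e).trans comp_zero
  have hz : (G.tail 2).arrow ≫ cokernel.π S.arrow = 0 := by
    refine G.mk_partι_arrow_comp_eq_zero _ fun n hn => ?_
    obtain ⟨m, rfl⟩ : ∃ m, n = m + 1 := ⟨n - 1, by omega⟩
    have := he m (by omega)
    rw [← cancel_epi (G.mulComp m 1 (m + 1)), reassoc_of% h.mulComp_inj (rfl : m + 1 = m + 1),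
      hS m 1 (by omega) le_rfl, comp_zero]
  exact Subobject.le_of_comm (Abelian.monoLift S.arrow _ hz) (Abelian.monoLift_comp _ _ _)

/-- If `X[2] = X[1]²`, then the components of degree at least two are spanned by products of
elements of smaller positive degree. -/
lemma eq_zero_of_mulComp (h : G.IsGradedMul) (ht : G.tail 2 = subobjectSq (G.tail 1)) {n : ℕ}
    (hn : 2 ≤ n) {Z : C} (g : G.comp n ⟶ Z)
    (hg : ∀ a b, 1 ≤ a → 1 ≤ b → a + b = n → G.mulComp a b n ≫ g = 0) : g = 0 := by
  -- `X[1]` is fixed by the endomorphism of `X` that kills the component of degree zero, so in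
  -- degree `n` a product of elements of `X[1]` involves only the multiplications of `hg`.
  have h00 : (G.tail 1).arrow ≫ G.proj 0 = 0 := G.mk_partι_arrow_proj _ (by omega)
  have h0 : (G.tail 1).arrow ≫ G.truncation 0 = (G.tail 1).arrow := by
    rw [truncation, Preadditive.comp_sub, Finset.sum_range_one, reassoc_of% h00]
    simp
  have h1 : (G.truncation 0 ⊗ₘ G.truncation 0) ≫ μ[X] ≫ G.proj n ≫ g = 0 := by
    refine G.tensor_ext G fun a b => ?_
    rw [tensorHom_comp_tensorHom_assoc, inj_truncation, inj_truncation, comp_zero]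
    split_ifs with ha hb hb
    · simp
    · simp
    · simp
    · by_cases hab : a + b = n
      · simpa only [mulComp, Category.assoc] using hg a b (by omega) (by omega) hab
      · rw [reassoc_of% h.inj_mul_proj hab, zero_comp]
  have h2 : (subobjectSq (G.tail 1)).arrow ≫ G.proj n ≫ g = 0 := by
    have e := imageSubobject_arrow_comp (((G.tail 1).arrow ⊗ₘ (G.tail 1).arrow) ≫ μ[X])
    have e' : factorThruImageSubobject _ ≫ (subobjectSq (G.tail 1)).arrow ≫ G.proj n ≫ g =
        ((G.tail 1).arrow ⊗ₘ (G.tail 1).arrow) ≫ μ[X] ≫ G.proj n ≫ g :=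
      (Category.assoc _ _ _).symm.trans ((congrArg (· ≫ G.proj n ≫ g) e).trans
        (Category.assoc _ _ _))
    have e0 : ((G.tail 1).arrow ⊗ₘ (G.tail 1).arrow) ≫ μ[X] ≫ G.proj n ≫ g = 0 := by
      rw [← h0, ← tensorHom_comp_tensorHom, Category.assoc, h1, comp_zero]
    exact (cancel_epi (factorThruImageSubobject
      (((G.tail 1).arrow ⊗ₘ (G.tail 1).arrow) ≫ μ[X]))).1 (e'.trans (e0.trans comp_zero.symm))
  rw [← ht] at h2
  have e := Subobject.factorThru_arrow _ _ (G.mk_partι_factors_inj (2 ≤ ·) hn)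
  rw [← Category.id_comp g, ← G.inj_proj_self n, ← e, Category.assoc, Category.assoc]
  exact (congrArg _ h2).trans comp_zero

end Mul

section Comul

variable [ComonObj X]

/-! ### Cogeneration in degree one -/

/-- The quotient morphism from `X` by its component of degree zero. -/
abbrev quotZero (G : Grading X) : X ⟶ cokernel (Subobject.mk (G.inj 0)).arrow :=
  cokernel.π (Subobject.mk (G.inj 0)).arrow

lemma inj_quotZero : G.inj 0 ≫ G.quotZero = 0 := by
  have := cokernel.condition (Subobject.mk (G.inj 0)).arrow
  refine (congrArg (· ≫ G.quotZero) (Subobject.underlyingIso_arrow (G.inj 0))).symm.trans ?_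
  exact (Category.assoc _ _ _).trans ((congrArg _ this).trans comp_zero)

lemma exists_quotZero_comp_eq_proj {n : ℕ} (hn : n ≠ 0) : ∃ k, G.quotZero ≫ k = G.proj n :=
  ⟨cokernel.desc _ (G.proj n) (by
    rw [← Subobject.underlyingIso_hom_comp_eq_mk, Category.assoc, G.inj_proj_ne hn.symm,
      comp_zero]), cokernel.π_desc _ _ _⟩

/-- Modulo `X₀` in both tensor factors, only those components of the comultiplication survive for
which both degrees are positive. -/
lemma IsGradedComul.comp_comul_quotZero (h : G.IsGradedComul) {Z : C} {n : ℕ} (g : Z ⟶ G.comp n)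
    (hg : ∀ a b, 1 ≤ a → 1 ≤ b → a + b = n → g ≫ G.comulComp n a b = 0) :
    g ≫ G.inj n ≫ Δ[X] ≫ (G.quotZero ⊗ₘ G.quotZero) = 0 := by
  rw [h.inj_comul_tensorHom, Preadditive.comp_sum]
  refine Finset.sum_eq_zero fun q hq => ?_
  have hq := Finset.HasAntidiagonal.mem_antidiagonal.1 hq
  by_cases h1 : q.1 = 0
  · rw [h1, inj_quotZero]
    simp
  · by_cases h2 : q.2 = 0
    · rw [h2, inj_quotZero]
      simp
    · rw [reassoc_of% hg q.1 q.2 (by omega) (by omega) hq, zero_comp]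

lemma IsGradedComul.head_le_wedge (h : G.IsGradedComul) :
    G.head 2 ≤ wedge (Subobject.mk (G.inj 0)) (Subobject.mk (G.inj 0)) := by
  refine le_kernelSubobject _ _ (G.mk_partι_arrow_comp_eq_zero _ fun n hn => ?_)
  have := h.comp_comul_quotZero (𝟙 (G.comp n)) fun a b ha hb hab => by omega
  rwa [Category.id_comp] at this

lemma IsGradedComul.wedge_le_head (h : G.IsGradedComul)
    (hm : ∀ n, 1 ≤ n → Mono (G.comulComp (n + 1) n 1)) :
    wedge (Subobject.mk (G.inj 0)) (Subobject.mk (G.inj 0)) ≤ G.head 2 := by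
  set W := wedge (Subobject.mk (G.inj 0)) (Subobject.mk (G.inj 0))
  have hW : W.arrow ≫ Δ[X] ≫ (G.quotZero ⊗ₘ G.quotZero) = 0 := kernelSubobject_arrow_comp _
  have hf : (G.head 2).Factors W.arrow := G.mk_partι_factors _ _ fun n hn => by
    obtain ⟨m, rfl⟩ : ∃ m, n = m + 1 := ⟨n - 1, by omega⟩
    have := hm m (by omega)
    -- The component of degrees `m` and `1` of the comultiplication factors through the quotient by
    -- `X₀` in both tensor factors, so it vanishes on `W`.
    obtain ⟨k, hk⟩ := G.exists_quotZero_comp_eq_proj (n := m) (by omega)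
    obtain ⟨l, hl⟩ := G.exists_quotZero_comp_eq_proj (n := 1) (by omega)
    rw [← cancel_mono (G.comulComp (m + 1) m 1), Category.assoc, h.proj_comulComp m 1 _ rfl, ← hk,
      ← hl, ← tensorHom_comp_tensorHom, reassoc_of% hW, zero_comp, zero_comp]
  exact Subobject.le_of_comm _ (Subobject.factorThru_arrow _ _ hf)

/-- If `X(2) = X₀ ∧ X₀`, then an element of degree at least two vanishes as soon as all components
of its comultiplication in smaller positive degrees do. -/
lemma eq_zero_of_comulComp (h : G.IsGradedComul)
    (hw : G.head 2 = wedge (Subobject.mk (G.inj 0)) (Subobject.mk (G.inj 0))) {n : ℕ}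
    (hn : 2 ≤ n) {Z : C} (g : Z ⟶ G.comp n)
    (hg : ∀ a b, 1 ≤ a → 1 ≤ b → a + b = n → g ≫ G.comulComp n a b = 0) : g = 0 := by
  have h1 : (wedge (Subobject.mk (G.inj 0)) (Subobject.mk (G.inj 0))).Factors (g ≫ G.inj n) :=
    kernelSubobject_factors _ _ (by
      rw [Category.assoc]; exact h.comp_comul_quotZero g hg)
  rw [← hw] at h1
  rw [← Category.comp_id g, ← G.inj_proj_self n, ← Category.assoc,
    ← Subobject.factorThru_arrow _ _ h1, Category.assoc]
  exact (congrArg _ (G.mk_partι_arrow_proj (· < 2) (by omega))).trans comp_zero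

end Comul

/-! ### Graded morphisms -/

/-- The inverse of an isomorphism that respects gradings also does. -/
lemma IsGradedHom.inv {Y : C} {K : Grading Y} (e : X ≅ Y) (h : G.IsGradedHom K e.hom) :
    K.IsGradedHom G e.inv := fun n => by
  choose k hk using h
  have h1 : e.hom ≫ K.proj n = G.proj n ≫ k n := G.hom_ext fun m => by
    rw [reassoc_of% hk]
    by_cases hm : m = n
    · subst hm
      rw [K.inj_proj_self, reassoc_of% G.inj_proj_self m, Category.comp_id]
    · rw [K.inj_proj_ne hm, reassoc_of% G.inj_proj_ne hm, comp_zero, zero_comp]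
  have : Epi (k n) := by
    have : Epi (G.proj n ≫ k n) := by rw [← h1]; infer_instance
    exact epi_of_epi (G.proj n) _
  have : Mono (k n) := by
    have : Mono (k n ≫ K.inj n) := by rw [← hk]; infer_instance
    exact mono_of_mono _ (K.inj n)
  have : IsIso (k n) := isIso_of_mono_of_epi _
  exact ⟨CategoryTheory.inv (k n), by
    rw [Iso.comp_inv_eq, Category.assoc, hk, IsIso.inv_hom_id_assoc]⟩

lemma IsGradedHom.comp {Y Z : C} {K : Grading Y} {L : Grading Z} {f : X ⟶ Y} {g : Y ⟶ Z}
    (hf : G.IsGradedHom K f) (hg : K.IsGradedHom L g) : G.IsGradedHom L (f ≫ g) := fun n => by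
  obtain ⟨a, ha⟩ := hf n
  obtain ⟨b, hb⟩ := hg n
  exact ⟨a ≫ b, by rw [reassoc_of% ha, hb, Category.assoc]⟩

end Grading

end Conditions

section QuotientsAndSubobjects

variable {C : Type u} [Category.{v} C] [Abelian C] [MonoidalCategory C] [BraidedCategory C]
  [MonoidalPreadditive C] [HasColimits C] [ExactTensor C]

/-! ### Graded quotients of tensor algebras and graded subcoalgebras of cotensor coalgebras -/

variable {H : C} [BimonObj H] {M : HopfBimodule H} {X : C} {G : Grading X}

open HopfBimodule

/-- In a graded quotient of the tensor algebra, the component of degree `n + 1` is spanned by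
products of elements of degree `n` with elements of degree one. -/
lemma epi_mulComp [MonObj X] (hG : G.IsGradedMul) (f : M.tensorObj ⟶ X) [Epi f]
    (hm : M.tensorMul ≫ f = (f ⊗ₘ f) ≫ μ[X]) (hf : M.tensorGrading.IsGradedHom G f) (n : ℕ) :
    Epi (G.mulComp n 1 (n + 1)) := by
  have hf' : ∀ n, ∃ k : tpow M.bimod n ⟶ G.comp n, M.tIn n ≫ f = k ≫ G.inj n := hf
  choose k hk using hf'
  have h1 : f ≫ G.proj (n + 1) = M.tensorGrading.proj (n + 1) ≫ k (n + 1) :=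
    tensorObj_hom_ext fun m => by
      rw [reassoc_of% hk]
      by_cases hm : m = n + 1
      · subst hm
        rw [G.inj_proj_self, Category.comp_id]
        exact (((Category.assoc _ _ _).symm.trans (congrArg (· ≫ k (n + 1))
          (M.tensorGrading.inj_proj_self (n + 1)))).trans (Category.id_comp _)).symm
      · rw [G.inj_proj_ne hm, comp_zero]
        exact (((Category.assoc _ _ _).symm.trans (congrArg (· ≫ k (n + 1))
          (M.tensorGrading.inj_proj_ne hm))).trans zero_comp).symm
  have : Epi (k (n + 1)) := by
    have : Epi (M.tensorGrading.proj (n + 1) ≫ k (n + 1)) := by rw [← h1]; infer_instance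
    exact epi_of_epi (M.tensorGrading.proj (n + 1)) _
  have h2 : (k n ⊗ₘ k 1) ≫ G.mulComp n 1 (n + 1) = tpowMul M.bimod n 1 ≫ k (n + 1) := by
    rw [← cancel_mono (G.inj (n + 1)), Category.assoc, Category.assoc, hG.mulComp_inj rfl, ← hk,
      ← reassoc_of% tIn_mul, hm, tensorHom_comp_tensorHom_assoc, tensorHom_comp_tensorHom_assoc,
      hk, hk]
  have : Epi ((k n ⊗ₘ k 1) ≫ G.mulComp n 1 (n + 1)) := by rw [h2]; infer_instance
  exact epi_of_epi (k n ⊗ₘ k 1) _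

/-- An element of positive degree of a graded subcoalgebra of the cotensor coalgebra is determined
by the component of its comultiplication whose second tensor factor has degree one. -/
lemma mono_comulComp [ComonObj X] (hG : G.IsGradedComul) (f : X ⟶ M.cotensorObj) [Mono f]
    (hm : f ≫ M.cotensorComul = Δ[X] ≫ (f ⊗ₘ f)) (hf : G.IsGradedHom M.cotensorGrading f)
    (n : ℕ) : Mono (G.comulComp (n + 1) n 1) := by
  have hf' : ∀ n, ∃ k : G.comp n ⟶ M.cpow n, G.inj n ≫ f = k ≫ M.cIn n := hf
  choose k hk using hf'
  have : Mono (k (n + 1)) := by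
    have : Mono (k (n + 1) ≫ M.cIn (n + 1)) := by rw [← hk]; infer_instance
    exact mono_of_mono _ (M.cIn (n + 1))
  have h1 : ∀ n, f ≫ M.cOut n = G.proj n ≫ k n := fun n => G.hom_ext fun m => by
    rw [reassoc_of% hk]
    by_cases hm : m = n
    · subst hm
      rw [M.cIn_cOut_self, reassoc_of% G.inj_proj_self m, Category.comp_id]
    · rw [M.cIn_cOut_ne hm, reassoc_of% G.inj_proj_ne hm, comp_zero, zero_comp]
  have h2 : G.comulComp (n + 1) n 1 ≫ (k n ⊗ₘ k 1) = k (n + 1) ≫ M.cpowComul n 1 := by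
    rw [← cancel_epi (G.proj (n + 1)), reassoc_of% hG.proj_comulComp n 1 (n + 1) rfl,
      tensorHom_comp_tensorHom, ← h1, ← h1, ← reassoc_of% h1, ← M.comul_cOut, reassoc_of% hm,
      tensorHom_comp_tensorHom]
  have : Mono (G.comulComp (n + 1) n 1 ≫ (k n ⊗ₘ k 1)) := by rw [h2]; infer_instance
  exact mono_of_mono _ (k n ⊗ₘ k 1)

end QuotientsAndSubobjects

section Characterization

variable {C : Type u} [Category.{v} C] [Abelian C] [MonoidalCategory C] [BraidedCategory C]
  [MonoidalPreadditive C] [HasColimits C] [ExactTensor C] [AB5 C]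

namespace GradedBialgebra

/-! ### Bialgebras of type one are generated and cogenerated in degree one -/

variable {B : GradedBialgebra C}

lemma IsTypeOne.tail_two (h : B.IsTypeOne) :
    B.grading.tail 2 = subobjectSq (B.grading.tail 1) := by
  obtain ⟨A, ⟨e⟩⟩ := h
  have := A.φ_epi
  have h1 : B.degOne.tensorMul ≫ A.φ = (A.φ ⊗ₘ A.φ) ≫ μ[A.X] := by
    let := A.T.bimon
    have hφ : IsBimonHom A.φ := A.φ_isBimonHom
    rw [← A.T.mul_eq]
    exact hφ.mul_hom
  have h2 : μ[A.X] ≫ e.iso.inv = (e.iso.inv ⊗ₘ e.iso.inv) ≫ μ[B.X] := by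
    rw [Iso.comp_inv_eq, Category.assoc, e.isBimonHom.mul_hom, tensorHom_comp_tensorHom_assoc]
    simp
  have h3 : B.degOne.tensorMul ≫ A.φ ≫ e.iso.inv =
      (A.φ ≫ e.iso.inv ⊗ₘ A.φ ≫ e.iso.inv) ≫ μ[B.X] := by
    rw [reassoc_of% h1, h2, tensorHom_comp_tensorHom_assoc]
  exact le_antisymm (B.mul_graded.tail_le_subobjectSq fun n _ => epi_mulComp B.mul_graded _ h3
    (Grading.IsGradedHom.comp A.φ_isGradedHom (Grading.IsGradedHom.inv e.iso e.isGradedHom)) n)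
    B.mul_graded.subobjectSq_tail_le

lemma IsTypeOne.head_two (h : B.IsTypeOne) : B.grading.head 2 =
    wedge (Subobject.mk (B.grading.inj 0)) (Subobject.mk (B.grading.inj 0)) := by
  obtain ⟨A, ⟨e⟩⟩ := h
  have := A.ψ_mono
  have h1 : A.ψ ≫ B.degOne.cotensorComul = Δ[A.X] ≫ (A.ψ ⊗ₘ A.ψ) := by
    let := A.Tc.bimon
    have hψ : IsBimonHom A.ψ := A.ψ_isBimonHom
    rw [← A.Tc.comul_eq]
    exact hψ.hom_comul
  have h3 : (e.iso.hom ≫ A.ψ) ≫ B.degOne.cotensorComul =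
      Δ[B.X] ≫ (e.iso.hom ≫ A.ψ ⊗ₘ e.iso.hom ≫ A.ψ) := by
    rw [Category.assoc, h1, reassoc_of% e.isBimonHom.hom_comul, tensorHom_comp_tensorHom]
  exact le_antisymm B.comul_graded.head_le_wedge
    (B.comul_graded.wedge_le_head fun n _ => mono_comulComp B.comul_graded _ h3
      (Grading.IsGradedHom.comp e.isGradedHom A.ψ_isGradedHom) n)

/-! ### The canonical morphism from the tensor algebra -/

open HopfBimodule

attribute [local instance] tensorMon ComonObj.instTensorUnit

variable (B) in
/-- The inclusion of the Hopf bimodule `B₁` into `B`. -/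
def injOne : B.degOne.X ⟶ B.X := B.grading.inj 1

variable (B) in
/-- The projection of `B` onto the Hopf bimodule `B₁`. -/
def projOne : B.X ⟶ B.degOne.X := B.grading.proj 1

lemma injOne_projOne : B.injOne ≫ B.projOne = 𝟙 B.degOne.X := B.grading.inj_proj_self 1

variable (B) in
lemma isBimodPair_inj : IsBimodPair B.degOne.bimod (B.grading.inj 0) B.injOne where
  one := (Category.assoc _ _ _).trans B.mul_graded.one_proj_inj
  mul := B.mul_graded.mulComp_inj rfl
  left := B.mul_graded.mulComp_inj rfl
  right := B.mul_graded.mulComp_inj rfl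

variable (B) in
/-- The morphism of algebras `T_{B₀}(B₁) ⟶ B` that extends the inclusions. -/
def fromTensor : B.degOne.tensorObj ⟶ B.X := tensorLift B.isBimodPair_inj

instance : IsMonHom B.fromTensor := inferInstanceAs (IsMonHom (tensorLift B.isBimodPair_inj))

lemma inclZero_fromTensor : B.degOne.inclZero ≫ B.fromTensor = B.grading.inj 0 :=
  inclZero_tensorLift _

lemma inclOne_fromTensor : B.degOne.inclOne ≫ B.fromTensor = B.injOne :=
  inclOne_tensorLift _

/-- The canonical morphism maps the `n`-th tensor power to the component of degree `n` of `B`. -/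
lemma lift_proj_inj (n : ℕ) : B.isBimodPair_inj.lift n ≫ B.grading.proj n ≫ B.grading.inj n =
    B.isBimodPair_inj.lift n := by
  have h1 : B.isBimodPair_inj.lift 1 ≫ B.grading.proj 1 ≫ B.grading.inj 1 =
      B.isBimodPair_inj.lift 1 := by
    rw [← cancel_epi (toTpowOne B.degOne.bimod), reassoc_of% B.isBimodPair_inj.toTpowOne_lift,
      B.isBimodPair_inj.toTpowOne_lift]
    change B.grading.inj 1 ≫ _ = B.grading.inj 1
    rw [reassoc_of% B.grading.inj_proj_self 1]
  induction n with
  | zero =>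
    rw [← cancel_epi (tpowZero B.degOne.bimod).hom, reassoc_of% B.isBimodPair_inj.tpowZero_lift,
      reassoc_of% B.grading.inj_proj_self 0, B.isBimodPair_inj.tpowZero_lift]
  | succ n ih =>
    rw [← cancel_epi (tpowMul B.degOne.bimod n 1),
      reassoc_of% B.isBimodPair_inj.tpowMul_lift n 1, B.isBimodPair_inj.tpowMul_lift,
      B.mul_graded.tensorHom_mul_proj_inj rfl ih h1]

variable (B) in
/-- The component of degree `n` of the canonical morphism from the tensor algebra to `B`. -/
def fromTpow (n : ℕ) : tpow B.degOne.bimod n ⟶ B.grading.comp n :=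
  B.isBimodPair_inj.lift n ≫ B.grading.proj n

lemma fromTpow_inj (n : ℕ) : B.fromTpow n ≫ B.grading.inj n = B.degOne.tIn n ≫ B.fromTensor := by
  rw [fromTpow, Category.assoc, lift_proj_inj, fromTensor, tIn_tensorLift]

lemma tpowMul_fromTpow (a b : ℕ) : tpowMul B.degOne.bimod a b ≫ B.fromTpow (a + b) =
    (B.fromTpow a ⊗ₘ B.fromTpow b) ≫ B.grading.mulComp a b (a + b) := by
  rw [Grading.mulComp, tensorHom_comp_tensorHom_assoc, fromTpow, fromTpow, fromTpow,
    Category.assoc, Category.assoc, lift_proj_inj, lift_proj_inj,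
    reassoc_of% B.isBimodPair_inj.tpowMul_lift]

lemma fromTensor_isGradedHom :
    B.degOne.tensorGrading.IsGradedHom B.grading B.fromTensor :=
  fun n => ⟨B.fromTpow n, (fromTpow_inj n).symm⟩

instance isComonHom_fromTensor :
    letI := B.degOne.tensorBimon
    IsComonHom B.fromTensor :=
  letI := B.degOne.tensorBimon
  { hom_counit := by
      change B.fromTensor ≫ ε[B.X] = B.degOne.tensorCounit
      have : IsMonHom ε[B.X] := ⟨BimonObj.one_counit _, BimonObj.mul_counit _⟩
      refine tensorAlg_hom_ext _ _ ?_ ?_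
      · rw [reassoc_of% inclZero_fromTensor, inclZero_tensorCounit]
        rfl
      · rw [reassoc_of% inclOne_fromTensor, inclOne_tensorCounit,
          ← B.comul_graded.proj_inj_counit]
        change B.grading.inj 1 ≫ _ = 0
        rw [reassoc_of% B.grading.inj_proj_ne one_ne_zero, zero_comp]
    hom_comul := by
      change B.fromTensor ≫ Δ[B.X] = B.degOne.tensorComul ≫ (B.fromTensor ⊗ₘ B.fromTensor)
      have : IsMonHom Δ[B.X] := ⟨BimonObj.one_comul _, BimonObj.mul_comul _⟩
      refine tensorAlg_hom_ext _ _ ?_ ?_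
      · rw [reassoc_of% inclZero_fromTensor, reassoc_of% inclZero_tensorComul,
          tensorHom_comp_tensorHom, inclZero_fromTensor, B.comul_graded.inj_comul]
        simp
        rfl
      · rw [reassoc_of% inclOne_fromTensor, reassoc_of% inclOne_tensorComul,
          Preadditive.add_comp, Category.assoc, Category.assoc, tensorHom_comp_tensorHom,
          tensorHom_comp_tensorHom, inclZero_fromTensor, inclOne_fromTensor]
        refine (B.comul_graded.inj_comul 1).trans ?_
        rw [Finset.Nat.antidiagonal_succ]
        simp
        rfl }

/-- If `B[2] = B[1]²`, then `B` is generated by its components of degree zero and one: for `n ≥ 2`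
the component of degree `n` is spanned by products of elements of smaller positive degree, which by
induction come from the tensor powers. -/
lemma epi_fromTpow (h : B.grading.tail 2 = subobjectSq (B.grading.tail 1)) (n : ℕ) :
    Epi (B.fromTpow n) := by
  induction n using Nat.strong_induction_on with
  | _ n ih =>
    obtain rfl | rfl | hn : n = 0 ∨ n = 1 ∨ 2 ≤ n := by omega
    · refine epi_of_epi_fac (f := (tpowZero B.degOne.bimod).hom) (h := 𝟙 _) ?_
      rw [fromTpow, reassoc_of% B.isBimodPair_inj.tpowZero_lift, B.grading.inj_proj_self]
    · have e : toTpowOne B.degOne.bimod ≫ B.fromTpow 1 = 𝟙 B.degOne.X := by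
        rw [fromTpow, reassoc_of% B.isBimodPair_inj.toTpowOne_lift]
        exact injOne_projOne
      have : Epi (𝟙 B.degOne.X) := inferInstance
      exact @epi_of_epi_fac _ _ _ _ _ _ _ _ this e
    · refine Preadditive.epi_of_cancel_zero _ fun g hg =>
        Grading.eq_zero_of_mulComp B.mul_graded h hn g fun a b ha hb hab => ?_
      subst hab
      have := ih a (by omega)
      have := ih b (by omega)
      rw [← cancel_epi (B.fromTpow a ⊗ₘ B.fromTpow b), comp_zero, ← reassoc_of% tpowMul_fromTpow,
        hg, comp_zero]

lemma epi_fromTensor (h : B.grading.tail 2 = subobjectSq (B.grading.tail 1)) :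
    Epi B.fromTensor :=
  ⟨fun f g hfg => B.grading.hom_ext fun n => by
    have := epi_fromTpow h n
    rw [← cancel_epi (B.fromTpow n), reassoc_of% fromTpow_inj, reassoc_of% fromTpow_inj, hfg]⟩

/-! ### The canonical morphism to the cotensor coalgebra -/

attribute [local instance] cotensorComon

variable (B) in
lemma isBicomodPair_proj : B.degOne.IsBicomodPair (B.grading.proj 0) B.projOne where
  counit := B.comul_graded.proj_inj_counit
  comul := B.comul_graded.proj_comulComp 0 0 0 rfl
  left := B.comul_graded.proj_comulComp 0 1 1 rfl
  right := B.comul_graded.proj_comulComp 1 0 1 rfl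

/-- The component of degree `m` of `B` maps to zero in the `n`-th cotensor power for `n ≠ m`. -/
lemma inj_lift_ne {m n : ℕ} (h : m ≠ n) : B.grading.inj m ≫ B.isBicomodPair_proj.lift n = 0 :=
  B.comul_graded.isHomogeneousFamily.lift_eq_zero B.isBicomodPair_proj
    (fun _ h => B.grading.inj_proj_ne h) (fun _ h => B.grading.inj_proj_ne h) n m h

variable (B) in
/-- The component of degree `n` of the canonical morphism from `B` to the cotensor coalgebra. -/
def toCpow (n : ℕ) : B.grading.comp n ⟶ B.degOne.cpow n :=
  B.grading.inj n ≫ B.isBicomodPair_proj.lift n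

lemma toCpow_zero : B.toCpow 0 ≫ B.degOne.cpowZero.hom = 𝟙 B.degZero := by
  rw [toCpow, Category.assoc, B.isBicomodPair_proj.lift_zero, B.grading.inj_proj_self]

lemma toCpow_one : B.toCpow 1 ≫ B.degOne.cpowOne.hom = 𝟙 B.degOne.X := by
  rw [toCpow, Category.assoc, B.isBicomodPair_proj.lift_one]
  exact injOne_projOne

lemma proj_toCpow (n : ℕ) : B.grading.proj n ≫ B.toCpow n = B.isBicomodPair_proj.lift n :=
  B.grading.hom_ext fun m => by
    by_cases h : m = n
    · subst h
      rw [reassoc_of% B.grading.inj_proj_self m, toCpow]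
    · rw [reassoc_of% B.grading.inj_proj_ne h, zero_comp, inj_lift_ne h]

lemma comulComp_toCpow (a b : ℕ) :
    B.grading.comulComp (a + b) a b ≫ (B.toCpow a ⊗ₘ B.toCpow b) =
      B.toCpow (a + b) ≫ B.degOne.cpowComul a b := by
  rw [Grading.comulComp, Category.assoc, Category.assoc, tensorHom_comp_tensorHom, proj_toCpow,
    proj_toCpow, toCpow, Category.assoc, B.isBicomodPair_proj.lift_comul]

variable (B) in
/-- The morphism of coalgebras from `B` to `T^c_{B₀}(B₁)` that lifts the projections. -/
def toCotensor : B.X ⟶ B.degOne.cotensorObj :=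
  Cofan.IsColimit.desc B.grading.isColimit fun n => B.toCpow n ≫ B.degOne.cIn n

lemma inj_toCotensor (n : ℕ) :
    B.grading.inj n ≫ B.toCotensor = B.toCpow n ≫ B.degOne.cIn n :=
  Cofan.IsColimit.fac B.grading.isColimit _ n

lemma toCotensor_isGradedHom :
    B.grading.IsGradedHom B.degOne.cotensorGrading B.toCotensor :=
  fun n => ⟨B.toCpow n, inj_toCotensor n⟩

lemma toCotensor_cOut (n : ℕ) :
    B.toCotensor ≫ B.degOne.cOut n = B.isBicomodPair_proj.lift n :=
  B.grading.hom_ext fun m => by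
    rw [reassoc_of% inj_toCotensor]
    by_cases h : m = n
    · subst h
      rw [cIn_cOut_self, Category.comp_id, toCpow]
    · rw [cIn_cOut_ne _ h, comp_zero, inj_lift_ne h]

instance : IsComonHom B.toCotensor := B.isBicomodPair_proj.isComonHom _ toCotensor_cOut

lemma toCotensor_coprojZero : B.toCotensor ≫ B.degOne.coprojZero = B.grading.proj 0 :=
  B.isBicomodPair_proj.comp_coprojZero _ toCotensor_cOut

lemma toCotensor_coprojOne : B.toCotensor ≫ B.degOne.coprojOne = B.projOne :=
  B.isBicomodPair_proj.comp_coprojOne _ toCotensor_cOut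

instance isMonHom_toCotensor :
    letI := B.degOne.cotensorBimon
    IsMonHom B.toCotensor :=
  letI := B.degOne.cotensorBimon
  { one_hom := by
      change η[B.X] ≫ B.toCotensor = B.degOne.cotensorOne
      have : IsComonHom η[B.X] := ⟨BimonObj.one_counit _, BimonObj.one_comul _⟩
      refine cotensorCoalg_hom_ext _ _ ?_ ?_
      · rw [Category.assoc, toCotensor_coprojZero, cotensorOne_coprojZero]
        rfl
      · rw [Category.assoc, toCotensor_coprojOne, cotensorOne_coprojOne,
          ← B.mul_graded.one_proj_inj]
        change (_ ≫ _ ≫ _) ≫ B.grading.proj 1 = 0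
        rw [Category.assoc, Category.assoc, B.grading.inj_proj_ne zero_ne_one, comp_zero, comp_zero]
    mul_hom := by
      change μ[B.X] ≫ B.toCotensor = (B.toCotensor ⊗ₘ B.toCotensor) ≫ B.degOne.cotensorMul
      have : IsComonHom μ[B.X] := ⟨BimonObj.mul_counit _, by
        rw [BimonObj.mul_comul, Comon.tensorObj_comul, Category.assoc]⟩
      have := isComonHom_tensorHom B.toCotensor B.toCotensor
      refine cotensorCoalg_hom_ext _ _ ?_ ?_
      · rw [Category.assoc, Category.assoc, toCotensor_coprojZero, cotensorMul_coprojZero,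
          tensorHom_comp_tensorHom_assoc, toCotensor_coprojZero]
        exact B.mul_graded.mul_proj_zero
      · rw [Category.assoc, Category.assoc, toCotensor_coprojOne, cotensorMul_coprojOne,
          Preadditive.comp_add, tensorHom_comp_tensorHom_assoc, tensorHom_comp_tensorHom_assoc,
          toCotensor_coprojZero, toCotensor_coprojOne]
        exact B.mul_graded.mul_proj_one }

/-- If `B(2) = B₀ ∧ B₀`, then `B` is cogenerated by its components of degree zero and one: for
`n ≥ 2` an element of degree `n` is determined by the components of its comultiplication in smaller
positive degrees, which by induction are determined by their images in the cotensor powers. -/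
lemma mono_toCpow (h : B.grading.head 2 =
    wedge (Subobject.mk (B.grading.inj 0)) (Subobject.mk (B.grading.inj 0))) (n : ℕ) :
    Mono (B.toCpow n) := by
  induction n using Nat.strong_induction_on with
  | _ n ih =>
    obtain rfl | rfl | hn : n = 0 ∨ n = 1 ∨ 2 ≤ n := by omega
    · exact mono_of_mono_fac toCpow_zero
    · have : Mono (𝟙 B.degOne.X) := inferInstance
      exact @mono_of_mono_fac _ _ _ _ _ _ _ _ this toCpow_one
    · refine Preadditive.mono_of_cancel_zero _ fun g hg =>
        Grading.eq_zero_of_comulComp B.comul_graded h hn g fun a b ha hb hab => ?_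
      subst hab
      have := ih a (by omega)
      have := ih b (by omega)
      rw [← cancel_mono (B.toCpow a ⊗ₘ B.toCpow b), zero_comp, Category.assoc, comulComp_toCpow,
        reassoc_of% hg, zero_comp]

lemma mono_toCotensor (h : B.grading.head 2 =
    wedge (Subobject.mk (B.grading.inj 0)) (Subobject.mk (B.grading.inj 0))) :
    Mono B.toCotensor :=
  Preadditive.mono_of_cancel_zero _ fun g hg => B.grading.eq_zero_of_comp_proj g fun n => by
    have := mono_toCpow h n
    rw [← cancel_mono (B.toCpow n), Category.assoc, proj_toCpow, ← toCotensor_cOut,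
      reassoc_of% hg, zero_comp, zero_comp]

/-! ### The characterization -/

variable (B) in
/-- Under the two conditions, `B` itself is the image of the canonical morphism from the tensor
algebra to the cotensor coalgebra. -/
def typeOne (ht : B.grading.tail 2 = subobjectSq (B.grading.tail 1)) (hh : B.grading.head 2 =
    wedge (Subobject.mk (B.grading.inj 0)) (Subobject.mk (B.grading.inj 0))) :
    TypeOneBialgebra B.degOne where
  toGradedBialgebra := B
  T := B.degOne.tensorBialgebra
  Tc := B.degOne.cotensorBialgebra
  F := B.fromTensor ≫ B.toCotensor
  F_isMonHom :=
    letI := B.degOne.cotensorBimon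
    letI := B.degOne.tensorBimon
    inferInstanceAs (IsMonHom (B.fromTensor ≫ B.toCotensor))
  inclZero_F := by
    have e : B.toCpow 0 = B.degOne.cpowZero.inv := (Iso.comp_hom_eq_id _).1 toCpow_zero
    rw [reassoc_of% inclZero_fromTensor, inj_toCotensor, coinclZero_eq, e]
  inclOne_F := by
    have e : B.toCpow 1 = B.degOne.cpowOne.inv := (Iso.comp_hom_eq_id _).1 toCpow_one
    rw [reassoc_of% inclOne_fromTensor, coinclOne_eq, ← e]
    exact inj_toCotensor 1
  φ := B.fromTensor
  ψ := B.toCotensor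
  fac := rfl
  φ_epi := epi_fromTensor ht
  ψ_mono := mono_toCotensor hh
  φ_isBimonHom :=
    letI := B.degOne.tensorBimon
    { __ := (inferInstance : IsMonHom B.fromTensor), __ := B.isComonHom_fromTensor }
  ψ_isBimonHom :=
    letI := B.degOne.cotensorBimon
    { __ := B.isMonHom_toCotensor, __ := (inferInstance : IsComonHom B.toCotensor) }
  φ_isGradedHom := fromTensor_isGradedHom
  ψ_isGradedHom := toCotensor_isGradedHom

lemma isCanonicallyTypeOne (ht : B.grading.tail 2 = subobjectSq (B.grading.tail 1))
    (hh : B.grading.head 2 =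
      wedge (Subobject.mk (B.grading.inj 0)) (Subobject.mk (B.grading.inj 0))) :
    B.IsCanonicallyTypeOne := by
  have hid : IsBimonHom (𝟙 B.X) :=
    { __ := (inferInstance : IsMonHom (𝟙 B.X)), __ := (inferInstance : IsComonHom (𝟙 B.X)) }
  refine ⟨B.typeOne ht hh, ⟨Iso.refl B.X, hid, fun n => ⟨𝟙 _, ?_⟩⟩, ?_, ?_⟩
  · exact (Category.comp_id _).trans (Category.id_comp _).symm
  · exact (Category.comp_id _).trans inclZero_fromTensor.symm
  · exact (Category.comp_id _).trans inclOne_fromTensor.symm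

lemma IsCanonicallyTypeOne.isTypeOne (h : B.IsCanonicallyTypeOne) : B.IsTypeOne := by
  obtain ⟨A, e, _⟩ := h
  exact ⟨A, ⟨e⟩⟩

end GradedBialgebra

end Characterization

end

end TypeOne

theorem mainTheorem2 {C : Type u} [Category.{v} C] [Abelian C] [HasLimits C] [HasColimits C]
    [AB5 C] [MonoidalCategory C] [BraidedCategory C] [MonoidalPreadditive C]
    [TypeOne.ExactTensor C] (B : TypeOne.GradedBialgebra C) :
    (B.IsTypeOne ↔
      B.grading.tail 2 = TypeOne.subobjectSq (B.grading.tail 1) ∧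
        B.grading.head 2 =
          TypeOne.wedge (Subobject.mk (B.grading.inj 0)) (Subobject.mk (B.grading.inj 0))) ∧
    (B.IsCanonicallyTypeOne ↔
      B.grading.tail 2 = TypeOne.subobjectSq (B.grading.tail 1) ∧
        B.grading.head 2 =
          TypeOne.wedge (Subobject.mk (B.grading.inj 0)) (Subobject.mk (B.grading.inj 0))) :=
  ⟨⟨fun h => ⟨h.tail_two, h.head_two⟩, fun h =>
      (TypeOne.GradedBialgebra.isCanonicallyTypeOne h.1 h.2).isTypeOne⟩,
    ⟨fun h => ⟨h.isTypeOne.tail_two, h.isTypeOne.head_two⟩, fun h =>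
      TypeOne.GradedBialgebra.isCanonicallyTypeOne h.1 h.2⟩⟩
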